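/- **Theorem 5.14.** A *model category* is a category $\mathsf M$ with all small limits and colimits, with classes $\mathcal F,\mathcal C,\mathcal W$ of morphisms (fibrations, cofibrations, weak equivalences) such that $\mathcal W$ contains the identities and satisfies 2-out-of-3, and $(\mathcal C,\mathcal F\cap\mathcal W)$ and $(\mathcal C\cap\mathcal W,\mathcal F)$ are weak factorization systems. A *dualizable generalized Reedy category* is a small category $\mathsf R$ with a degree function $\deg\colon \operatorname{Ob}\mathsf R\to\mathbb N$ and two wide subcategories $\mathsf R^+,\mathsf R^-$ such that: non-invertible morphisms of $\mathsf R^+$ strictly raise the degree and those of $\mathsf R^-$ strictly lower it; isomorphisms preserve the degree; $\mathsf R^+\cap\mathsf R^-=\mathrm{Iso}(\mathsf R)$; every morphism factors, uniquely up to isomorphism, as a morphism of $\mathsf R^-$ followed by one of $\mathsf R^+$; if $\theta f=f$ with $\theta\in\mathrm{Iso}(\mathsf R)$ and $f\in\mathsf R^-$, then $\theta$ is an identity; and if $f\theta=f$ with $\theta\in\mathrm{Iso}(\mathsf R)$ and $f\in\mathsf R^+$, then $\theta$ is an identity. For $r\in\mathsf R$ and $\Phi\colon\mathsf R\to\mathsf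 M$, let the latching object $L_r\Phi$ be the colimit of $\Phi(s)$ over the category of arrows $u\colon s\to r$ in $\mathsf R^+$ with $\deg s<\deg r$ (and morphisms of $\mathsf R^+$ over $r$), and let the matching object $M_r\Phi$ be the limit of $\Phi(s)$ over the category of arrows $u\colon r\to s$ in $\mathsf R^-$ with $\deg s<\deg r$ (and morphisms of $\mathsf R^-$ under $r$). The group $\mathrm{Aut}(r)$ acts on $\Phi(r)$, on $L_r\Phi$ and on $M_r\Phi$ (by composition on the indexing arrows $u$). Hence a natural transformation $\tau\colon\Phi\to\Psi$ has a component $\tau_r\colon\Phi(r)\to\Psi(r)$, a relative latching map $\ell_r(\tau)\colon\Phi(r)\sqcup_{L_r\Phi}L_r\Psi\to\Psi(r)$ and a relative matching map $m_r(\tau)\colon\Phi(r)\to M_r\Phi\times_{M_r\Psi}\Psi(r)$, all of which are morphisms in $\mathsf M^{\mathrm{Aut}(r)}$, where $\mathrm{Aut}(r)$ is viewed as a one-object category. Let $\mathsf R$ be a dualizable generalized Reedy category and let $\mathsf M$ be an $\mathsf R$-injective model category, that is, for every $r\in\mathsf R$ the category $\mathsf M^{\mathrm{Aut}(r)}$ admits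 the injective model structure: the one whose weak equivalences and cofibrations are the morphisms that are weak equivalences, respectively cofibrations, objectwise in $\mathsf M$. Then $\mathsf M^{\mathsf R}$ is a model category when a map $\tau\colon\Phi\to\Psi$ is called * a weak equivalence if and only if, for every $r\in\mathsf R$, $\tau_r$ is a weak equivalence in the injective model structure on $\mathsf M^{\mathrm{Aut}(r)}$; * a cofibration if and only if, for every $r\in\mathsf R$, $\ell_r(\tau)$ is a cofibration in the injective model structure on $\mathsf M^{\mathrm{Aut}(r)}$; * a fibration if and only if, for every $r\in\mathsf R$, $m_r(\tau)$ is a fibration in the injective model structure on $\mathsf M^{\mathrm{Aut}(r)}$. -/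

import Mathlib

open CategoryTheory Limits HomotopicalAlgebra

universe v u

/-- A generalized Reedy structure on a category `R`: a degree function with natural number
values and two wide subcategories `plus` and `minus`, encoded as multiplicative classes of
morphisms (that is, classes containing the identities and closed under composition). -/
structure GeneralizedReedy (R : Type u) [Category.{v} R] where
  /-- the degree function -/
  deg : R → ℕ
  /-- the morphisms of the wide subcategory of degree-raising maps -/
  plus : MorphismProperty R
  /-- the morphisms of the wide subcategory of degree-lowering maps -/
  minus : MorphismProperty R
  plus_isMultiplicative : plus.IsMultiplicative
  minus_isMultiplicative : minus.IsMultiplicative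
  deg_lt_of_plus {s t : R} (f : s ⟶ t) : plus f → ¬ IsIso f → deg s < deg t
  deg_lt_of_minus {s t : R} (f : s ⟶ t) : minus f → ¬ IsIso f → deg t < deg s
  deg_eq_of_isIso {s t : R} (f : s ⟶ t) : IsIso f → deg s = deg t
  plus_inf_minus : plus ⊓ minus = MorphismProperty.isomorphisms R
  exists_factorization {s t : R} (f : s ⟶ t) :
    ∃ (z : R) (p : s ⟶ z) (i : z ⟶ t), minus p ∧ plus i ∧ p ≫ i = f
  factorization_unique {s t z z' : R} (p : s ⟶ z) (i : z ⟶ t) (p' : s ⟶ z') (i' : z' ⟶ t) :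
    minus p → plus i → minus p' → plus i' → p ≫ i = p' ≫ i' →
      ∃ e : z ≅ z', p ≫ e.hom = p' ∧ e.hom ≫ i' = i
  eq_id_of_minus {s t : R} (f : s ⟶ t) (θ : t ⟶ t) : minus f → IsIso θ → f ≫ θ = f → θ = 𝟙 t

/-- A generalized Reedy structure is dualizable if isomorphisms `θ` such that `f ∘ θ = f`
for some `f` in the degree-raising subcategory are identities. -/
structure DualizableGeneralizedReedy (R : Type u) [Category.{v} R] extends
    GeneralizedReedy R where
  eq_id_of_plus {s t : R} (f : s ⟶ t) (θ : s ⟶ s) : plus f → IsIso θ → θ ≫ f = f → θ = 𝟙 s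

/-- A model structure on the diagram category `D ⥤ M` is the injective one if its weak equivalences
and its cofibrations are determined objectwise in `M`. -/
class IsInjectiveModelStructure (D : Type*) [Category D] (M : Type*) [Category M]
    [ModelCategory M] [ModelCategory (D ⥤ M)] : Prop where
  weakEquivalence_iff_app {Φ Ψ : D ⥤ M} (τ : Φ ⟶ Ψ) :
    WeakEquivalence τ ↔ ∀ d : D, WeakEquivalence (τ.app d)
  cofibration_iff_app {Φ Ψ : D ⥤ M} (τ : Φ ⟶ Ψ) :
    Cofibration τ ↔ ∀ d : D, Cofibration (τ.app d)

/-- The inclusion in `R` of the automorphism group of `r`, seen as a category with one object.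
(In `SingleObj G`, the composition `f ≫ g` is `g * f`, and in `Aut r` the product `g * f` is
`f` followed by `g`.) -/
def autInclusion {R : Type u} [Category.{v} R] (r : R) : SingleObj (Aut r) ⥤ R where
  obj _ := r
  map g := Iso.hom (X := r) (Y := r) g
  map_id _ := rfl
  map_comp _ _ := rfl

/-- Restriction of a natural transformation to `Aut r`: this is its component at `r`, seen as
a morphism in the category of objects with an action of `Aut r`. -/
abbrev autRestrict {R : Type u} [Category.{v} R] {M : Type*} [Category M] (r : R) {Φ Ψ : R ⥤ M}
    (τ : Φ ⟶ Ψ) : autInclusion r ⋙ Φ ⟶ autInclusion r ⋙ Ψ :=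
  Functor.whiskerLeft (autInclusion r) τ

namespace GeneralizedReedy

lemma comp_comp_of_eq {C : Type*} [Category C] {W X Y Z : C} {f : W ⟶ X} {g : X ⟶ Y} {k : W ⟶ Y}
    (e : f ≫ g = k) (h : Y ⟶ Z) : f ≫ g ≫ h = k ≫ h := by
  rw [← Category.assoc, e]

section Index

variable {R : Type u} [Category.{v} R] (ρ : GeneralizedReedy R)

/-- The objects of the slice category of the degree-raising subcategory over `r`, restricted to
objects of degree less than that of `r`. -/
structure LatchingIndex (r : R) where
  /-- the source of the arrow to `r` -/
  obj : R
  /-- the arrow to `r` -/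
  arrow : obj ⟶ r
  plus_arrow : ρ.plus arrow
  deg_lt : ρ.deg obj < ρ.deg r

/-- Morphisms are the degree-raising maps over `r`. -/
@[ext]
structure LatchingIndex.Hom {r : R} (a b : ρ.LatchingIndex r) where
  /-- the underlying morphism -/
  map : a.obj ⟶ b.obj
  plus_map : ρ.plus map
  w : map ≫ b.arrow = a.arrow

instance (r : R) : Category (ρ.LatchingIndex r) where
  Hom a b := LatchingIndex.Hom ρ a b
  id a := ⟨𝟙 a.obj, ρ.plus_isMultiplicative.id_mem a.obj, Category.id_comp _⟩
  comp f g := ⟨f.map ≫ g.map, ρ.plus_isMultiplicative.comp_mem _ _ f.plus_map g.plus_map, by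
    rw [Category.assoc, g.w, f.w]⟩
  id_comp _ := LatchingIndex.Hom.ext (Category.id_comp _)
  comp_id _ := LatchingIndex.Hom.ext (Category.comp_id _)
  assoc _ _ _ := LatchingIndex.Hom.ext (Category.assoc _ _ _)

/-- The objects of the slice category of the degree-lowering subcategory under `r`, restricted to
objects of degree less than that of `r`. -/
structure MatchingIndex (r : R) where
  /-- the target of the arrow from `r` -/
  obj : R
  /-- the arrow from `r` -/
  arrow : r ⟶ obj
  minus_arrow : ρ.minus arrow
  deg_lt : ρ.deg obj < ρ.deg r

/-- Morphisms are the degree-lowering maps under `r`. -/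
@[ext]
structure MatchingIndex.Hom {r : R} (a b : ρ.MatchingIndex r) where
  /-- the underlying morphism -/
  map : a.obj ⟶ b.obj
  minus_map : ρ.minus map
  w : a.arrow ≫ map = b.arrow

instance (r : R) : Category (ρ.MatchingIndex r) where
  Hom a b := MatchingIndex.Hom ρ a b
  id a := ⟨𝟙 a.obj, ρ.minus_isMultiplicative.id_mem a.obj, Category.comp_id _⟩
  comp f g := ⟨f.map ≫ g.map, ρ.minus_isMultiplicative.comp_mem _ _ f.minus_map g.minus_map, by
    rw [← Category.assoc, f.w, g.w]⟩
  id_comp _ := MatchingIndex.Hom.ext (Category.id_comp _)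
  comp_id _ := MatchingIndex.Hom.ext (Category.comp_id _)
  assoc _ _ _ := MatchingIndex.Hom.ext (Category.assoc _ _ _)

/-- The forgetful functor from the latching category to `R`. -/
def latchingForget (r : R) : ρ.LatchingIndex r ⥤ R where
  obj a := a.obj
  map f := LatchingIndex.Hom.map f

/-- The forgetful functor from the matching category to `R`. -/
def matchingForget (r : R) : ρ.MatchingIndex r ⥤ R where
  obj a := a.obj
  map f := MatchingIndex.Hom.map f

variable {ρ} {r : R}

lemma plus_of_aut (g : Aut r) : ρ.plus g.hom := by
  have h : (ρ.plus ⊓ ρ.minus) g.hom := by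
    rw [ρ.plus_inf_minus]; exact Iso.isIso_hom (X := r) (Y := r) g
  exact h.1

lemma minus_of_aut (g : Aut r) : ρ.minus g.hom := by
  have h : (ρ.plus ⊓ ρ.minus) g.hom := by
    rw [ρ.plus_inf_minus]; exact Iso.isIso_hom (X := r) (Y := r) g
  exact h.2

/-- Postcomposition of a degree-raising map with an automorphism. -/
lemma plus_comp_aut {s : R} {u : s ⟶ r} (hu : ρ.plus u) (g : Aut r) : ρ.plus (u ≫ g.hom) :=
  ρ.plus_isMultiplicative.comp_mem _ _ hu (plus_of_aut g)

/-- Precomposition of a degree-lowering map with an automorphism. -/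
lemma minus_aut_comp {s : R} {u : r ⟶ s} (hu : ρ.minus u) (g : Aut r) : ρ.minus (g.hom ≫ u) :=
  ρ.minus_isMultiplicative.comp_mem _ _ (minus_of_aut g) hu

end Index

section Latching

variable {R : Type v} [SmallCategory R] (ρ : GeneralizedReedy R)
  {M : Type u} [Category.{v} M] [HasColimits M] {r : R}

/-- The `r`-th latching object of a diagram. -/
noncomputable def latchingObj (r : R) (Φ : R ⥤ M) : M :=
  colimit (ρ.latchingForget r ⋙ Φ)

/-- The coprojection of the latching object at an arrow `u`. -/
noncomputable def latchingι (Φ : R ⥤ M) {s : R} (u : s ⟶ r) (hu : ρ.plus u)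
    (hs : ρ.deg s < ρ.deg r) : Φ.obj s ⟶ ρ.latchingObj r Φ :=
  colimit.ι (ρ.latchingForget r ⋙ Φ) ⟨s, u, hu, hs⟩

lemma latchingι_w (Φ : R ⥤ M) {s t : R} (w : s ⟶ t) (hw : ρ.plus w) (u : s ⟶ r) (hu : ρ.plus u)
    (hs : ρ.deg s < ρ.deg r) (u' : t ⟶ r) (hu' : ρ.plus u') (ht : ρ.deg t < ρ.deg r)
    (h : w ≫ u' = u) :
    Φ.map w ≫ ρ.latchingι Φ u' hu' ht = ρ.latchingι Φ u hu hs :=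
  colimit.w (ρ.latchingForget r ⋙ Φ)
    (show (⟨s, u, hu, hs⟩ : ρ.LatchingIndex r) ⟶ ⟨t, u', hu', ht⟩ from
      LatchingIndex.Hom.mk w hw h)

/-- The morphism out of the latching object given by a compatible family of morphisms. -/
noncomputable def latchingDesc {Φ : R ⥤ M} {X : M}
    (k : ∀ {s : R} (u : s ⟶ r), ρ.plus u → ρ.deg s < ρ.deg r → (Φ.obj s ⟶ X))
    (hk : ∀ {s t : R} (w : s ⟶ t) (u : s ⟶ r) (hu : ρ.plus u) (hs : ρ.deg s < ρ.deg r)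
      (u' : t ⟶ r) (hu' : ρ.plus u') (ht : ρ.deg t < ρ.deg r),
      ρ.plus w → w ≫ u' = u → Φ.map w ≫ k u' hu' ht = k u hu hs) :
    ρ.latchingObj r Φ ⟶ X :=
  colimit.desc (ρ.latchingForget r ⋙ Φ)
    { pt := X
      ι :=
        { app := fun a => k a.arrow a.plus_arrow a.deg_lt
          naturality := fun a b f =>
            (hk (LatchingIndex.Hom.map f) a.arrow a.plus_arrow a.deg_lt b.arrow b.plus_arrow
              b.deg_lt (LatchingIndex.Hom.plus_map f) (LatchingIndex.Hom.w f)).trans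
              (Category.comp_id _).symm } }

variable {ρ} in
lemma latchingObj_hom_ext {Φ : R ⥤ M} {X : M} {f g : ρ.latchingObj r Φ ⟶ X}
    (h : ∀ {s : R} (u : s ⟶ r) (hu : ρ.plus u) (hs : ρ.deg s < ρ.deg r),
      ρ.latchingι Φ u hu hs ≫ f = ρ.latchingι Φ u hu hs ≫ g) : f = g :=
  colimit.hom_ext fun a => h a.arrow a.plus_arrow a.deg_lt

/-- The action of an automorphism `g` of `r` on the latching object: it sends the summand
indexed by `u` to the summand indexed by `g ∘ u`. -/
noncomputable def latchingAct (Φ : R ⥤ M) (g : Aut r) : ρ.latchingObj r Φ ⟶ ρ.latchingObj r Φ :=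
  ρ.latchingDesc (fun u hu hs => ρ.latchingι Φ (u ≫ g.hom) (plus_comp_aut hu g) hs)
    (fun w _ _ _ _ _ _ hw h => ρ.latchingι_w Φ w hw _ _ _ _ _ _ (by
      rw [← h, Category.assoc]))

lemma latchingι_act (Φ : R ⥤ M) (g : Aut r) {s : R} (u : s ⟶ r) (hu : ρ.plus u)
    (hs : ρ.deg s < ρ.deg r) :
    ρ.latchingι Φ u hu hs ≫ ρ.latchingAct Φ g =
      ρ.latchingι Φ (u ≫ g.hom) (plus_comp_aut hu g) hs :=
  colimit.ι_desc _ (⟨s, u, hu, hs⟩ : ρ.LatchingIndex r)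

/-- The canonical morphism from the latching object of `Φ` to `Φ(r)`, given by the maps `Φ(u)`. -/
noncomputable def latchingObjTo (r : R) (Φ : R ⥤ M) : ρ.latchingObj r Φ ⟶ Φ.obj r :=
  ρ.latchingDesc (fun u _ _ => Φ.map u) (fun _ _ _ _ _ _ _ _ h => by rw [← Φ.map_comp, h])

lemma latchingι_to (Φ : R ⥤ M) {s : R} (u : s ⟶ r) (hu : ρ.plus u) (hs : ρ.deg s < ρ.deg r) :
    ρ.latchingι Φ u hu hs ≫ ρ.latchingObjTo r Φ = Φ.map u :=
  colimit.ι_desc _ (⟨s, u, hu, hs⟩ : ρ.LatchingIndex r)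

/-- The morphism of latching objects induced by a natural transformation. -/
noncomputable def latchingObjMap (r : R) {Φ Ψ : R ⥤ M} (τ : Φ ⟶ Ψ) :
    ρ.latchingObj r Φ ⟶ ρ.latchingObj r Ψ :=
  ρ.latchingDesc (fun {s} u hu hs => τ.app s ≫ ρ.latchingι Ψ u hu hs)
    (fun w _ _ _ _ _ _ hw h => by
      rw [← Category.assoc, τ.naturality, Category.assoc, ρ.latchingι_w Ψ w hw _ _ _ _ _ _ h])

lemma latchingι_map {Φ Ψ : R ⥤ M} (τ : Φ ⟶ Ψ) {s : R} (u : s ⟶ r) (hu : ρ.plus u)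
    (hs : ρ.deg s < ρ.deg r) :
    ρ.latchingι Φ u hu hs ≫ ρ.latchingObjMap r τ = τ.app s ≫ ρ.latchingι Ψ u hu hs :=
  colimit.ι_desc _ (⟨s, u, hu, hs⟩ : ρ.LatchingIndex r)

/-- The `r`-th latching object with its action of `Aut r`. -/
noncomputable def latching (r : R) (Φ : R ⥤ M) : SingleObj (Aut r) ⥤ M where
  obj _ := ρ.latchingObj r Φ
  map g := ρ.latchingAct Φ g
  map_id _ := latchingObj_hom_ext fun u hu hs => by
    refine (ρ.latchingι_act Φ (1 : Aut r) u hu hs).trans ?_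
    rw [Category.comp_id]
    congr 1
    exact Category.comp_id _
  map_comp f g := latchingObj_hom_ext fun u hu hs => by
    refine (ρ.latchingι_act Φ (Mul.mul (α := Aut r) g f) u hu hs).trans ?_
    rw [← Category.assoc, latchingι_act, latchingι_act]
    congr 1
    exact (Category.assoc _ _ _).symm

/-- The canonical map from the `r`-th latching object of `Φ` to `Φ(r)` is equivariant. -/
noncomputable def latchingTo (r : R) (Φ : R ⥤ M) : ρ.latching r Φ ⟶ autInclusion r ⋙ Φ where
  app _ := ρ.latchingObjTo r Φ
  naturality _ _ g := latchingObj_hom_ext (ρ := ρ) fun u hu hs => by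
    refine (comp_comp_of_eq (ρ.latchingι_act Φ g u hu hs) _).trans ?_
    refine (ρ.latchingι_to Φ _ _ _).trans ?_
    refine Eq.trans ?_ (comp_comp_of_eq (ρ.latchingι_to Φ u hu hs) _).symm
    exact Φ.map_comp _ _

/-- Functoriality of the latching object with its action of `Aut r`. -/
noncomputable def latchingMap (r : R) {Φ Ψ : R ⥤ M} (τ : Φ ⟶ Ψ) :
    ρ.latching r Φ ⟶ ρ.latching r Ψ where
  app _ := ρ.latchingObjMap r τ
  naturality _ _ g := latchingObj_hom_ext (ρ := ρ) fun u hu hs => by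
    refine (comp_comp_of_eq (ρ.latchingι_act Φ g u hu hs) _).trans ?_
    refine (ρ.latchingι_map τ _ _ _).trans ?_
    refine Eq.trans ?_ (comp_comp_of_eq (ρ.latchingι_map τ u hu hs) _).symm
    refine Eq.trans ?_ (Category.assoc _ _ _).symm
    exact congrArg (τ.app _ ≫ ·) (ρ.latchingι_act Ψ g u hu hs).symm

lemma latchingTo_naturality (r : R) {Φ Ψ : R ⥤ M} (τ : Φ ⟶ Ψ) :
    ρ.latchingTo r Φ ≫ autRestrict r τ = ρ.latchingMap r τ ≫ ρ.latchingTo r Ψ :=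
  NatTrans.ext <| funext fun _ => latchingObj_hom_ext (ρ := ρ) fun u hu hs => by
    refine (comp_comp_of_eq (ρ.latchingι_to Φ u hu hs) _).trans ?_
    refine Eq.trans ?_ (comp_comp_of_eq (ρ.latchingι_map τ u hu hs) _).symm
    refine Eq.trans ?_ (Category.assoc _ _ _).symm
    exact (τ.naturality u).trans (congrArg (τ.app _ ≫ ·) (ρ.latchingι_to Ψ u hu hs).symm)

/-- The relative latching map `Φ(r) ⊔_{L_r Φ} L_r Ψ ⟶ Ψ(r)` of `τ`, as a morphism in the
category of objects of `M` with an action of `Aut r`. -/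
noncomputable def relativeLatchingMap (r : R) {Φ Ψ : R ⥤ M} (τ : Φ ⟶ Ψ) :
    pushout (ρ.latchingTo r Φ) (ρ.latchingMap r τ) ⟶ autInclusion r ⋙ Ψ :=
  pushout.desc (autRestrict r τ) (ρ.latchingTo r Ψ) (ρ.latchingTo_naturality r τ)

end Latching

section Matching

variable {R : Type v} [SmallCategory R] (ρ : GeneralizedReedy R)
  {M : Type u} [Category.{v} M] [HasLimits M] {r : R}

/-- The `r`-th matching object of a diagram. -/
noncomputable def matchingObj (r : R) (Φ : R ⥤ M) : M :=
  limit (ρ.matchingForget r ⋙ Φ)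

/-- The projection of the matching object at an arrow `u`. -/
noncomputable def matchingπ (Φ : R ⥤ M) {s : R} (u : r ⟶ s) (hu : ρ.minus u)
    (hs : ρ.deg s < ρ.deg r) : ρ.matchingObj r Φ ⟶ Φ.obj s :=
  limit.π (ρ.matchingForget r ⋙ Φ) ⟨s, u, hu, hs⟩

lemma matchingπ_w (Φ : R ⥤ M) {s t : R} (w : s ⟶ t) (hw : ρ.minus w) (u : r ⟶ s)
    (hu : ρ.minus u) (hs : ρ.deg s < ρ.deg r) (u' : r ⟶ t) (hu' : ρ.minus u')
    (ht : ρ.deg t < ρ.deg r) (h : u ≫ w = u') :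
    ρ.matchingπ Φ u hu hs ≫ Φ.map w = ρ.matchingπ Φ u' hu' ht :=
  limit.w (ρ.matchingForget r ⋙ Φ)
    (show (⟨s, u, hu, hs⟩ : ρ.MatchingIndex r) ⟶ ⟨t, u', hu', ht⟩ from
      MatchingIndex.Hom.mk w hw h)

/-- The morphism to the matching object given by a compatible family of morphisms. -/
noncomputable def matchingLift {Φ : R ⥤ M} {X : M}
    (k : ∀ {s : R} (u : r ⟶ s), ρ.minus u → ρ.deg s < ρ.deg r → (X ⟶ Φ.obj s))
    (hk : ∀ {s t : R} (w : s ⟶ t) (u : r ⟶ s) (hu : ρ.minus u) (hs : ρ.deg s < ρ.deg r)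
      (u' : r ⟶ t) (hu' : ρ.minus u') (ht : ρ.deg t < ρ.deg r),
      ρ.minus w → u ≫ w = u' → k u hu hs ≫ Φ.map w = k u' hu' ht) :
    X ⟶ ρ.matchingObj r Φ :=
  limit.lift (ρ.matchingForget r ⋙ Φ)
    { pt := X
      π :=
        { app := fun a => k a.arrow a.minus_arrow a.deg_lt
          naturality := fun a b f =>
            (Category.id_comp _).trans
              (hk (MatchingIndex.Hom.map f) a.arrow a.minus_arrow a.deg_lt b.arrow b.minus_arrow
                b.deg_lt (MatchingIndex.Hom.minus_map f) (MatchingIndex.Hom.w f)).symm } }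

variable {ρ} in
lemma matchingObj_hom_ext {Φ : R ⥤ M} {X : M} {f g : X ⟶ ρ.matchingObj r Φ}
    (h : ∀ {s : R} (u : r ⟶ s) (hu : ρ.minus u) (hs : ρ.deg s < ρ.deg r),
      f ≫ ρ.matchingπ Φ u hu hs = g ≫ ρ.matchingπ Φ u hu hs) : f = g :=
  limit.hom_ext fun a => h a.arrow a.minus_arrow a.deg_lt

/-- The action of an automorphism `g` of `r` on the matching object: its component at `u` is
the projection indexed by `u ∘ g`. -/
noncomputable def matchingAct (Φ : R ⥤ M) (g : Aut r) : ρ.matchingObj r Φ ⟶ ρ.matchingObj r Φ :=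
  ρ.matchingLift (fun u hu hs => ρ.matchingπ Φ (g.hom ≫ u) (minus_aut_comp hu g) hs)
    (fun w _ _ _ _ _ _ hw h => ρ.matchingπ_w Φ w hw _ _ _ _ _ _ (by
      rw [← h, Category.assoc]))

lemma matchingAct_π (Φ : R ⥤ M) (g : Aut r) {s : R} (u : r ⟶ s) (hu : ρ.minus u)
    (hs : ρ.deg s < ρ.deg r) :
    ρ.matchingAct Φ g ≫ ρ.matchingπ Φ u hu hs =
      ρ.matchingπ Φ (g.hom ≫ u) (minus_aut_comp hu g) hs :=
  limit.lift_π _ (⟨s, u, hu, hs⟩ : ρ.MatchingIndex r)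

/-- The canonical morphism from `Φ(r)` to the matching object of `Φ`, given by the maps `Φ(u)`. -/
noncomputable def toMatchingObj (r : R) (Φ : R ⥤ M) : Φ.obj r ⟶ ρ.matchingObj r Φ :=
  ρ.matchingLift (fun u _ _ => Φ.map u) (fun _ _ _ _ _ _ _ _ h => by rw [← Φ.map_comp, h])

lemma toMatchingObj_π (Φ : R ⥤ M) {s : R} (u : r ⟶ s) (hu : ρ.minus u)
    (hs : ρ.deg s < ρ.deg r) :
    ρ.toMatchingObj r Φ ≫ ρ.matchingπ Φ u hu hs = Φ.map u :=
  limit.lift_π _ (⟨s, u, hu, hs⟩ : ρ.MatchingIndex r)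

/-- The morphism of matching objects induced by a natural transformation. -/
noncomputable def matchingObjMap (r : R) {Φ Ψ : R ⥤ M} (τ : Φ ⟶ Ψ) :
    ρ.matchingObj r Φ ⟶ ρ.matchingObj r Ψ :=
  ρ.matchingLift (fun {s} u hu hs => ρ.matchingπ Φ u hu hs ≫ τ.app s)
    (fun w _ _ _ _ _ _ hw h => by
      rw [Category.assoc, ← τ.naturality, ← Category.assoc, ρ.matchingπ_w Φ w hw _ _ _ _ _ _ h])

lemma matchingObjMap_π {Φ Ψ : R ⥤ M} (τ : Φ ⟶ Ψ) {s : R} (u : r ⟶ s) (hu : ρ.minus u)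
    (hs : ρ.deg s < ρ.deg r) :
    ρ.matchingObjMap r τ ≫ ρ.matchingπ Ψ u hu hs = ρ.matchingπ Φ u hu hs ≫ τ.app s :=
  limit.lift_π _ (⟨s, u, hu, hs⟩ : ρ.MatchingIndex r)

/-- The `r`-th matching object with its action of `Aut r`. -/
noncomputable def matching (r : R) (Φ : R ⥤ M) : SingleObj (Aut r) ⥤ M where
  obj _ := ρ.matchingObj r Φ
  map g := ρ.matchingAct Φ g
  map_id _ := matchingObj_hom_ext fun u hu hs => by
    refine (ρ.matchingAct_π Φ (1 : Aut r) u hu hs).trans ?_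
    rw [Category.id_comp]
    congr 1
    exact Category.id_comp _
  map_comp f g := matchingObj_hom_ext fun u hu hs => by
    refine (ρ.matchingAct_π Φ (Mul.mul (α := Aut r) g f) u hu hs).trans ?_
    rw [Category.assoc, matchingAct_π, matchingAct_π]
    congr 1
    exact Category.assoc _ _ _

/-- The canonical map from `Φ(r)` to the `r`-th matching object of `Φ` is equivariant. -/
noncomputable def toMatching (r : R) (Φ : R ⥤ M) : autInclusion r ⋙ Φ ⟶ ρ.matching r Φ where
  app _ := ρ.toMatchingObj r Φ
  naturality _ _ g := matchingObj_hom_ext (ρ := ρ) fun u hu hs => by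
    refine (Category.assoc _ _ _).trans ?_
    refine (congrArg (_ ≫ ·) (ρ.toMatchingObj_π Φ u hu hs)).trans ?_
    refine Eq.trans ?_ (Category.assoc _ _ _).symm
    refine Eq.trans ?_ (congrArg (_ ≫ ·) (ρ.matchingAct_π Φ g u hu hs)).symm
    refine Eq.trans ?_ (ρ.toMatchingObj_π Φ _ _ _).symm
    exact (Φ.map_comp _ _).symm

/-- Functoriality of the matching object with its action of `Aut r`. -/
noncomputable def matchingMap (r : R) {Φ Ψ : R ⥤ M} (τ : Φ ⟶ Ψ) :
    ρ.matching r Φ ⟶ ρ.matching r Ψ where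
  app _ := ρ.matchingObjMap r τ
  naturality _ _ g := matchingObj_hom_ext (ρ := ρ) fun {s} u hu hs => by
    refine (Category.assoc _ _ _).trans ?_
    refine (congrArg (_ ≫ ·) (ρ.matchingObjMap_π τ u hu hs)).trans ?_
    refine (Category.assoc _ _ _).symm.trans ?_
    refine (congrArg (· ≫ τ.app s) (ρ.matchingAct_π Φ g u hu hs)).trans ?_
    refine Eq.trans ?_ (Category.assoc _ _ _).symm
    refine Eq.trans ?_ (congrArg (_ ≫ ·) (ρ.matchingAct_π Ψ g u hu hs)).symm
    exact (ρ.matchingObjMap_π τ _ _ _).symm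

lemma toMatching_naturality (r : R) {Φ Ψ : R ⥤ M} (τ : Φ ⟶ Ψ) :
    ρ.toMatching r Φ ≫ ρ.matchingMap r τ = autRestrict r τ ≫ ρ.toMatching r Ψ :=
  NatTrans.ext <| funext fun _ => matchingObj_hom_ext (ρ := ρ) fun {s} u hu hs => by
    refine (Category.assoc _ _ _).trans ?_
    refine (congrArg (_ ≫ ·) (ρ.matchingObjMap_π τ u hu hs)).trans ?_
    refine (comp_comp_of_eq (ρ.toMatchingObj_π Φ u hu hs) _).trans ?_
    refine Eq.trans ?_ (Category.assoc _ _ _).symm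
    exact (τ.naturality u).trans (congrArg (_ ≫ ·) (ρ.toMatchingObj_π Ψ u hu hs).symm)

/-- The relative matching map `Φ(r) ⟶ M_r Φ ×_{M_r Ψ} Ψ(r)` of `τ`, as a morphism in the
category of objects of `M` with an action of `Aut r`. -/
noncomputable def relativeMatchingMap (r : R) {Φ Ψ : R ⥤ M} (τ : Φ ⟶ Ψ) :
    autInclusion r ⋙ Φ ⟶ pullback (ρ.matchingMap r τ) (ρ.toMatching r Ψ) :=
  pullback.lift (ρ.toMatching r Φ) (autRestrict r τ) (ρ.toMatching_naturality r τ)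

end Matching

end GeneralizedReedy

/-! At an object `r`, the latching and matching objects depend only on degrees below `deg r`.
Extending a partially defined diagram or transformation to degree `deg r` is therefore one problem
in `M^{Aut r}` per isomorphism class of objects. Non-invertible maps between objects of equal degree
add no condition, because they factor through a lower degree.

For lifting, a filler known in lower degrees turns the problem at `r` into a square from a relative
latching map to a relative matching map (`exists_lift_of_degreewise`,
`hasLiftingProperty_of_relative`).

For factorization, restriction to the objects of degree less than `n` has both Kan extensions as
adjoints. Maps left orthogonal to the transformations inverted by this restriction have invertible
relative latching maps at the objects of degree `n`, and dually for right orthogonal maps and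
matching (`isIso_relativeLatchingMap_of_leftOrth`, `isIso_relativeMatchingMap_of_rightOrth`). A
factorization `A ⟶ P ⟶ Y` whose first map is left orthogonal in this sense is improved as follows.
Split `P ⟶ Y` into a map `P ⟶ Q` invertible below `n` and a right orthogonal map. In degree `n` the
map `P ⟶ Q` is then, up to isomorphism, the one from the latching pushout to the matching pullback,
and it is factored equivariantly there (`exists_factorization_step`). The colimit of these
improvements has the required relative maps (`exists_factorization_relative`).

It remains to recognize the trivial classes: a cofibration is an objectwise weak equivalence exactly
when its relative latching maps are weak equivalences, and dually for fibrations. The point is that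
`L_r τ` is a trivial cofibration of `M` as soon as the relative latching maps of lower degree are
(`hasLiftingProperty_latchingObjMap`). The axiom `eq_id_of_plus` makes the automorphisms of an arrow
in the latching category trivial, so lifts can be chosen in `M` without equivariance. Matching
objects use `eq_id_of_minus` and the fact that injective fibrations are fibrations of the underlying
objects (`fibration_app_of_injective`). Lifting, factorization and closure under retracts then give
both weak factorization systems. -/

namespace CategoryTheory

/-! ### Representatives of isomorphism classes -/

/-- A chosen representative of the isomorphism class of an object. -/
noncomputable def isoRep {C : Type*} [Category C] (c : C) : C :=
  _root_.Quotient.out (s := isIsomorphicSetoid C) (_root_.Quotient.mk _ c)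

/-- An isomorphism from an object to the chosen representative of its isomorphism class. -/
noncomputable def isoToRep {C : Type*} [Category C] (c : C) : c ≅ isoRep c :=
  ((_root_.Quotient.exact (s := isIsomorphicSetoid C)
    (_root_.Quotient.out_eq (s := isIsomorphicSetoid C) (_root_.Quotient.mk _ c))) :
      Nonempty (isoRep c ≅ c)).some.symm

/-- The representatives agree as objects, so conjugation by `isoToRep` turns an isomorphism into an
automorphism of a single object. -/
lemma isoRep_eq {C : Type*} [Category C] {c d : C} (e : c ≅ d) : isoRep c = isoRep d := by
  unfold isoRep
  rw [_root_.Quotient.sound (s := isIsomorphicSetoid C) (a := c) (b := d) ⟨e⟩]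

/-! ### Diagonal fillers by induction on the degree -/

section DegreewiseLift

variable {C : Type*} [Category C] {M : Type*} [Category M] (deg : C → ℕ)

/-- A diagonal filler of a square of natural transformations, defined on the objects of degree
less than `n`. -/
structure PartialLift {A B X Y : C ⥤ M} (i : A ⟶ B) (p : X ⟶ Y) (t : A ⟶ X) (b : B ⟶ Y)
    (n : ℕ) where
  /-- the components of the filler -/
  app (s : C) (hs : deg s < n) : B.obj s ⟶ X.obj s
  naturality {s s' : C} (hs : deg s < n) (hs' : deg s' < n) (f : s ⟶ s') :
    B.map f ≫ app s' hs' = app s hs ≫ X.map f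
  fac_left (s : C) (hs : deg s < n) : i.app s ≫ app s hs = t.app s
  fac_right (s : C) (hs : deg s < n) : app s hs ≫ p.app s = b.app s

variable {deg} {A B X Y : C ⥤ M} {i : A ⟶ B} {p : X ⟶ Y} {t : A ⟶ X} {b : B ⟶ Y}

/-- An equivariant extension of a partial filler to an object of degree `n`. -/
structure PartialLift.IsExtension {n : ℕ} (L : PartialLift deg i p t b n) {r : C}
    (k : B.obj r ⟶ X.obj r) : Prop where
  fac_left : i.app r ≫ k = t.app r
  fac_right : k ≫ p.app r = b.app r
  aut (g : r ≅ r) : B.map g.hom ≫ k = k ≫ X.map g.hom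
  naturality_left (s : C) (hs : deg s < n) (f : s ⟶ r) : B.map f ≫ k = L.app s hs ≫ X.map f
  naturality_right (s : C) (hs : deg s < n) (f : r ⟶ s) : k ≫ X.map f = B.map f ≫ L.app s hs

/-- Extensions at different objects of degree `n` need not be compatible with isomorphisms. Hence
only those at representatives are kept and carried to the other objects by conjugation. Equivariance
then gives naturality for isomorphisms, and every other map in degree `n` passes through a lower
degree, where compatibility is already known. -/
lemma PartialLift.exists_succ
    (deg_iso : ∀ {c d : C} (_ : c ≅ d), deg c = deg d)
    (deg_fac : ∀ {c d : C} (f : c ⟶ d), deg c = deg d → ¬ IsIso f →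
      ∃ (z : C) (a : c ⟶ z) (e : z ⟶ d), deg z < deg c ∧ a ≫ e = f)
    {n : ℕ} (L : PartialLift deg i p t b n)
    (hL : ∀ r : C, deg r = n → ∃ k : B.obj r ⟶ X.obj r, L.IsExtension k) :
    ∃ L' : PartialLift deg i p t b (n + 1), ∀ (s : C) (hs : deg s < n),
      L'.app s (hs.trans n.lt_succ_self) = L.app s hs := by
  choose k hk using hL
  have hrep : ∀ {c : C}, deg c = n → deg (isoRep c) = n := fun {c} hc => by
    rw [← hc, deg_iso (isoToRep c)]
  -- The representatives of isomorphic objects are only propositionally equal, so equivariance is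
  -- restated for isomorphisms between equal objects.
  have cast : ∀ {r r' : C} (hr : deg r = n) (hr' : deg r' = n) (_ : r = r') (g : r ≅ r'),
      B.map g.hom ≫ k r' hr' = k r hr ≫ X.map g.hom := by
    intro r r' hr hr' h g
    subst h
    exact (hk r hr).aut g
  let l : ∀ (c : C) (_ : deg c = n), B.obj c ⟶ X.obj c := fun c hc =>
    B.map (isoToRep c).hom ≫ k (isoRep c) (hrep hc) ≫ X.map (isoToRep c).inv
  have l_left : ∀ (s c : C) (hs : deg s < n) (hc : deg c = n) (f : s ⟶ c),
      B.map f ≫ l c hc = L.app s hs ≫ X.map f := by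
    intro s c hs hc f
    have := (hk _ (hrep hc)).naturality_left s hs (f ≫ (isoToRep c).hom)
    simp only [Functor.map_comp, Category.assoc] at this
    simp only [l]
    rw [reassoc_of% this, ← X.map_comp]
    simp
  have l_right : ∀ (s c : C) (hs : deg s < n) (hc : deg c = n) (f : c ⟶ s),
      l c hc ≫ X.map f = B.map f ≫ L.app s hs := by
    intro s c hs hc f
    have := (hk _ (hrep hc)).naturality_right s hs ((isoToRep c).inv ≫ f)
    simp only [l, Category.assoc, ← X.map_comp, this]
    rw [← Category.assoc, ← B.map_comp]
    simp
  have l_iso : ∀ (c d : C) (hc : deg c = n) (hd : deg d = n) (f : c ≅ d),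
      B.map f.hom ≫ l d hd = l c hc ≫ X.map f.hom := by
    intro c d hc hd f
    have := cast (hrep hc) (hrep hd) (isoRep_eq f) ((isoToRep c).symm ≪≫ f ≪≫ isoToRep d)
    simp only [Iso.trans_hom, Iso.symm_hom, Functor.map_comp, Category.assoc] at this
    simp only [l, Category.assoc]
    rw [← cancel_epi (B.map (isoToRep c).inv), reassoc_of% this]
    simp
  have l_nat : ∀ (c d : C) (hc : deg c = n) (hd : deg d = n) (f : c ⟶ d),
      B.map f ≫ l d hd = l c hc ≫ X.map f := by
    intro c d hc hd f
    by_cases hf : IsIso f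
    · exact l_iso c d hc hd (asIso f)
    · obtain ⟨z, a, e, hz, rfl⟩ := deg_fac f (hc.trans hd.symm) hf
      rw [B.map_comp, X.map_comp, Category.assoc, l_left z d (by omega) hd,
        ← reassoc_of% (l_right z c (by omega) hc a)]
  refine ⟨⟨fun s hs => if h : deg s < n then L.app s h else l s (by omega), ?_, ?_, ?_⟩, ?_⟩
  · intro s s' hs hs' f
    by_cases h : deg s < n <;> by_cases h' : deg s' < n
    · simpa only [dif_pos h, dif_pos h'] using L.naturality h h' f
    · simpa only [dif_pos h, dif_neg h'] using l_left s s' h (by omega) f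
    · simpa only [dif_neg h, dif_pos h'] using (l_right s' s h' (by omega) f).symm
    · simpa only [dif_neg h, dif_neg h'] using l_nat s s' (by omega) (by omega) f
  · intro s hs
    by_cases h : deg s < n
    · simpa only [dif_pos h] using L.fac_left s h
    · simp only [dif_neg h, l]
      rw [← NatTrans.naturality_assoc, reassoc_of% (hk _ _).fac_left, ← t.naturality]
      simp
  · intro s hs
    by_cases h : deg s < n
    · simpa only [dif_pos h] using L.fac_right s h
    · simp only [dif_neg h, l, Category.assoc, NatTrans.naturality]
      rw [reassoc_of% (hk _ _).fac_right, ← b.naturality]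
      simp
  · intro s hs
    simp only [dif_pos hs]

/-- If the objects of a category have degrees such that all non-invertible morphisms between
objects of the same degree factor through an object of smaller degree, then diagonal fillers can
be constructed by induction on the degree. -/
theorem exists_lift_of_degreewise
    (deg_iso : ∀ {c d : C} (_ : c ≅ d), deg c = deg d)
    (deg_fac : ∀ {c d : C} (f : c ⟶ d), deg c = deg d → ¬ IsIso f →
      ∃ (z : C) (a : c ⟶ z) (e : z ⟶ d), deg z < deg c ∧ a ≫ e = f)
    (h : ∀ (r : C) (L : PartialLift deg i p t b (deg r)),
      ∃ k : B.obj r ⟶ X.obj r, L.IsExtension k) :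
    ∃ l : B ⟶ X, i ≫ l = t ∧ l ≫ p = b := by
  have step : ∀ (n : ℕ) (L : PartialLift deg i p t b n),
      ∃ L' : PartialLift deg i p t b (n + 1), ∀ (s : C) (hs : deg s < n),
        L'.app s (hs.trans n.lt_succ_self) = L.app s hs := fun n L =>
    L.exists_succ deg_iso deg_fac fun r hr => by subst hr; exact h r L
  choose next hnext using step
  let F : ∀ n, PartialLift deg i p t b n := fun n => Nat.rec
    ⟨fun s hs => absurd hs (Nat.not_lt_zero _), fun hs => absurd hs (Nat.not_lt_zero _),
      fun s hs => absurd hs (Nat.not_lt_zero _), fun s hs => absurd hs (Nat.not_lt_zero _)⟩ next n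
  -- Each stage strictly extends the previous one, so the component at an object never changes once
  -- it is defined.
  have hF : ∀ (m n : ℕ) (hmn : m ≤ n) (s : C) (hs : deg s < m),
      (F n).app s (hs.trans_le hmn) = (F m).app s hs := by
    intro m n hmn
    induction n, hmn using Nat.le_induction with
    | base => intros; rfl
    | succ n hmn ih => exact fun s hs => (hnext n (F n) s (hs.trans_le hmn)).trans (ih s hs)
  -- Stage `deg s + 1` is the first at which the component at `s` exists; for naturality, both
  -- components are compared at a common later stage.
  refine ⟨{ app := fun s => (F (deg s + 1)).app s (Nat.lt_succ_self _), naturality := ?_ }, ?_, ?_⟩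
  · intro s s' f
    have h1 := hF _ (max (deg s) (deg s') + 1) (by simp) s (Nat.lt_succ_self (deg s))
    have h2 := hF _ (max (deg s) (deg s') + 1) (by simp) s' (Nat.lt_succ_self (deg s'))
    rw [← h1, ← h2]
    exact (F _).naturality _ _ f
  · ext s
    exact (F (deg s + 1)).fac_left s _
  · ext s
    exact (F (deg s + 1)).fac_right s _

end DegreewiseLift

/-! ### Gluing a functor from values at objects -/

section Gluing

variable {C : Type*} [Category C] {M : Type*} [Category M]

/-- A factorization of a natural transformation `α` on isomorphisms extends to a factorization
through a functor, provided all non-invertible morphisms factor through objects at which `α` is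
invertible, in an essentially unique way. -/
theorem exists_glued_functor (S : C → Prop) {P Q : C ⥤ M} (α : P ⟶ Q)
    (β : ∀ z, S z → (Q.obj z ⟶ P.obj z))
    (hαβ : ∀ z (hz : S z), α.app z ≫ β z hz = 𝟙 _)
    (hβα : ∀ z (hz : S z), β z hz ≫ α.app z = 𝟙 _)
    (hS : ∀ {c d z z' : C} (a : c ⟶ z) (b : z ⟶ d) (a' : c ⟶ z') (b' : z' ⟶ d) (hz : S z)
      (hz' : S z'), a ≫ b = a' ≫ b' →
        Q.map a ≫ β z hz ≫ P.map b = Q.map a' ≫ β z' hz' ≫ P.map b')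
    (hfac : ∀ {c d : C} (f : c ⟶ d), (∃ (z : C) (a : c ⟶ z) (b : z ⟶ d), S z ∧ a ≫ b = f) ∨
      IsIso f)
    (hid : ∀ {c z : C} (a : c ⟶ z) (b : z ⟶ c), S z → a ≫ b = 𝟙 c → S c)
    (X : C → M) (p : ∀ c, P.obj c ⟶ X c) (q : ∀ c, X c ⟶ Q.obj c)
    (hpq : ∀ c, p c ≫ q c = α.app c) (hp : ∀ c, S c → IsIso (p c))
    (m : ∀ {c d : C} (_ : c ≅ d), X c ⟶ X d) (m_id : ∀ c, m (Iso.refl c) = 𝟙 _)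
    (m_comp : ∀ {c d e : C} (f : c ≅ d) (g : d ≅ e), m (f ≪≫ g) = m f ≫ m g)
    (hmp : ∀ {c d : C} (f : c ≅ d), P.map f.hom ≫ p d = p c ≫ m f)
    (hmq : ∀ {c d : C} (f : c ≅ d), m f ≫ q d = q c ≫ Q.map f.hom) :
    ∃ (Z : C ⥤ M) (p' : P ⟶ Z) (q' : Z ⟶ Q) (e : ∀ c, Z.obj c ≅ X c),
      (∀ c, p'.app c ≫ (e c).hom = p c) ∧ (∀ c, (e c).hom ≫ q c = q'.app c) ∧
      ∀ c (g : c ≅ c), ¬ S c → Z.map g.hom ≫ (e c).hom = (e c).hom ≫ m g := by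
  classical
  -- Arrows in `T` form an ideal: they factor through an object where `α` is invertible.
  let T : ∀ {c d : C}, (c ⟶ d) → Prop := fun {c d} f =>
    ∃ (z : C) (a : c ⟶ z) (b : z ⟶ d), S z ∧ a ≫ b = f
  -- On `T` the value is forced: go to `Q`, cross to `P` by the inverse `β`, and come back to `X`.
  -- By `hS` the choice of factorization is immaterial. Outside `T` the arrow is an isomorphism and
  -- the given action `m` is used.
  let zmap : ∀ {c d : C}, (c ⟶ d) → (X c ⟶ X d) := fun {c d} f =>
    if h : T f then q c ≫ Q.map h.choose_spec.choose ≫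
      β h.choose h.choose_spec.choose_spec.choose_spec.1 ≫
        P.map h.choose_spec.choose_spec.choose ≫ p d
    else have := (hfac f).resolve_left h; m (asIso f)
  have zmap_of_fac : ∀ {c d z : C} (f : c ⟶ d) (a : c ⟶ z) (b : z ⟶ d) (hz : S z),
      a ≫ b = f → zmap f = q c ≫ Q.map a ≫ β z hz ≫ P.map b ≫ p d := by
    intro c d z f a b hz hab
    have h : T f := ⟨z, a, b, hz, hab⟩
    have := hS a b h.choose_spec.choose h.choose_spec.choose_spec.choose hz
      h.choose_spec.choose_spec.choose_spec.1
      (hab.trans h.choose_spec.choose_spec.choose_spec.2.symm)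
    simp only [zmap, dif_pos h]
    rw [reassoc_of% this]
  have zmap_of_not : ∀ {c d : C} (f : c ≅ d), ¬ T f.hom → zmap f.hom = m f := by
    intro c d f h
    simp only [zmap, dif_neg h]
    congr 1
    ext
    rfl
  have cases : ∀ {c d : C} (f : c ⟶ d), T f ∨ (¬ T f ∧ ∃ e : c ≅ d, e.hom = f) := by
    intro c d f
    by_cases h : T f
    · exact Or.inl h
    · have := (hfac f).resolve_left h
      exact Or.inr ⟨h, asIso f, rfl⟩
  have hpq' : ∀ c {W : M} (k : Q.obj c ⟶ W), p c ≫ q c ≫ k = α.app c ≫ k := fun c W k => by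
    rw [← Category.assoc, hpq]
  have zmap_p : ∀ {c d : C} (f : c ⟶ d), p c ≫ zmap f = P.map f ≫ p d := by
    intro c d f
    obtain ⟨z, a, b, hz, hab⟩ | ⟨hf, e, rfl⟩ := cases f
    · rw [zmap_of_fac f a b hz hab, hpq', ← α.naturality_assoc, reassoc_of% (hαβ z hz), ← hab,
        P.map_comp, Category.assoc]
    · rw [zmap_of_not _ hf, hmp]
  have zmap_q : ∀ {c d : C} (f : c ⟶ d), zmap f ≫ q d = q c ≫ Q.map f := by
    intro c d f
    obtain ⟨z, a, b, hz, hab⟩ | ⟨hf, e, rfl⟩ := cases f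
    · rw [zmap_of_fac f a b hz hab]
      simp only [Category.assoc, hpq, α.naturality]
      rw [reassoc_of% (hβα z hz), ← hab, Q.map_comp]
    · rw [zmap_of_not _ hf, hmq]
  have id_of_S : ∀ c, S c → T (𝟙 c) := fun c hc => ⟨c, 𝟙 c, 𝟙 c, hc, Category.comp_id _⟩
  let Z : C ⥤ M :=
    { obj := X
      map := zmap
      map_id := fun c => by
        by_cases hc : S c
        · have := hp c hc
          -- At an object of `S` the identity lies in `T`, so its value is not given by `m`;
          -- invertibility of `p c` identifies it.
          rw [← cancel_epi (p c), zmap_p]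
          simp
        · have hT : ¬ T (𝟙 c) := by
            rintro ⟨z, a, b, hz, hab⟩
            exact hc (hid a b hz hab)
          exact (zmap_of_not (Iso.refl c) hT).trans (m_id c)
      map_comp := fun {c d e} f g => by
        obtain ⟨z, a, b, hz, hab⟩ | ⟨hf, f, rfl⟩ := cases f
        · rw [zmap_of_fac (f ≫ g) a (b ≫ g) hz (by rw [← hab, Category.assoc]),
            zmap_of_fac f a b hz hab]
          simp only [Category.assoc, zmap_p, P.map_comp]
        · obtain ⟨z, a, b, hz, hab⟩ | ⟨hg, g, rfl⟩ := cases g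
          · rw [zmap_of_fac (f.hom ≫ g) (f.hom ≫ a) b hz (by rw [← hab, Category.assoc]),
              zmap_of_fac g a b hz hab, ← Category.assoc (zmap f.hom), zmap_q, Q.map_comp]
            simp only [Category.assoc]
          -- Composing with the inverse of `g` would put `f` itself in `T`.
          · have hfg : ¬ T (f ≪≫ g).hom := by
              rintro ⟨z, a, b, hz, hab⟩
              exact hf ⟨z, a, b ≫ g.inv, hz, by rw [← Category.assoc, hab]; simp⟩
            rw [zmap_of_not f hf, zmap_of_not g hg, ← m_comp]
            exact zmap_of_not (f ≪≫ g) hfg }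
  refine ⟨Z, ⟨p, fun _ _ f => (zmap_p f).symm⟩, ⟨q, fun _ _ f => zmap_q f⟩,
    fun c => Iso.refl _, fun c => Category.comp_id _, fun c => Category.id_comp _, ?_⟩
  intro c g hc
  have hT : ¬ T g.hom := by
    rintro ⟨z, a, b, hz, hab⟩
    exact hc (hid a (b ≫ g.inv) hz (by rw [← Category.assoc, hab]; simp))
  change zmap g.hom ≫ 𝟙 _ = 𝟙 _ ≫ m g
  rw [zmap_of_not g hT]
  simp

end Gluing


/-! ### Orthogonality and localizations -/

section UniqueLift

variable {𝒳 : Type*} [Category 𝒳] {𝒟 : Type*} [Category 𝒟]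

/-- `i` and `e` are orthogonal: every commutative square from `i` to `e` has a unique diagonal
filler. -/
def UniqueLift {A B X Y : 𝒳} (i : A ⟶ B) (e : X ⟶ Y) : Prop :=
  ∀ (t : A ⟶ X) (b : B ⟶ Y), t ≫ e = i ≫ b → ∃! l : B ⟶ X, i ≫ l = t ∧ l ≫ e = b

lemma UniqueLift.id_left {A X Y : 𝒳} (e : X ⟶ Y) : UniqueLift (𝟙 A) e := fun t b w =>
  ⟨t, ⟨Category.id_comp _, by simpa using w⟩, fun l hl => by simpa using hl.1⟩

lemma UniqueLift.comp_left {A B C X Y : 𝒳} {i : A ⟶ B} {j : B ⟶ C} {e : X ⟶ Y}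
    (hi : UniqueLift i e) (hj : UniqueLift j e) : UniqueLift (i ≫ j) e := by
  intro t b w
  obtain ⟨l, ⟨hl, hl'⟩, hl''⟩ := hi t (j ≫ b) (by simpa using w)
  obtain ⟨m, ⟨hm, hm'⟩, hm''⟩ := hj l b hl'
  refine ⟨m, ⟨by rw [Category.assoc, hm, hl], hm'⟩, ?_⟩
  rintro k ⟨hk, hk'⟩
  exact hm'' k ⟨hl'' _ ⟨by rw [← hk, Category.assoc], by rw [Category.assoc, hk']⟩, hk'⟩

lemma UniqueLift.of_isPushout {A B A' B' X Y : 𝒳} {f : A ⟶ A'} {i : A ⟶ B} {i' : A' ⟶ B'}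
    {g : B ⟶ B'} {e : X ⟶ Y} (h : IsPushout f i i' g) (hi : UniqueLift i e) :
    UniqueLift i' e := by
  intro t b w
  obtain ⟨l, ⟨hl, hl'⟩, hl''⟩ := hi (f ≫ t) (g ≫ b) (by rw [Category.assoc, w, h.w_assoc])
  refine ⟨h.desc t l hl.symm, ⟨h.inl_desc _ _ _, h.hom_ext ?_ ?_⟩, ?_⟩
  · rw [h.inl_desc_assoc, w]
  · rw [h.inr_desc_assoc, hl']
  · rintro k ⟨hk, hk'⟩
    refine h.hom_ext ?_ ?_
    · rw [h.inl_desc, hk]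
    · rw [h.inr_desc]
      exact hl'' _ ⟨by rw [← h.w_assoc, hk], by rw [Category.assoc, hk']⟩

lemma UniqueLift.of_isPullback {A B X Y X' Y' : 𝒳} {g : X' ⟶ X} {e' : X' ⟶ Y'} {e : X ⟶ Y}
    {f : Y' ⟶ Y} {i : A ⟶ B} (h : IsPullback g e' e f) (hi : UniqueLift i e) :
    UniqueLift i e' := by
  intro t b w
  obtain ⟨l, ⟨hl, hl'⟩, hl''⟩ := hi (t ≫ g) (b ≫ f)
    (by rw [Category.assoc, h.w, reassoc_of% w])
  refine ⟨h.lift l b hl', ⟨h.hom_ext ?_ ?_, h.lift_snd _ _ _⟩, ?_⟩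
  · rw [Category.assoc, h.lift_fst, hl]
  · rw [Category.assoc, h.lift_snd, w]
  · rintro k ⟨hk, hk'⟩
    refine h.hom_ext ?_ ?_
    · rw [h.lift_fst]
      exact hl'' _ ⟨by rw [← hk, Category.assoc], by rw [Category.assoc, h.w, reassoc_of% hk']⟩
    · rw [h.lift_snd, hk']

/-- By adjunction this is orthogonality of `f` to `G.map e`, and every map is orthogonal to an
isomorphism. -/
lemma UniqueLift.map_leftAdjoint {F : 𝒟 ⥤ 𝒳} {G : 𝒳 ⥤ 𝒟} (adj : F ⊣ G) {W Z : 𝒟} (f : W ⟶ Z)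
    {X Y : 𝒳} (e : X ⟶ Y) [IsIso (G.map e)] : UniqueLift (F.map f) e := by
  intro t b w
  have w' := congrArg (adj.homEquiv _ _) w
  rw [adj.homEquiv_naturality_right, adj.homEquiv_naturality_left] at w'
  refine ⟨(adj.homEquiv _ _).symm (adj.homEquiv _ _ b ≫ inv (G.map e)), ⟨?_, ?_⟩, ?_⟩
  · rw [← adj.homEquiv_naturality_left_symm, Equiv.symm_apply_eq, ← reassoc_of% w']
    simp
  · rw [← adj.homEquiv_naturality_right_symm, Equiv.symm_apply_eq]
    simp
  · rintro k ⟨-, rfl⟩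
    rw [Equiv.eq_symm_apply, adj.homEquiv_naturality_right]
    simp

lemma UniqueLift.map_rightAdjoint {F : 𝒳 ⥤ 𝒟} {G : 𝒟 ⥤ 𝒳} (adj : F ⊣ G) {W Z : 𝒟} (f : W ⟶ Z)
    {X Y : 𝒳} (e : X ⟶ Y) [IsIso (F.map e)] : UniqueLift e (G.map f) := by
  intro t b w
  have w' := congrArg (adj.homEquiv _ _).symm w
  rw [adj.homEquiv_naturality_right_symm, adj.homEquiv_naturality_left_symm] at w'
  refine ⟨adj.homEquiv _ _ (inv (F.map e) ≫ (adj.homEquiv _ _).symm t), ⟨?_, ?_⟩, ?_⟩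
  · rw [← adj.homEquiv_naturality_left, ← Equiv.eq_symm_apply]
    simp
  · rw [← adj.homEquiv_naturality_right, ← Equiv.eq_symm_apply, Category.assoc, w']
    simp
  · rintro k ⟨rfl, -⟩
    rw [← Equiv.symm_apply_eq, adj.homEquiv_naturality_left_symm]
    simp

/-- Extension of a factorization along a coreflective localization. -/
lemma exists_extension_of_coreflective {F : 𝒟 ⥤ 𝒳} {G : 𝒳 ⥤ 𝒟} (adj : F ⊣ G)
    [∀ W, IsIso (adj.unit.app W)] [HasPushouts 𝒳] [PreservesColimitsOfShape WalkingSpan G]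
    {P Q : 𝒳} (α : P ⟶ Q) {Z : 𝒟} (p : G.obj P ⟶ Z) (q : Z ⟶ G.obj Q) (h : p ≫ q = G.map α) :
    ∃ (P' : 𝒳) (j : P ⟶ P') (k : P' ⟶ Q) (e : G.obj P' ≅ Z),
      j ≫ k = α ∧ G.map j ≫ e.hom = p ∧ e.hom ≫ q = G.map k ∧
      ∀ {X Y : 𝒳} (f : X ⟶ Y), IsIso (G.map f) → UniqueLift j f := by
  -- The extension is `P` with `F.obj (G.obj P)` replaced by `F.obj Z`. The map from `P` is thus a
  -- pushout of `F.map p`, which is what yields orthogonality.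
  have sq := IsPushout.of_hasPushout (adj.counit.app P) (F.map p)
  have : IsIso (G.map (adj.counit.app P)) := by
    have := adj.right_triangle_components P
    exact IsIso.of_isIso_fac_left this
  -- `G` inverts the counit, hence also its pushout; this identifies `G` of the extension with
  -- `G.obj (F.obj Z)`, and so with `Z`.
  have sq' := sq.map G
  have : IsIso (G.map (pushout.inr (adj.counit.app P) (F.map p))) := sq'.isIso_inr_of_isIso
  let k : pushout (adj.counit.app P) (F.map p) ⟶ Q :=
    pushout.desc α ((adj.homEquiv _ _).symm q) (by
      rw [← adj.homEquiv_naturality_left_symm, h]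
      simp [Adjunction.homEquiv_counit])
  refine ⟨_, pushout.inl _ _, k,
    (asIso (adj.unit.app Z ≫ G.map (pushout.inr (adj.counit.app P) (F.map p)))).symm,
    pushout.inl_desc _ _ _, ?_, ?_, fun f hf => UniqueLift.of_isPushout sq
      (UniqueLift.map_leftAdjoint adj p f)⟩
  · rw [Iso.symm_hom, asIso_inv, IsIso.comp_inv_eq, ← adj.unit_naturality_assoc, ← G.map_comp,
      ← pushout.condition, G.map_comp, adj.right_triangle_components_assoc]
  · rw [Iso.symm_hom, asIso_inv, IsIso.inv_comp_eq, Category.assoc, ← G.map_comp,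
      pushout.inr_desc, ← adj.homEquiv_unit, Equiv.apply_symm_apply]

/-- Factorization of a morphism with respect to a reflective localization. -/
lemma exists_factorization_of_reflective {F : 𝒳 ⥤ 𝒟} {G : 𝒟 ⥤ 𝒳} (adj : F ⊣ G)
    [∀ W, IsIso (adj.counit.app W)] [HasPullbacks 𝒳] [PreservesLimitsOfShape WalkingCospan F]
    {P Q : 𝒳} (α : P ⟶ Q) :
    ∃ (Q' : 𝒳) (j : P ⟶ Q') (k : Q' ⟶ Q), j ≫ k = α ∧ IsIso (F.map j) ∧
      ∀ {X Y : 𝒳} (f : X ⟶ Y), IsIso (F.map f) → UniqueLift f k := by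
  -- The middle object agrees with `P` after applying `F` and is otherwise pulled back from `Q`. Its
  -- map to `Q` is a pullback of a map in the image of the right adjoint.
  have sq := IsPullback.of_hasPullback (G.map (F.map α)) (adj.unit.app Q)
  have : ∀ W, IsIso (F.map (adj.unit.app W)) := fun W => by
    have h : inv (adj.counit.app (F.obj W)) = F.map (adj.unit.app W) :=
      IsIso.inv_eq_of_inv_hom_id (adj.left_triangle_components W)
    exact h ▸ (inferInstance : IsIso (inv (adj.counit.app (F.obj W))))
  have sq' := sq.map F
  have : IsIso (F.map (pullback.fst (G.map (F.map α)) (adj.unit.app Q))) := sq'.isIso_fst_of_isIso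
  let j : P ⟶ pullback (G.map (F.map α)) (adj.unit.app Q) :=
    pullback.lift (adj.unit.app P) α (adj.unit_naturality α)
  refine ⟨_, j, pullback.snd _ _, pullback.lift_snd _ _ _, ?_, fun f hf =>
    UniqueLift.of_isPullback sq (UniqueLift.map_rightAdjoint adj _ f)⟩
  have hj : F.map j ≫ F.map (pullback.fst (G.map (F.map α)) (adj.unit.app Q)) =
      F.map (adj.unit.app P) := by
    rw [← F.map_comp, pullback.lift_fst]
  exact IsIso.of_isIso_fac_right hj

end UniqueLift

/-! ### Orthogonality for diagrams and full subcategories -/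

section Diagrams

variable {R : Type v} [SmallCategory R] {M : Type u} [Category.{v} M]

/-- The natural transformations which are invertible at the objects of a full subcategory. -/
def IsoOn (D : ObjectProperty R) {P Q : R ⥤ M} (f : P ⟶ Q) : Prop :=
  ∀ s, D s → IsIso (f.app s)

lemma isIso_whiskerLeft_ι_iff (D : ObjectProperty R) {P Q : R ⥤ M} (f : P ⟶ Q) :
    IsIso (((Functor.whiskeringLeft _ _ M).obj D.ι).map f) ↔ IsoOn D f := by
  rw [NatTrans.isIso_iff_isIso_app]
  exact ⟨fun h s hs => h ⟨s, hs⟩, fun h s => h s.1 s.2⟩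

/-- Natural transformations which are left orthogonal to the transformations invertible on `D`. -/
def LeftOrth (D : ObjectProperty R) {A P : R ⥤ M} (i : A ⟶ P) : Prop :=
  ∀ {X Y : R ⥤ M} (f : X ⟶ Y), IsoOn D f → UniqueLift i f

/-- Natural transformations which are right orthogonal to the transformations invertible
on `D`. -/
def RightOrth (D : ObjectProperty R) {P Q : R ⥤ M} (p : P ⟶ Q) : Prop :=
  ∀ {X Y : R ⥤ M} (f : X ⟶ Y), IsoOn D f → UniqueLift f p

/-- A larger subcategory leaves fewer transformations to be orthogonal to. -/
lemma LeftOrth.mono {D D' : ObjectProperty R} (h : D ≤ D') {A P : R ⥤ M} {i : A ⟶ P}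
    (hi : LeftOrth D i) : LeftOrth D' i :=
  fun f hf => hi f fun s hs => hf s (h s hs)

lemma LeftOrth.comp {D : ObjectProperty R} {A B C : R ⥤ M} {i : A ⟶ B} {j : B ⟶ C}
    (hi : LeftOrth D i) (hj : LeftOrth D j) : LeftOrth D (i ≫ j) :=
  fun f hf => (hi f hf).comp_left (hj f hf)

/-- A factorization of the restriction of a natural transformation to a full subcategory extends
to a factorization of the transformation. -/
theorem exists_extension_leftOrth [HasColimits M] (D : ObjectProperty R) {P Q : R ⥤ M}
    (α : P ⟶ Q) {Z : D.FullSubcategory ⥤ M} (p : D.ι ⋙ P ⟶ Z) (q : Z ⟶ D.ι ⋙ Q)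
    (h : p ≫ q = Functor.whiskerLeft D.ι α) :
    ∃ (P' : R ⥤ M) (j : P ⟶ P') (k : P' ⟶ Q) (e : D.ι ⋙ P' ≅ Z),
      j ≫ k = α ∧ Functor.whiskerLeft D.ι j ≫ e.hom = p ∧
      e.hom ≫ q = Functor.whiskerLeft D.ι k ∧ LeftOrth D j := by
  obtain ⟨P', j, k, e, h₁, h₂, h₃, h₄⟩ :=
    -- The inclusion is fully faithful, so the unit of the left Kan extension adjunction is
    -- invertible.
    exists_extension_of_coreflective (D.ι.lanAdjunction M) α p q h
  exact ⟨P', j, k, e, h₁, h₂, h₃, fun f hf => h₄ f ((isIso_whiskerLeft_ι_iff D f).2 hf)⟩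

/-- Every natural transformation factors as a transformation invertible on `D` followed by a
transformation right orthogonal to those. -/
theorem exists_factorization_rightOrth [HasLimits M] (D : ObjectProperty R) {P Q : R ⥤ M}
    (α : P ⟶ Q) :
    ∃ (Q' : R ⥤ M) (j : P ⟶ Q') (k : Q' ⟶ Q), j ≫ k = α ∧ IsoOn D j ∧ RightOrth D k := by
  obtain ⟨Q', j, k, h₁, h₂, h₃⟩ :=
    exists_factorization_of_reflective (D.ι.ranAdjunction M) α
  exact ⟨Q', j, k, h₁, (isIso_whiskerLeft_ι_iff D j).1 h₂,
    fun f hf => h₃ f ((isIso_whiskerLeft_ι_iff D f).2 hf)⟩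

end Diagrams

end CategoryTheory

namespace GeneralizedReedy

/-! ### Degrees and Reedy factorizations -/

section Reedy

variable {R : Type u} [Category.{v} R] (ρ : GeneralizedReedy R)

lemma plus_of_isIso {s t : R} (f : s ⟶ t) [h : IsIso f] : ρ.plus f := by
  have : (ρ.plus ⊓ ρ.minus) f := by rw [ρ.plus_inf_minus]; exact h
  exact this.1

lemma minus_of_isIso {s t : R} (f : s ⟶ t) [h : IsIso f] : ρ.minus f := by
  have : (ρ.plus ⊓ ρ.minus) f := by rw [ρ.plus_inf_minus]; exact h
  exact this.2

lemma deg_eq_of_iso {s t : R} (e : s ≅ t) : ρ.deg s = ρ.deg t :=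
  ρ.deg_eq_of_isIso e.hom inferInstance

lemma deg_le_of_plus {s t : R} {f : s ⟶ t} (hf : ρ.plus f) : ρ.deg s ≤ ρ.deg t := by
  by_cases h : IsIso f
  · exact (ρ.deg_eq_of_isIso f h).le
  · exact (ρ.deg_lt_of_plus f hf h).le

lemma deg_le_of_minus {s t : R} {f : s ⟶ t} (hf : ρ.minus f) : ρ.deg t ≤ ρ.deg s := by
  by_cases h : IsIso f
  · exact (ρ.deg_eq_of_isIso f h).ge
  · exact (ρ.deg_lt_of_minus f hf h).le

/-- The middle object of a Reedy factorization of a morphism has the least degree among the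
objects through which it factors. -/
lemma deg_le_of_fac {s t z w : R} {p : s ⟶ z} {i : z ⟶ t} (hp : ρ.minus p) (hi : ρ.plus i)
    (a : s ⟶ w) (b : w ⟶ t) (h : a ≫ b = p ≫ i) : ρ.deg z ≤ ρ.deg w := by
  obtain ⟨x, p₁, i₁, hp₁, hi₁, rfl⟩ := ρ.exists_factorization a
  obtain ⟨y, p₂, i₂, hp₂, hi₂, h₂⟩ := ρ.exists_factorization (i₁ ≫ b)
  obtain ⟨e, -, -⟩ := ρ.factorization_unique p i (p₁ ≫ p₂) i₂ hp hi
    (ρ.minus_isMultiplicative.comp_mem _ _ hp₁ hp₂) hi₂ (by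
      rw [← h, Category.assoc, Category.assoc, h₂])
  rw [ρ.deg_eq_of_iso e]
  exact (ρ.deg_le_of_minus hp₂).trans (ρ.deg_le_of_plus hi₁)

/-- In a Reedy factorization of `f` one factor is not invertible. Either the first one lowers the
degree strictly, or the second one raises it strictly to `deg d = deg c`. -/
lemma exists_fac_of_not_isIso {c d : R} (f : c ⟶ d) (h : ρ.deg c = ρ.deg d) (hf : ¬ IsIso f) :
    ∃ (z : R) (a : c ⟶ z) (b : z ⟶ d), ρ.deg z < ρ.deg c ∧ a ≫ b = f := by
  obtain ⟨z, p, i, hp, hi, rfl⟩ := ρ.exists_factorization f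
  refine ⟨z, p, i, ?_, rfl⟩
  by_cases hp' : IsIso p
  · have hi' : ¬ IsIso i := fun _ => hf inferInstance
    exact (ρ.deg_lt_of_plus i hi hi').trans_eq h.symm
  · exact ρ.deg_lt_of_minus p hp hp'

/-- The objects of degree less than `n`. -/
def below (n : ℕ) : ObjectProperty R := fun s => ρ.deg s < n

lemma below_mono {m n : ℕ} (h : m ≤ n) : ρ.below m ≤ ρ.below n := fun _ hs => hs.trans_le h

end Reedy

/-! ### Test diagrams: powers indexed by sieves -/

section Tests

variable {R : Type v} [SmallCategory R] {M : Type u} [Category.{v} M]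

/-- The functor sending `s` to the power of `T` by the set of arrows `s ⟶ r` in a sieve. -/
noncomputable def sievePower [HasLimits M] {r : R} (S : Sieve r) (T : M) : R ⥤ M where
  obj s := ∏ᶜ fun _ : {f : s ⟶ r // S f} => T
  map g := Pi.lift fun f => Pi.π (fun _ : {f : _ ⟶ r // S f} => T)
    ⟨g ≫ f.1, S.downward_closed f.2 g⟩
  map_id s := Pi.hom_ext _ _ fun f => by simp
  map_comp g h := Pi.hom_ext _ _ fun f => by simp

/-- The projection of `sievePower` at an arrow. -/
noncomputable def sievePowerπ [HasLimits M] {r : R} (S : Sieve r) (T : M) {s : R} (f : s ⟶ r)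
    (hf : S f) : (sievePower S T).obj s ⟶ T :=
  Pi.π (fun _ : {f : s ⟶ r // S f} => T) ⟨f, hf⟩

lemma sievePower_map_π [HasLimits M] {r : R} (S : Sieve r) (T : M) {s s' : R} (g : s ⟶ s')
    (f : s' ⟶ r) (hf : S f) : (sievePower S T).map g ≫ sievePowerπ S T f hf =
      sievePowerπ S T (g ≫ f) (S.downward_closed hf g) :=
  Pi.lift_π _ _

lemma sievePower_hom_ext [HasLimits M] {r : R} {S : Sieve r} {T : M} {s : R} {W : M}
    {a b : W ⟶ (sievePower S T).obj s}
    (h : ∀ (f : s ⟶ r) (hf : S f), a ≫ sievePowerπ S T f hf = b ≫ sievePowerπ S T f hf) : a = b :=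
  Pi.hom_ext _ _ fun f => h f.1 f.2

/-- Morphisms to a value of `sievePower` are families of morphisms. -/
noncomputable def sievePowerObjLift [HasLimits M] {r : R} (S : Sieve r) {T : M} {s : R} {W : M}
    (k : ∀ f : s ⟶ r, S f → (W ⟶ T)) : W ⟶ (sievePower S T).obj s :=
  Pi.lift fun f : {f : s ⟶ r // S f} => k f.1 f.2

lemma sievePowerObjLift_π [HasLimits M] {r : R} (S : Sieve r) {T : M} {s : R} {W : M}
    (k : ∀ f : s ⟶ r, S f → (W ⟶ T)) (f : s ⟶ r) (hf : S f) :
    sievePowerObjLift S k ≫ sievePowerπ S T f hf = k f hf :=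
  Pi.lift_π _ (⟨f, hf⟩ : {f : s ⟶ r // S f})

/-- Morphisms to `sievePower` are compatible families of morphisms. -/
noncomputable def sievePowerLift [HasLimits M] {r : R} (S : Sieve r) {T : M} {P : R ⥤ M}
    (k : ∀ (s : R) (f : s ⟶ r), S f → (P.obj s ⟶ T))
    (hk : ∀ {s s' : R} (g : s ⟶ s') (f : s' ⟶ r) (hf : S f),
      P.map g ≫ k s' f hf = k s (g ≫ f) (S.downward_closed hf g)) : P ⟶ sievePower S T where
  app s := sievePowerObjLift S (k s)
  naturality s s' g := sievePower_hom_ext fun f hf => by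
    rw [Category.assoc, Category.assoc, sievePower_map_π, sievePowerObjLift_π,
      sievePowerObjLift_π, hk]

lemma sievePowerLift_π [HasLimits M] {r : R} (S : Sieve r) {T : M} {P : R ⥤ M}
    (k : ∀ (s : R) (f : s ⟶ r), S f → (P.obj s ⟶ T))
    (hk : ∀ {s s' : R} (g : s ⟶ s') (f : s' ⟶ r) (hf : S f),
      P.map g ≫ k s' f hf = k s (g ≫ f) (S.downward_closed hf g)) {s : R} (f : s ⟶ r) (hf : S f) :
    (sievePowerLift S k hk).app s ≫ sievePowerπ S T f hf = k s f hf :=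
  sievePowerObjLift_π _ _ _ _

/-- The restriction of powers along an inclusion of sieves. -/
noncomputable def sievePowerRestrict [HasLimits M] {r : R} (S : Sieve r) (T : M) :
    sievePower (⊤ : Sieve r) T ⟶ sievePower S T :=
  sievePowerLift S (fun _ f _ => sievePowerπ ⊤ T f trivial) fun g f _ =>
    sievePower_map_π ⊤ T g f trivial

lemma sievePowerRestrict_π [HasLimits M] {r : R} (S : Sieve r) (T : M) {s : R} (f : s ⟶ r)
    (hf : S f) : (sievePowerRestrict S T).app s ≫ sievePowerπ S T f hf =
      sievePowerπ ⊤ T f trivial :=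
  sievePowerObjLift_π S (fun f _ => sievePowerπ ⊤ T f trivial) f hf

/-- Applied to the boundary sieve, this says that the restriction is invertible below the degree of
`r`, so that orthogonality can be tested against it. -/
lemma isIso_sievePowerRestrict_app [HasLimits M] {r : R} (S : Sieve r) (T : M) (s : R)
    (hs : ∀ f : s ⟶ r, S f) : IsIso ((sievePowerRestrict S T).app s) := by
  refine ⟨sievePowerObjLift ⊤ fun f _ => sievePowerπ S T f (hs f), ?_, ?_⟩
  · refine sievePower_hom_ext fun f hf => ?_
    rw [Category.assoc, Category.id_comp, sievePowerObjLift_π, sievePowerRestrict_π]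
  · refine sievePower_hom_ext fun f hf => ?_
    rw [Category.assoc, Category.id_comp, sievePowerRestrict_π, sievePowerObjLift_π]

end Tests

/-! ### Orthogonal maps have invertible relative latching maps -/

section Latching

variable {R : Type v} [SmallCategory R] (ρ : GeneralizedReedy R)
  {M : Type u} [Category.{v} M] [HasColimits M]

/-- The sieve of the arrows which factor through an object of degree less than `n`. -/
def boundarySieve (n : ℕ) (r : R) : Sieve r where
  arrows s f := ∃ (z : R) (a : s ⟶ z) (b : z ⟶ r), ρ.deg z < n ∧ a ≫ b = f
  downward_closed := by
    rintro s s' f ⟨z, a, b, hz, rfl⟩ g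
    exact ⟨z, g ≫ a, b, hz, Category.assoc _ _ _⟩

/-- The object of `M` underlying the source of the relative latching map. -/
noncomputable def latchingPushout (r : R) {Φ Ψ : R ⥤ M} (τ : Φ ⟶ Ψ) : M :=
  (pushout (ρ.latchingTo r Φ) (ρ.latchingMap r τ)).obj (SingleObj.star _)

/-- The first coprojection of the source of the relative latching map. -/
noncomputable def latchingInl (r : R) {Φ Ψ : R ⥤ M} (τ : Φ ⟶ Ψ) :
    Φ.obj r ⟶ ρ.latchingPushout r τ :=
  (pushout.inl (ρ.latchingTo r Φ) (ρ.latchingMap r τ)).app (SingleObj.star _)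

/-- The second coprojection of the source of the relative latching map. -/
noncomputable def latchingInr (r : R) {Φ Ψ : R ⥤ M} (τ : Φ ⟶ Ψ) :
    ρ.latchingObj r Ψ ⟶ ρ.latchingPushout r τ :=
  (pushout.inr (ρ.latchingTo r Φ) (ρ.latchingMap r τ)).app (SingleObj.star _)

/-- The morphism of `M` underlying the relative latching map. -/
noncomputable def relativeLatchingObjMap (r : R) {Φ Ψ : R ⥤ M} (τ : Φ ⟶ Ψ) :
    ρ.latchingPushout r τ ⟶ Ψ.obj r :=
  (ρ.relativeLatchingMap r τ).app (SingleObj.star _)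

lemma isPushout_relativeLatching (r : R) {Φ Ψ : R ⥤ M} (τ : Φ ⟶ Ψ) :
    IsPushout (ρ.latchingObjTo r Φ) (ρ.latchingObjMap r τ)
      (ρ.latchingInl r τ) (ρ.latchingInr r τ) :=
  (IsPushout.of_hasPushout (ρ.latchingTo r Φ) (ρ.latchingMap r τ)).map
    ((evaluation (SingleObj (Aut r)) M).obj (SingleObj.star _))

lemma latchingInl_map (r : R) {Φ Ψ : R ⥤ M} (τ : Φ ⟶ Ψ) :
    ρ.latchingInl r τ ≫ ρ.relativeLatchingObjMap r τ = τ.app r :=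
  congrArg (fun f : autInclusion r ⋙ Φ ⟶ autInclusion r ⋙ Ψ => f.app (SingleObj.star _))
    (pushout.inl_desc _ _ _)

lemma latchingInr_map (r : R) {Φ Ψ : R ⥤ M} (τ : Φ ⟶ Ψ) :
    ρ.latchingInr r τ ≫ ρ.relativeLatchingObjMap r τ = ρ.latchingObjTo r Ψ :=
  congrArg (fun f : ρ.latching r Ψ ⟶ autInclusion r ⋙ Ψ => f.app (SingleObj.star _))
    (pushout.inr_desc _ _ _)

lemma latchingObj_naturality (r : R) {Φ Ψ : R ⥤ M} (τ : Φ ⟶ Ψ) :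
    ρ.latchingObjTo r Φ ≫ τ.app r = ρ.latchingObjMap r τ ≫ ρ.latchingObjTo r Ψ :=
  congrArg (fun f : ρ.latching r Φ ⟶ autInclusion r ⋙ Ψ => f.app (SingleObj.star _))
    (ρ.latchingTo_naturality r τ)

lemma isIso_singleObj {G : Type*} [Monoid G] {C : Type*} [Category C] {P Q : SingleObj G ⥤ C}
    (f : P ⟶ Q) (h : IsIso (f.app (SingleObj.star _))) : IsIso f := by
  rw [NatTrans.isIso_iff_isIso_app]
  rintro ⟨⟩
  exact h

/-- The relative latching map is the comparison between two pushouts of the same span; its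
invertibility can be checked without the group action. -/
lemma isIso_relativeLatchingMap_of_isPushout (r : R) {Φ Ψ : R ⥤ M} (τ : Φ ⟶ Ψ)
    (h : IsPushout (ρ.latchingObjTo r Φ) (ρ.latchingObjMap r τ) (τ.app r)
      (ρ.latchingObjTo r Ψ)) :
    IsIso (ρ.relativeLatchingMap r τ) := by
  apply isIso_singleObj
  have h' := ρ.isPushout_relativeLatching r τ
  have : ρ.relativeLatchingObjMap r τ = (h'.isoIsPushout _ _ h).hom := by
    refine h'.hom_ext ?_ ?_
    · rw [latchingInl_map, IsPushout.inl_isoIsPushout_hom]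
    · rw [latchingInr_map, IsPushout.inr_isoIsPushout_hom]
  change IsIso (ρ.relativeLatchingObjMap r τ)
  exact this ▸ Iso.isIso_hom _

variable {ρ} in
/-- Two Reedy factorizations of the same morphism yield the same morphism to the latching
object. -/
lemma map_latchingι_eq (Φ : R ⥤ M) {r s z z' : R} {p : s ⟶ z} {i : z ⟶ r} {p' : s ⟶ z'}
    {i' : z' ⟶ r} (hp : ρ.minus p) (hi : ρ.plus i) (hz : ρ.deg z < ρ.deg r) (hp' : ρ.minus p')
    (hi' : ρ.plus i') (hz' : ρ.deg z' < ρ.deg r) (h : p ≫ i = p' ≫ i') :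
    Φ.map p ≫ ρ.latchingι Φ i hi hz = Φ.map p' ≫ ρ.latchingι Φ i' hi' hz' := by
  obtain ⟨e, rfl, he⟩ := ρ.factorization_unique p i p' i' hp hi hp' hi' h
  rw [Φ.map_comp, Category.assoc,
    ρ.latchingι_w Φ e.hom (ρ.plus_of_isIso e.hom) i hi hz i' hi' hz' he]

/-- The morphism to the latching object defined by an arrow which factors through an object of
smaller degree. -/
lemma exists_latchingι (Φ : R ⥤ M) (r : R) :
    ∃ k : ∀ (s : R) (f : s ⟶ r), ρ.boundarySieve (ρ.deg r) r f → (Φ.obj s ⟶ ρ.latchingObj r Φ),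
      ∀ {s z : R} (p : s ⟶ z) (i : z ⟶ r) (_ : ρ.minus p) (hi : ρ.plus i)
        (hz : ρ.deg z < ρ.deg r) (f : s ⟶ r) (h : ρ.boundarySieve (ρ.deg r) r f), p ≫ i = f →
        k s f h = Φ.map p ≫ ρ.latchingι Φ i hi hz := by
  have key : ∀ (s : R) (f : s ⟶ r), ρ.boundarySieve (ρ.deg r) r f →
      ∃ k : Φ.obj s ⟶ ρ.latchingObj r Φ, ∀ {z : R} (p : s ⟶ z) (i : z ⟶ r) (_ : ρ.minus p)
        (hi : ρ.plus i) (hz : ρ.deg z < ρ.deg r), p ≫ i = f →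
        k = Φ.map p ≫ ρ.latchingι Φ i hi hz := by
    rintro s f ⟨w, a, b, hw, hab⟩
    obtain ⟨z, p, i, hp, hi, hpi⟩ := ρ.exists_factorization f
    refine ⟨Φ.map p ≫ ρ.latchingι Φ i hi
      ((ρ.deg_le_of_fac hp hi a b (hab.trans hpi.symm)).trans_lt hw), ?_⟩
    intro z' p' i' hp' hi' hz' h
    exact map_latchingι_eq Φ hp hi _ hp' hi' hz' (hpi.trans h.symm)
  choose k hk using key
  refine ⟨k, ?_⟩
  intro s z p i hp hi hz f h e
  exact hk s f h p i hp hi hz e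

/-- The relative latching map of a transformation which is left orthogonal to the
transformations invertible below the degree of `r` is invertible. -/
theorem isIso_relativeLatchingMap_of_leftOrth [HasLimits M] (r : R) {Φ Ψ : R ⥤ M} (τ : Φ ⟶ Ψ)
    (hτ : LeftOrth (ρ.below (ρ.deg r)) τ) : IsIso (ρ.relativeLatchingMap r τ) := by
  apply isIso_relativeLatchingMap_of_isPushout
  -- The pushout property, tested on an arbitrary `T`. Maps into `sievePower ⊤ T` are maps from the
  -- value at `r` to `T`, and a map `L_r Ψ ⟶ T` gives a map from `Ψ` into the power over the
  -- boundary sieve. Orthogonality to the restriction between these powers is what provides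
  -- existence and uniqueness.
  have key : ∀ {T : M} (a : Φ.obj r ⟶ T) (l : ρ.latchingObj r Ψ ⟶ T),
      ρ.latchingObjTo r Φ ≫ a = ρ.latchingObjMap r τ ≫ l →
      ∃! m : Ψ.obj r ⟶ T, τ.app r ≫ m = a ∧ ρ.latchingObjTo r Ψ ≫ m = l := by
    intro T a l w
    let S := ρ.boundarySieve (ρ.deg r) r
    obtain ⟨k, hk⟩ := ρ.exists_latchingι Ψ r
    have hS : ∀ {s : R} (f : s ⟶ r), S f → ∃ (z : R) (p : s ⟶ z) (i : z ⟶ r), ρ.minus p ∧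
        ρ.plus i ∧ ρ.deg z < ρ.deg r ∧ p ≫ i = f := by
      rintro s f ⟨z, a, b, hz, hab⟩
      obtain ⟨y, p, i, hp, hi, hpi⟩ := ρ.exists_factorization f
      exact ⟨y, p, i, hp, hi, (ρ.deg_le_of_fac hp hi a b (hab.trans hpi.symm)).trans_lt hz, hpi⟩
    -- Precomposing with `g` destroys the Reedy factorization. Refactoring `g ≫ p` lowers the middle
    -- object, and the new degree-raising map `j` is absorbed by a relation of the latching colimit.
    have hk' : ∀ {s s' : R} (g : s ⟶ s') (f : s' ⟶ r) (hf : S f),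
        Ψ.map g ≫ k _ f hf = k _ (g ≫ f) (S.downward_closed hf g) := by
      intro s s' g f hf
      obtain ⟨z, p, i, hp, hi, hz, rfl⟩ := hS f hf
      obtain ⟨y, p', j, hp', hj, h⟩ := ρ.exists_factorization (g ≫ p)
      have e : g ≫ p ≫ i = p' ≫ j ≫ i := by rw [← Category.assoc, ← h, Category.assoc]
      have hji := ρ.plus_isMultiplicative.comp_mem _ _ hj hi
      have hy := (ρ.deg_le_of_plus hj).trans_lt hz
      rw [hk p' (j ≫ i) hp' hji hy _ _ e.symm, hk p i hp hi hz _ _ rfl,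
        ← ρ.latchingι_w Ψ j hj (j ≫ i) hji hy i hi hz rfl, ← Ψ.map_comp_assoc, ← Ψ.map_comp_assoc,
        h]
    have unit : ∀ {s : R} (u : s ⟶ r) (hu : ρ.plus u) (hs : ρ.deg s < ρ.deg r) (h : S u),
        k s u h = ρ.latchingι Ψ u hu hs := by
      intro s u hu hs h
      rw [hk (𝟙 s) u (ρ.minus_isMultiplicative.id_mem s) hu hs u h (Category.id_comp _),
        Ψ.map_id, Category.id_comp]
    let t : Φ ⟶ sievePower ⊤ T := sievePowerLift ⊤ (fun _ f _ => Φ.map f ≫ a)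
      fun g f _ => by rw [Φ.map_comp, Category.assoc]
    let b : Ψ ⟶ sievePower S T := sievePowerLift S (fun _ f hf => k _ f hf ≫ l)
      fun g f hf => by rw [← Category.assoc, hk']
    have hw : t ≫ sievePowerRestrict S T = τ ≫ b := by
      ext s
      refine sievePower_hom_ext fun f hf => ?_
      simp only [NatTrans.comp_app, Category.assoc, t, b, sievePowerRestrict_π, sievePowerLift_π]
      obtain ⟨z, p, i, hp, hi, hz, rfl⟩ := hS f hf
      rw [hk p i hp hi hz _ hf rfl, Category.assoc, ← τ.naturality_assoc, Φ.map_comp, Category.assoc,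
        ← reassoc_of% (ρ.latchingι_map τ i hi hz), ← w, reassoc_of% (ρ.latchingι_to Φ i hi hz)]
    obtain ⟨m, ⟨hm, hm'⟩, hm''⟩ := hτ (sievePowerRestrict S T) (fun s hs =>
      isIso_sievePowerRestrict_app S T s fun f => ⟨s, 𝟙 s, f, hs, Category.id_comp _⟩) t b hw
    -- As in the Yoneda lemma, the factor indexed by the identity of `r` recovers the map out of
    -- `Ψ.obj r`.
    refine ⟨m.app r ≫ sievePowerπ ⊤ T (𝟙 r) trivial, ⟨?_, ?_⟩, ?_⟩
    · rw [← NatTrans.comp_app_assoc, hm, sievePowerLift_π, Φ.map_id, Category.id_comp]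
    · refine latchingObj_hom_ext fun {s} u hu hs => ?_
      have hu' : S u := ⟨s, 𝟙 s, u, hs, Category.id_comp _⟩
      have h₁ := congrArg (fun f => f.app s ≫ sievePowerπ S T u hu') hm'
      simp only [NatTrans.comp_app, Category.assoc, b, sievePowerRestrict_π, sievePowerLift_π,
        unit u hu hs hu'] at h₁
      rw [reassoc_of% (ρ.latchingι_to Ψ u hu hs), m.naturality_assoc, sievePower_map_π, ← h₁]
      simp only [Category.comp_id]
    · rintro m' ⟨h₁, h₂⟩
      have := hm'' (sievePowerLift ⊤ (fun _ f _ => Ψ.map f ≫ m')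
        fun g f _ => by rw [Ψ.map_comp, Category.assoc]) ⟨?_, ?_⟩
      · rw [← this, sievePowerLift_π, Ψ.map_id, Category.id_comp]
      · ext s
        refine sievePower_hom_ext fun f hf => ?_
        simp only [NatTrans.comp_app, Category.assoc, t, sievePowerLift_π]
        rw [← τ.naturality_assoc, h₁]
      · ext s
        refine sievePower_hom_ext fun f hf => ?_
        simp only [NatTrans.comp_app, Category.assoc, b, sievePowerRestrict_π, sievePowerLift_π]
        obtain ⟨z, p, i, hp, hi, hz, rfl⟩ := hS f hf
        rw [hk p i hp hi hz _ hf rfl, ← h₂, Category.assoc, reassoc_of% (ρ.latchingι_to Ψ i hi hz),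
          Ψ.map_comp, Category.assoc]
  exact ⟨⟨ρ.latchingObj_naturality r τ⟩, ⟨PushoutCocone.IsColimit.mk _
    (fun s => (key s.inl s.inr s.condition).choose)
    (fun s => (key s.inl s.inr s.condition).choose_spec.1.1)
    (fun s => (key s.inl s.inr s.condition).choose_spec.1.2)
    (fun s m h₁ h₂ => (key s.inl s.inr s.condition).choose_spec.2 m ⟨h₁, h₂⟩)⟩⟩

end Latching


/-! ### Test diagrams: copowers indexed by cosieves -/

/-- A set of arrows with source `r` which is closed under postcomposition. -/
structure Cosieve {R : Type u} [Category.{v} R] (r : R) where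
  /-- the arrows of the cosieve -/
  arrows (s : R) (f : r ⟶ s) : Prop
  upward_closed {s s' : R} (f : r ⟶ s) (_ : arrows s f) (g : s ⟶ s') : arrows s' (f ≫ g)

/-- The cosieve of all arrows. -/
def Cosieve.all {R : Type u} [Category.{v} R] (r : R) : Cosieve r where
  arrows _ _ := True
  upward_closed _ _ _ := trivial

lemma Cosieve.all_arrows {R : Type u} [Category.{v} R] {r s : R} (f : r ⟶ s) :
    (Cosieve.all r).arrows s f := trivial

section Tests

variable {R : Type v} [SmallCategory R] {M : Type u} [Category.{v} M]

/-- The functor sending `s` to the copower of `T` by the set of arrows `r ⟶ s` in a cosieve. -/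
noncomputable def cosieveCopower [HasColimits M] {r : R} (S : Cosieve r) (T : M) : R ⥤ M where
  obj s := ∐ fun _ : {f : r ⟶ s // S.arrows s f} => T
  map {_ s'} g := Sigma.desc fun f => Sigma.ι (fun _ : {f : r ⟶ s' // S.arrows s' f} => T)
    ⟨f.1 ≫ g, S.upward_closed f.1 f.2 g⟩
  map_id s := Sigma.hom_ext _ _ fun f => by simp
  map_comp g h := Sigma.hom_ext _ _ fun f => by simp

/-- The coprojection of `cosieveCopower` at an arrow. -/
noncomputable def cosieveCopowerι [HasColimits M] {r : R} (S : Cosieve r) (T : M) {s : R}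
    (f : r ⟶ s) (hf : S.arrows s f) : T ⟶ (cosieveCopower S T).obj s :=
  Sigma.ι (fun _ : {f : r ⟶ s // S.arrows s f} => T) ⟨f, hf⟩

lemma cosieveCopower_ι_map [HasColimits M] {r : R} (S : Cosieve r) (T : M) {s s' : R} (g : s ⟶ s')
    (f : r ⟶ s) (hf : S.arrows s f) : cosieveCopowerι S T f hf ≫ (cosieveCopower S T).map g =
      cosieveCopowerι S T (f ≫ g) (S.upward_closed f hf g) :=
  Sigma.ι_desc _ _

lemma cosieveCopower_hom_ext [HasColimits M] {r : R} {S : Cosieve r} {T : M} {s : R} {W : M}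
    {a b : (cosieveCopower S T).obj s ⟶ W} (h : ∀ (f : r ⟶ s) (hf : S.arrows s f),
      cosieveCopowerι S T f hf ≫ a = cosieveCopowerι S T f hf ≫ b) : a = b :=
  Sigma.hom_ext _ _ fun f => h f.1 f.2

/-- Morphisms from a value of `cosieveCopower` are families of morphisms. -/
noncomputable def cosieveCopowerObjDesc [HasColimits M] {r : R} (S : Cosieve r) {T : M} {s : R}
    {W : M} (k : ∀ f : r ⟶ s, S.arrows s f → (T ⟶ W)) : (cosieveCopower S T).obj s ⟶ W :=
  Sigma.desc fun f : {f : r ⟶ s // S.arrows s f} => k f.1 f.2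

lemma cosieveCopowerι_objDesc [HasColimits M] {r : R} (S : Cosieve r) {T : M} {s : R} {W : M}
    (k : ∀ f : r ⟶ s, S.arrows s f → (T ⟶ W)) (f : r ⟶ s) (hf : S.arrows s f) :
    cosieveCopowerι S T f hf ≫ cosieveCopowerObjDesc S k = k f hf :=
  Sigma.ι_desc _ (⟨f, hf⟩ : {f : r ⟶ s // S.arrows s f})

/-- Morphisms from `cosieveCopower` are compatible families of morphisms. -/
noncomputable def cosieveCopowerDesc [HasColimits M] {r : R} (S : Cosieve r) {T : M} {P : R ⥤ M}
    (k : ∀ (s : R) (f : r ⟶ s), S.arrows s f → (T ⟶ P.obj s))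
    (hk : ∀ {s s' : R} (g : s ⟶ s') (f : r ⟶ s) (hf : S.arrows s f),
      k s f hf ≫ P.map g = k s' (f ≫ g) (S.upward_closed f hf g)) : cosieveCopower S T ⟶ P where
  app s := cosieveCopowerObjDesc S (k s)
  naturality s s' g := cosieveCopower_hom_ext fun f hf => by
    rw [reassoc_of% @cosieveCopower_ι_map, reassoc_of% @cosieveCopowerι_objDesc, cosieveCopowerι_objDesc, hk]

lemma cosieveCopowerι_desc [HasColimits M] {r : R} (S : Cosieve r) {T : M} {P : R ⥤ M}
    (k : ∀ (s : R) (f : r ⟶ s), S.arrows s f → (T ⟶ P.obj s))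
    (hk : ∀ {s s' : R} (g : s ⟶ s') (f : r ⟶ s) (hf : S.arrows s f),
      k s f hf ≫ P.map g = k s' (f ≫ g) (S.upward_closed f hf g)) {s : R} (f : r ⟶ s)
    (hf : S.arrows s f) :
    cosieveCopowerι S T f hf ≫ (cosieveCopowerDesc S k hk).app s = k s f hf :=
  cosieveCopowerι_objDesc _ _ _ _

/-- The inclusion of copowers along an inclusion of cosieves. -/
noncomputable def cosieveCopowerInclusion [HasColimits M] {r : R} (S : Cosieve r) (T : M) :
    cosieveCopower S T ⟶ cosieveCopower (Cosieve.all r) T :=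
  cosieveCopowerDesc S (fun _ f _ => cosieveCopowerι (Cosieve.all r) T f (Cosieve.all_arrows f)) fun g f _ =>
    cosieveCopower_ι_map (Cosieve.all r) T g f (Cosieve.all_arrows f)

lemma cosieveCopowerι_inclusion [HasColimits M] {r : R} (S : Cosieve r) (T : M) {s : R}
    (f : r ⟶ s) (hf : S.arrows s f) :
    cosieveCopowerι S T f hf ≫ (cosieveCopowerInclusion S T).app s =
      cosieveCopowerι (Cosieve.all r) T f (Cosieve.all_arrows f) :=
  cosieveCopowerι_objDesc S (fun f _ => cosieveCopowerι (Cosieve.all r) T f (Cosieve.all_arrows f)) f hf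

lemma isIso_cosieveCopowerInclusion_app [HasColimits M] {r : R} (S : Cosieve r) (T : M) (s : R)
    (hs : ∀ f : r ⟶ s, S.arrows s f) : IsIso ((cosieveCopowerInclusion S T).app s) := by
  refine ⟨cosieveCopowerObjDesc _ fun f _ => cosieveCopowerι S T f (hs f), ?_, ?_⟩
  · refine cosieveCopower_hom_ext fun f hf => ?_
    rw [Category.comp_id, reassoc_of% @cosieveCopowerι_inclusion, cosieveCopowerι_objDesc]
  · refine cosieveCopower_hom_ext fun f hf => ?_
    rw [Category.comp_id, reassoc_of% @cosieveCopowerι_objDesc, cosieveCopowerι_inclusion]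

end Tests

/-! ### Orthogonal maps have invertible relative matching maps -/

section Matching

variable {R : Type v} [SmallCategory R] (ρ : GeneralizedReedy R)
  {M : Type u} [Category.{v} M] [HasLimits M]

/-- The cosieve of the arrows which factor through an object of degree less than `n`. -/
def boundaryCosieve (n : ℕ) (r : R) : Cosieve r where
  arrows s f := ∃ (z : R) (a : r ⟶ z) (b : z ⟶ s), ρ.deg z < n ∧ a ≫ b = f
  upward_closed := by
    rintro s s' f ⟨z, a, b, hz, rfl⟩ g
    exact ⟨z, a, b ≫ g, hz, (Category.assoc _ _ _).symm⟩

/-- The object of `M` underlying the target of the relative matching map. -/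
noncomputable def matchingPullback (r : R) {Φ Ψ : R ⥤ M} (τ : Φ ⟶ Ψ) : M :=
  (pullback (ρ.matchingMap r τ) (ρ.toMatching r Ψ)).obj (SingleObj.star _)

/-- The first projection of the target of the relative matching map. -/
noncomputable def matchingFst (r : R) {Φ Ψ : R ⥤ M} (τ : Φ ⟶ Ψ) :
    ρ.matchingPullback r τ ⟶ ρ.matchingObj r Φ :=
  (pullback.fst (ρ.matchingMap r τ) (ρ.toMatching r Ψ)).app (SingleObj.star _)

/-- The second projection of the target of the relative matching map. -/
noncomputable def matchingSnd (r : R) {Φ Ψ : R ⥤ M} (τ : Φ ⟶ Ψ) :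
    ρ.matchingPullback r τ ⟶ Ψ.obj r :=
  (pullback.snd (ρ.matchingMap r τ) (ρ.toMatching r Ψ)).app (SingleObj.star _)

/-- The morphism of `M` underlying the relative matching map. -/
noncomputable def relativeMatchingObjMap (r : R) {Φ Ψ : R ⥤ M} (τ : Φ ⟶ Ψ) :
    Φ.obj r ⟶ ρ.matchingPullback r τ :=
  (ρ.relativeMatchingMap r τ).app (SingleObj.star _)

lemma isPullback_relativeMatching (r : R) {Φ Ψ : R ⥤ M} (τ : Φ ⟶ Ψ) :
    IsPullback (ρ.matchingFst r τ) (ρ.matchingSnd r τ)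
      (ρ.matchingObjMap r τ) (ρ.toMatchingObj r Ψ) :=
  (IsPullback.of_hasPullback (ρ.matchingMap r τ) (ρ.toMatching r Ψ)).map
    ((evaluation (SingleObj (Aut r)) M).obj (SingleObj.star _))

lemma map_matchingFst (r : R) {Φ Ψ : R ⥤ M} (τ : Φ ⟶ Ψ) :
    ρ.relativeMatchingObjMap r τ ≫ ρ.matchingFst r τ = ρ.toMatchingObj r Φ :=
  congrArg (fun f : autInclusion r ⋙ Φ ⟶ ρ.matching r Φ => f.app (SingleObj.star _))
    (pullback.lift_fst _ _ _)

lemma map_matchingSnd (r : R) {Φ Ψ : R ⥤ M} (τ : Φ ⟶ Ψ) :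
    ρ.relativeMatchingObjMap r τ ≫ ρ.matchingSnd r τ = τ.app r :=
  congrArg (fun f : autInclusion r ⋙ Φ ⟶ autInclusion r ⋙ Ψ => f.app (SingleObj.star _))
    (pullback.lift_snd _ _ _)

lemma toMatchingObj_naturality (r : R) {Φ Ψ : R ⥤ M} (τ : Φ ⟶ Ψ) :
    ρ.toMatchingObj r Φ ≫ ρ.matchingObjMap r τ = τ.app r ≫ ρ.toMatchingObj r Ψ :=
  congrArg (fun f : autInclusion r ⋙ Φ ⟶ ρ.matching r Ψ => f.app (SingleObj.star _))
    (ρ.toMatching_naturality r τ)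

lemma isIso_relativeMatchingMap_of_isPullback (r : R) {Φ Ψ : R ⥤ M} (τ : Φ ⟶ Ψ)
    (h : IsPullback (ρ.toMatchingObj r Φ) (τ.app r) (ρ.matchingObjMap r τ)
      (ρ.toMatchingObj r Ψ)) :
    IsIso (ρ.relativeMatchingMap r τ) := by
  apply isIso_singleObj
  have h' := ρ.isPullback_relativeMatching r τ
  have : ρ.relativeMatchingObjMap r τ = (h.isoIsPullback _ _ h').hom := by
    refine h'.hom_ext ?_ ?_
    · rw [map_matchingFst, IsPullback.isoIsPullback_hom_fst]
    · rw [map_matchingSnd, IsPullback.isoIsPullback_hom_snd]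
  change IsIso (ρ.relativeMatchingObjMap r τ)
  exact this ▸ Iso.isIso_hom _

variable {ρ} in
/-- Two Reedy factorizations of the same morphism yield the same morphism from the matching
object. -/
lemma matchingπ_map_eq (Φ : R ⥤ M) {r s z z' : R} {p : r ⟶ z} {i : z ⟶ s} {p' : r ⟶ z'}
    {i' : z' ⟶ s} (hp : ρ.minus p) (hi : ρ.plus i) (hz : ρ.deg z < ρ.deg r) (hp' : ρ.minus p')
    (hi' : ρ.plus i') (hz' : ρ.deg z' < ρ.deg r) (h : p ≫ i = p' ≫ i') :
    ρ.matchingπ Φ p hp hz ≫ Φ.map i = ρ.matchingπ Φ p' hp' hz' ≫ Φ.map i' := by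
  obtain ⟨e, he, rfl⟩ := ρ.factorization_unique p i p' i' hp hi hp' hi' h
  rw [Φ.map_comp, ← ρ.matchingπ_w Φ e.hom (ρ.minus_of_isIso e.hom) p hp hz p' hp' hz' he,
    Category.assoc]

/-- The morphism from the matching object defined by an arrow which factors through an object of
smaller degree. -/
lemma exists_matchingπ (Φ : R ⥤ M) (r : R) :
    ∃ k : ∀ (s : R) (f : r ⟶ s), (ρ.boundaryCosieve (ρ.deg r) r).arrows s f →
        (ρ.matchingObj r Φ ⟶ Φ.obj s),
      ∀ {s z : R} (p : r ⟶ z) (i : z ⟶ s) (hp : ρ.minus p) (_ : ρ.plus i)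
        (hz : ρ.deg z < ρ.deg r) (f : r ⟶ s) (h : (ρ.boundaryCosieve (ρ.deg r) r).arrows s f),
        p ≫ i = f → k s f h = ρ.matchingπ Φ p hp hz ≫ Φ.map i := by
  have key : ∀ (s : R) (f : r ⟶ s), (ρ.boundaryCosieve (ρ.deg r) r).arrows s f →
      ∃ k : ρ.matchingObj r Φ ⟶ Φ.obj s, ∀ {z : R} (p : r ⟶ z) (i : z ⟶ s) (hp : ρ.minus p)
        (_ : ρ.plus i) (hz : ρ.deg z < ρ.deg r), p ≫ i = f →
        k = ρ.matchingπ Φ p hp hz ≫ Φ.map i := by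
    rintro s f ⟨w, a, b, hw, hab⟩
    obtain ⟨z, p, i, hp, hi, hpi⟩ := ρ.exists_factorization f
    refine ⟨ρ.matchingπ Φ p hp
      ((ρ.deg_le_of_fac hp hi a b (hab.trans hpi.symm)).trans_lt hw) ≫ Φ.map i, ?_⟩
    intro z' p' i' hp' hi' hz' h
    exact matchingπ_map_eq Φ hp hi _ hp' hi' hz' (hpi.trans h.symm)
  choose k hk using key
  refine ⟨k, ?_⟩
  intro s z p i hp hi hz f h e
  exact hk s f h p i hp hi hz e

/-- The relative matching map of a transformation which is right orthogonal to the
transformations invertible below the degree of `r` is invertible. -/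
theorem isIso_relativeMatchingMap_of_rightOrth [HasColimits M] (r : R) {Φ Ψ : R ⥤ M} (τ : Φ ⟶ Ψ)
    (hτ : RightOrth (ρ.below (ρ.deg r)) τ) : IsIso (ρ.relativeMatchingMap r τ) := by
  apply isIso_relativeMatchingMap_of_isPullback
  -- The pullback property, tested on maps from `T`: maps out of the full copower are maps from `T`
  -- to the value at `r`, and a map `T ⟶ M_r Φ` gives a map to `Φ` out of the copower over the
  -- boundary cosieve.
  have key : ∀ {T : M} (l : T ⟶ ρ.matchingObj r Φ) (a : T ⟶ Ψ.obj r),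
      l ≫ ρ.matchingObjMap r τ = a ≫ ρ.toMatchingObj r Ψ →
      ∃! m : T ⟶ Φ.obj r, m ≫ ρ.toMatchingObj r Φ = l ∧ m ≫ τ.app r = a := by
    intro T l a w
    let S := ρ.boundaryCosieve (ρ.deg r) r
    obtain ⟨k, hk⟩ := ρ.exists_matchingπ Φ r
    have hS : ∀ {s : R} (f : r ⟶ s), S.arrows s f → ∃ (z : R) (p : r ⟶ z) (i : z ⟶ s),
        ρ.minus p ∧ ρ.plus i ∧ ρ.deg z < ρ.deg r ∧ p ≫ i = f := by
      rintro s f ⟨z, a, b, hz, hab⟩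
      obtain ⟨y, p, i, hp, hi, hpi⟩ := ρ.exists_factorization f
      exact ⟨y, p, i, hp, hi, (ρ.deg_le_of_fac hp hi a b (hab.trans hpi.symm)).trans_lt hz, hpi⟩
    have hk' : ∀ {s s' : R} (g : s ⟶ s') (f : r ⟶ s) (hf : S.arrows s f),
        k s f hf ≫ Φ.map g = k s' (f ≫ g) (S.upward_closed f hf g) := by
      intro s s' g f hf
      obtain ⟨z, p, i, hp, hi, hz, rfl⟩ := hS f hf
      obtain ⟨y, q, i', hq, hi', h⟩ := ρ.exists_factorization (i ≫ g)
      have e : (p ≫ q) ≫ i' = (p ≫ i) ≫ g := by rw [Category.assoc, h, Category.assoc]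
      have hpq := ρ.minus_isMultiplicative.comp_mem _ _ hp hq
      have hy := (ρ.deg_le_of_minus hq).trans_lt hz
      rw [hk (p ≫ q) i' hpq hi' hy _ _ e, hk p i hp hi hz _ _ rfl,
        ← ρ.matchingπ_w Φ q hq p hp hz (p ≫ q) hpq hy rfl, Category.assoc, Category.assoc,
        ← Φ.map_comp, ← Φ.map_comp, h]
    have unit : ∀ {s : R} (u : r ⟶ s) (hu : ρ.minus u) (hs : ρ.deg s < ρ.deg r)
        (h : S.arrows s u), k s u h = ρ.matchingπ Φ u hu hs := by
      intro s u hu hs h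
      rw [hk u (𝟙 s) hu (ρ.plus_isMultiplicative.id_mem s) hs u h (Category.comp_id _),
        Φ.map_id, Category.comp_id]
    let b : cosieveCopower (Cosieve.all r) T ⟶ Ψ :=
      cosieveCopowerDesc (Cosieve.all r) (fun _ f _ => a ≫ Ψ.map f)
        fun g f _ => by rw [Ψ.map_comp, Category.assoc]
    let t : cosieveCopower S T ⟶ Φ := cosieveCopowerDesc S (fun _ f hf => l ≫ k _ f hf)
      fun g f hf => by rw [Category.assoc, hk']
    have hw : t ≫ τ = cosieveCopowerInclusion S T ≫ b := by
      ext s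
      refine cosieveCopower_hom_ext fun f hf => ?_
      simp only [NatTrans.comp_app, t, b, reassoc_of% @cosieveCopowerι_inclusion,
        reassoc_of% @cosieveCopowerι_desc, cosieveCopowerι_desc]
      obtain ⟨z, p, i, hp, hi, hz, rfl⟩ := hS f hf
      rw [hk p i hp hi hz _ hf rfl, Category.assoc, Category.assoc, τ.naturality, Ψ.map_comp,
        ← reassoc_of% (ρ.matchingObjMap_π τ p hp hz), reassoc_of% w,
        reassoc_of% (ρ.toMatchingObj_π Ψ p hp hz)]
    obtain ⟨m, ⟨hm, hm'⟩, hm''⟩ := hτ (cosieveCopowerInclusion S T) (fun s hs =>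
      isIso_cosieveCopowerInclusion_app S T s fun f => ⟨s, f, 𝟙 s, hs, Category.comp_id _⟩) t b hw
    refine ⟨cosieveCopowerι (Cosieve.all r) T (𝟙 r) (Cosieve.all_arrows _) ≫ m.app r, ⟨?_, ?_⟩, ?_⟩
    · refine matchingObj_hom_ext fun {s} u hu hs => ?_
      have hu' : S.arrows s u := ⟨s, u, 𝟙 s, hs, Category.comp_id _⟩
      have h₁ := congrArg (fun f => cosieveCopowerι S T u hu' ≫ f.app s) hm
      simp only [NatTrans.comp_app, t, reassoc_of% @cosieveCopowerι_inclusion, cosieveCopowerι_desc,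
        unit u hu hs hu'] at h₁
      rw [Category.assoc, Category.assoc, ρ.toMatchingObj_π Φ u hu hs, ← m.naturality,
        reassoc_of% @cosieveCopower_ι_map, ← h₁]
      simp only [Category.id_comp]
    · rw [Category.assoc, ← NatTrans.comp_app, hm', cosieveCopowerι_desc, Ψ.map_id,
        Category.comp_id]
    · rintro m' ⟨h₁, h₂⟩
      have := hm'' (cosieveCopowerDesc (Cosieve.all r) (fun _ f _ => m' ≫ Φ.map f)
        fun g f _ => by rw [Φ.map_comp, Category.assoc]) ⟨?_, ?_⟩
      · rw [← this, cosieveCopowerι_desc, Φ.map_id, Category.comp_id]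
      · ext s
        refine cosieveCopower_hom_ext fun f hf => ?_
        simp only [NatTrans.comp_app, t, reassoc_of% @cosieveCopowerι_inclusion, cosieveCopowerι_desc]
        obtain ⟨z, p, i, hp, hi, hz, rfl⟩ := hS f hf
        rw [hk p i hp hi hz _ hf rfl, ← h₁, Category.assoc,
          reassoc_of% (ρ.toMatchingObj_π Φ p hp hz), Φ.map_comp]
      · ext s
        refine cosieveCopower_hom_ext fun f hf => ?_
        simp only [NatTrans.comp_app, b, reassoc_of% @cosieveCopowerι_desc, cosieveCopowerι_desc]
        rw [Category.assoc, τ.naturality, reassoc_of% h₂]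
  exact ⟨⟨ρ.toMatchingObj_naturality r τ⟩, ⟨PullbackCone.IsLimit.mk _
    (fun s => (key s.fst s.snd s.condition).choose)
    (fun s => (key s.fst s.snd s.condition).choose_spec.1.1)
    (fun s => (key s.fst s.snd s.condition).choose_spec.1.2)
    (fun s m h₁ h₂ => (key s.fst s.snd s.condition).choose_spec.2 m ⟨h₁, h₂⟩)⟩⟩

end Matching


/-! ### Lifting from relative latching and matching maps -/

variable {R : Type v} [SmallCategory R] (ρ : GeneralizedReedy R)
  {M : Type u} [Category.{v} M]

section

variable {ρ} {A B X Y : R ⥤ M} {i : A ⟶ B} {p : X ⟶ Y} {t : A ⟶ X} {b : B ⟶ Y} {r : R}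
  (L : PartialLift ρ.deg i p t b (ρ.deg r))

/-- The morphism out of the latching object induced by a partial filler. -/
noncomputable def partialLiftLatching [HasColimits M] : ρ.latchingObj r B ⟶ X.obj r :=
  ρ.latchingDesc (fun {s} u _ hs => L.app s hs ≫ X.map u) (by
    intro s t w u hu hs u' hu' ht _ h
    rw [← Category.assoc, L.naturality hs ht, Category.assoc, ← X.map_comp, h])

lemma latchingι_partialLift [HasColimits M] {s : R} (u : s ⟶ r) (hu : ρ.plus u)
    (hs : ρ.deg s < ρ.deg r) :
    ρ.latchingι B u hu hs ≫ partialLiftLatching L = L.app s hs ≫ X.map u :=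
  colimit.ι_desc _ (⟨s, u, hu, hs⟩ : ρ.LatchingIndex r)

/-- The morphism to the matching object induced by a partial filler. -/
noncomputable def partialLiftMatching [HasLimits M] : B.obj r ⟶ ρ.matchingObj r X :=
  ρ.matchingLift (fun {s} u _ hs => B.map u ≫ L.app s hs) (by
    intro s t w u hu hs u' hu' ht _ h
    rw [Category.assoc, ← L.naturality hs ht, ← Category.assoc, ← B.map_comp, h])

lemma partialLift_matchingπ [HasLimits M] {s : R} (u : r ⟶ s) (hu : ρ.minus u)
    (hs : ρ.deg s < ρ.deg r) :
    partialLiftMatching L ≫ ρ.matchingπ X u hu hs = B.map u ≫ L.app s hs :=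
  limit.lift_π _ (⟨s, u, hu, hs⟩ : ρ.MatchingIndex r)

/-- The morphism out of the latching object induced by a partial filler is equivariant. -/
noncomputable def partialLiftLatchingHom [HasColimits M] :
    ρ.latching r B ⟶ autInclusion r ⋙ X where
  app _ := partialLiftLatching L
  naturality _ _ g := by
    refine latchingObj_hom_ext (ρ := ρ) fun u hu hs => ?_
    refine (comp_comp_of_eq (ρ.latchingι_act B g u hu hs) _).trans ?_
    refine (latchingι_partialLift L _ _ _).trans ?_
    refine Eq.trans ?_ (comp_comp_of_eq (latchingι_partialLift L u hu hs) _).symm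
    exact (congrArg (L.app _ hs ≫ ·) (X.map_comp u _)).trans (Category.assoc _ _ _).symm

/-- The morphism to the matching object induced by a partial filler is equivariant. -/
noncomputable def partialLiftMatchingHom [HasLimits M] :
    autInclusion r ⋙ B ⟶ ρ.matching r X where
  app _ := partialLiftMatching L
  naturality _ _ g := by
    refine matchingObj_hom_ext (ρ := ρ) fun {s} u hu hs => ?_
    refine (Category.assoc _ _ _).trans ?_
    refine (congrArg (_ ≫ ·) (partialLift_matchingπ L u hu hs)).trans ?_
    refine Eq.trans ?_ (Category.assoc _ _ _).symm
    refine Eq.trans ?_ (congrArg (_ ≫ ·) (ρ.matchingAct_π X g u hu hs)).symm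
    refine Eq.trans ?_ (partialLift_matchingπ L _ _ _).symm
    exact (Category.assoc _ _ _).symm.trans (congrArg (· ≫ L.app s hs) (B.map_comp _ u).symm)

/-- The degree-lowering part of an arrow into `r` from a lower object ends at a still lower object,
where the partial filler is natural. Only the degree-raising part has to be tested, and dually for
arrows out of `r`. -/
lemma isExtension_of_plus_of_minus (k : B.obj r ⟶ X.obj r) (h₁ : i.app r ≫ k = t.app r)
    (h₂ : k ≫ p.app r = b.app r) (h₃ : ∀ g : r ≅ r, B.map g.hom ≫ k = k ≫ X.map g.hom)
    (h₄ : ∀ (s : R) (hs : ρ.deg s < ρ.deg r) (f : s ⟶ r), ρ.plus f →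
      B.map f ≫ k = L.app s hs ≫ X.map f)
    (h₅ : ∀ (s : R) (hs : ρ.deg s < ρ.deg r) (f : r ⟶ s), ρ.minus f →
      k ≫ X.map f = B.map f ≫ L.app s hs) : L.IsExtension k where
  fac_left := h₁
  fac_right := h₂
  aut := h₃
  naturality_left s hs f := by
    obtain ⟨z, a, e, ha, he, rfl⟩ := ρ.exists_factorization f
    have hz := (ρ.deg_le_of_minus ha).trans_lt hs
    rw [B.map_comp, Category.assoc, h₄ z hz e he, reassoc_of% (L.naturality hs hz a), X.map_comp]
  naturality_right s hs f := by
    obtain ⟨z, a, e, ha, he, rfl⟩ := ρ.exists_factorization f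
    have hz := (ρ.deg_le_of_plus he).trans_lt hs
    rw [X.map_comp, reassoc_of% (h₅ z hz a ha), ← L.naturality hz hs e, B.map_comp,
      Category.assoc]

end

lemma inl_relativeLatchingMap [HasColimits M] (r : R) {Φ Ψ : R ⥤ M} (τ : Φ ⟶ Ψ) :
    pushout.inl (ρ.latchingTo r Φ) (ρ.latchingMap r τ) ≫ ρ.relativeLatchingMap r τ =
      autRestrict r τ :=
  pushout.inl_desc _ _ _

lemma inr_relativeLatchingMap [HasColimits M] (r : R) {Φ Ψ : R ⥤ M} (τ : Φ ⟶ Ψ) :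
    pushout.inr (ρ.latchingTo r Φ) (ρ.latchingMap r τ) ≫ ρ.relativeLatchingMap r τ =
      ρ.latchingTo r Ψ :=
  pushout.inr_desc _ _ _

lemma relativeMatchingMap_fst [HasLimits M] (r : R) {Φ Ψ : R ⥤ M} (τ : Φ ⟶ Ψ) :
    ρ.relativeMatchingMap r τ ≫ pullback.fst (ρ.matchingMap r τ) (ρ.toMatching r Ψ) =
      ρ.toMatching r Φ :=
  pullback.lift_fst _ _ _

lemma relativeMatchingMap_snd [HasLimits M] (r : R) {Φ Ψ : R ⥤ M} (τ : Φ ⟶ Ψ) :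
    ρ.relativeMatchingMap r τ ≫ pullback.snd (ρ.matchingMap r τ) (ρ.toMatching r Ψ) =
      autRestrict r τ :=
  pullback.lift_snd _ _ _

variable [HasColimits M] [HasLimits M]

/-- The lifting property follows from the lifting properties of relative latching maps with
respect to relative matching maps. -/
theorem hasLiftingProperty_of_relative {A B X Y : R ⥤ M} (i : A ⟶ B) (p : X ⟶ Y)
    (h : ∀ r, HasLiftingProperty (ρ.relativeLatchingMap r i) (ρ.relativeMatchingMap r p)) :
    HasLiftingProperty i p where
  sq_hasLift {t b} sq := by
    suffices h : ∃ l : B ⟶ X, i ≫ l = t ∧ l ≫ p = b by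
      obtain ⟨l, hl, hl'⟩ := h
      exact ⟨⟨⟨l, hl, hl'⟩⟩⟩
    refine exists_lift_of_degreewise (deg := ρ.deg) (fun e => ρ.deg_eq_of_iso e)
      (fun f => ρ.exists_fac_of_not_isIso f) ?_
    intro r L
    have h₁ : ρ.latchingTo r A ≫ autRestrict r t =
        ρ.latchingMap r i ≫ partialLiftLatchingHom L := by
      refine NatTrans.ext <| funext fun _ => latchingObj_hom_ext (ρ := ρ) fun u hu hs => ?_
      refine (comp_comp_of_eq (ρ.latchingι_to A u hu hs) _).trans ?_
      refine Eq.trans ?_ (comp_comp_of_eq (ρ.latchingι_map i u hu hs) _).symm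
      refine Eq.trans ?_ (Category.assoc _ _ _).symm
      refine Eq.trans ?_ (congrArg (i.app _ ≫ ·) (latchingι_partialLift L u hu hs)).symm
      refine (t.naturality u).trans ?_
      rw [← L.fac_left _ hs, Category.assoc]
    have h₂ : partialLiftMatchingHom L ≫ ρ.matchingMap r p =
        autRestrict r b ≫ ρ.toMatching r Y := by
      refine NatTrans.ext <| funext fun _ => matchingObj_hom_ext (ρ := ρ) fun {s} u hu hs => ?_
      refine (Category.assoc _ _ _).trans ?_
      refine (congrArg (_ ≫ ·) (ρ.matchingObjMap_π p u hu hs)).trans ?_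
      refine (comp_comp_of_eq (partialLift_matchingπ L u hu hs) _).trans ?_
      refine Eq.trans ?_ (Category.assoc _ _ _).symm
      refine Eq.trans ?_ (congrArg (_ ≫ ·) (ρ.toMatchingObj_π Y u hu hs)).symm
      refine Eq.trans ?_ (b.naturality u)
      rw [← L.fac_right _ hs, Category.assoc]
    -- The latching and matching data meet here: for `u : s ⟶ r` and `u' : r ⟶ s'`, both sides
    -- express naturality of the partial filler along `u ≫ u'`, a map between lower objects that
    -- need not lie in either subcategory.
    have h₃ : partialLiftLatchingHom L ≫ ρ.toMatching r X =
        ρ.latchingTo r B ≫ partialLiftMatchingHom L := by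
      refine NatTrans.ext <| funext fun _ => latchingObj_hom_ext (ρ := ρ) fun {s} u hu hs =>
        matchingObj_hom_ext (ρ := ρ) fun {s'} u' hu' hs' => ?_
      change (_ ≫ partialLiftLatching L ≫ ρ.toMatchingObj r X) ≫ _ =
        (_ ≫ ρ.latchingObjTo r B ≫ partialLiftMatching L) ≫ _
      rw [Category.assoc, Category.assoc, Category.assoc, Category.assoc, ρ.toMatchingObj_π,
        partialLift_matchingπ, reassoc_of% @latchingι_partialLift,
        reassoc_of% (ρ.latchingι_to B u hu hs), ← X.map_comp, ← B.map_comp_assoc,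
        L.naturality hs hs']
    have h₄ : autRestrict r t ≫ ρ.toMatching r X = autRestrict r i ≫ partialLiftMatchingHom L := by
      refine NatTrans.ext <| funext fun _ => matchingObj_hom_ext (ρ := ρ) fun {s} u hu hs => ?_
      refine (Category.assoc _ _ _).trans ?_
      refine (congrArg (_ ≫ ·) (ρ.toMatchingObj_π X u hu hs)).trans ?_
      refine Eq.trans ?_ (Category.assoc _ _ _).symm
      refine Eq.trans ?_ (congrArg (_ ≫ ·) (partialLift_matchingπ L u hu hs)).symm
      refine (t.naturality u).symm.trans ?_
      change _ = i.app r ≫ _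
      rw [← L.fac_left s hs, ← Category.assoc, i.naturality, Category.assoc]
    have h₅ : partialLiftLatchingHom L ≫ autRestrict r p = ρ.latchingTo r B ≫ autRestrict r b := by
      refine NatTrans.ext <| funext fun _ => latchingObj_hom_ext (ρ := ρ) fun {s} u hu hs => ?_
      refine (comp_comp_of_eq (latchingι_partialLift L u hu hs) _).trans ?_
      refine Eq.trans ?_ (comp_comp_of_eq (ρ.latchingι_to B u hu hs) _).symm
      refine Eq.trans ?_ (b.naturality u).symm
      change (_ ≫ X.map u) ≫ p.app r = _
      rw [← L.fac_right s hs, Category.assoc, Category.assoc]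
      exact congrArg (L.app s hs ≫ ·) (p.naturality u)
    have h₆ : autRestrict r t ≫ autRestrict r p = autRestrict r i ≫ autRestrict r b := by
      rw [autRestrict, autRestrict, ← Functor.whiskerLeft_comp, sq.w, Functor.whiskerLeft_comp]
    -- The lower part of the filler enters the square: on the latching side of the top and on the
    -- matching side of the bottom. A lift of this square is the same as an equivariant extension.
    let top : pushout (ρ.latchingTo r A) (ρ.latchingMap r i) ⟶ autInclusion r ⋙ X :=
      pushout.desc (autRestrict r t) (partialLiftLatchingHom L) h₁
    let bot : autInclusion r ⋙ B ⟶ pullback (ρ.matchingMap r p) (ρ.toMatching r Y) :=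
      pullback.lift (partialLiftMatchingHom L) (autRestrict r b) h₂
    have hsq : CommSq top (ρ.relativeLatchingMap r i) (ρ.relativeMatchingMap r p) bot := by
      constructor
      refine pushout.hom_ext (pullback.hom_ext ?_ ?_) (pullback.hom_ext ?_ ?_) <;>
        simp only [top, bot, relativeLatchingMap, relativeMatchingMap, Category.assoc,
          pushout.inl_desc_assoc, pushout.inr_desc_assoc, pullback.lift_fst, pullback.lift_snd]
      exacts [h₄, h₆, h₃, h₅]
    have := h r
    have e₁ : pushout.inl _ _ ≫ ρ.relativeLatchingMap r i ≫ hsq.lift = autRestrict r t := by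
      rw [hsq.fac_left, pushout.inl_desc]
    have e₂ : pushout.inr _ _ ≫ ρ.relativeLatchingMap r i ≫ hsq.lift =
        partialLiftLatchingHom L := by
      rw [hsq.fac_left, pushout.inr_desc]
    have e₃ : (hsq.lift ≫ ρ.relativeMatchingMap r p) ≫ pullback.fst _ _ =
        partialLiftMatchingHom L := by
      rw [hsq.fac_right, pullback.lift_fst]
    have e₄ : (hsq.lift ≫ ρ.relativeMatchingMap r p) ≫ pullback.snd _ _ = autRestrict r b := by
      rw [hsq.fac_right, pullback.lift_snd]
    rw [reassoc_of% @inl_relativeLatchingMap] at e₁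
    rw [reassoc_of% @inr_relativeLatchingMap] at e₂
    rw [Category.assoc, relativeMatchingMap_fst] at e₃
    rw [Category.assoc, relativeMatchingMap_snd] at e₄
    let k : B.obj r ⟶ X.obj r := hsq.lift.app (SingleObj.star _)
    have c₁ : i.app r ≫ k = t.app r := congrArg
      (fun f : autInclusion r ⋙ A ⟶ autInclusion r ⋙ X => f.app (SingleObj.star _)) e₁
    have c₂ : ρ.latchingObjTo r B ≫ k = partialLiftLatching L := congrArg
      (fun f : ρ.latching r B ⟶ autInclusion r ⋙ X => f.app (SingleObj.star _)) e₂
    have c₃ : k ≫ ρ.toMatchingObj r X = partialLiftMatching L := congrArg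
      (fun f : autInclusion r ⋙ B ⟶ ρ.matching r X => f.app (SingleObj.star _)) e₃
    have c₄ : k ≫ p.app r = b.app r := congrArg
      (fun f : autInclusion r ⋙ B ⟶ autInclusion r ⋙ Y => f.app (SingleObj.star _)) e₄
    refine ⟨k, isExtension_of_plus_of_minus L k c₁ c₄ ?_ ?_ ?_⟩
    -- Equivariance comes for free, because the square was lifted among objects with an action of
    -- `Aut r`.
    · exact fun g => hsq.lift.naturality
        (show SingleObj.star (Aut r) ⟶ SingleObj.star (Aut r) from g)
    · intro s hs f hf
      rw [← latchingι_partialLift L f hf hs, ← c₂, reassoc_of% (ρ.latchingι_to B f hf hs)]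
    · intro s hs f hf
      rw [← partialLift_matchingπ L f hf hs, ← c₃, Category.assoc, ρ.toMatchingObj_π X f hf hs]


/-! ### Fillers over latching categories -/

section Latching

variable {R : Type v} [SmallCategory R] (ρ : GeneralizedReedy R)
  {M : Type u} [Category.{v} M] [HasColimits M]

/-- A degree-raising map that preserves the degree is invertible. Degreewise lifting over the
latching category therefore has no factorization condition to verify. -/
lemma latchingIndex_isIso {r : R} {a b : ρ.LatchingIndex r} (f : a ⟶ b)
    (h : ρ.deg a.obj = ρ.deg b.obj) : IsIso f := by
  have hf : IsIso (LatchingIndex.Hom.map f) := by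
    by_contra h'
    exact h.not_lt (ρ.deg_lt_of_plus _ (LatchingIndex.Hom.plus_map f) h')
  refine ⟨LatchingIndex.Hom.mk (inv (LatchingIndex.Hom.map f)) (ρ.plus_of_isIso _) ?_, ?_, ?_⟩
  · rw [IsIso.inv_comp_eq]
    exact (LatchingIndex.Hom.w f).symm
  · exact LatchingIndex.Hom.ext (IsIso.hom_inv_id _)
  · exact LatchingIndex.Hom.ext (IsIso.inv_hom_id _)

lemma latchingIndex_deg_eq {r : R} {a b : ρ.LatchingIndex r} (e : a ≅ b) :
    ρ.deg a.obj = ρ.deg b.obj :=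
  ρ.deg_eq_of_iso ((ρ.latchingForget r).mapIso e)

variable {ρ} in
/-- A partial filler over the latching category defines a morphism out of the latching object. -/
noncomputable def latchingOfPartialLift {r : R} {Ψ : R ⥤ M} {X : M} {Φ' Y' : ρ.LatchingIndex r ⥤ M}
    {i : Φ' ⟶ ρ.latchingForget r ⋙ Ψ} {p : (Functor.const _).obj X ⟶ Y'}
    {t : Φ' ⟶ (Functor.const _).obj X} {b : ρ.latchingForget r ⋙ Ψ ⟶ Y'}
    (a : ρ.LatchingIndex r)
    (L : PartialLift (fun a : ρ.LatchingIndex r => ρ.deg a.obj) i p t b (ρ.deg a.obj)) :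
    ρ.latchingObj a.obj Ψ ⟶ X :=
  ρ.latchingDesc (fun {s} u hu hs => L.app ⟨s, u ≫ a.arrow,
      ρ.plus_isMultiplicative.comp_mem _ _ hu a.plus_arrow, hs.trans a.deg_lt⟩ hs) (by
    intro s s' w u hu hs u' hu' hs' hw h
    refine (L.naturality (s := ⟨s, u ≫ a.arrow, _, _⟩) (s' := ⟨s', u' ≫ a.arrow, _, _⟩) hs hs'
      (LatchingIndex.Hom.mk w hw (by rw [← Category.assoc, h]))).trans ?_
    exact Category.comp_id _)

lemma latchingι_ofPartialLift {r : R} {Ψ : R ⥤ M} {X : M} {Φ' Y' : ρ.LatchingIndex r ⥤ M}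
    {i : Φ' ⟶ ρ.latchingForget r ⋙ Ψ} {p : (Functor.const _).obj X ⟶ Y'}
    {t : Φ' ⟶ (Functor.const _).obj X} {b : ρ.latchingForget r ⋙ Ψ ⟶ Y'}
    (a : ρ.LatchingIndex r)
    (L : PartialLift (fun a : ρ.LatchingIndex r => ρ.deg a.obj) i p t b (ρ.deg a.obj))
    (c : ρ.LatchingIndex r) (hc : ρ.deg c.obj < ρ.deg a.obj) (f : c ⟶ a) :
    ρ.latchingι Ψ (LatchingIndex.Hom.map f) (LatchingIndex.Hom.plus_map f) hc ≫
      latchingOfPartialLift a L = L.app c hc := by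
  refine (colimit.ι_desc _ (⟨c.obj, LatchingIndex.Hom.map f, LatchingIndex.Hom.plus_map f, hc⟩ :
    ρ.LatchingIndex a.obj)).trans ?_
  -- The index built from `f` carries the arrow `f ≫ a.arrow`, which equals the arrow of `c` only by
  -- the triangle defining `f`.
  have aux : ∀ {s : R} (u u' : s ⟶ r) (hu : ρ.plus u) (hu' : ρ.plus u') (hs : ρ.deg s < ρ.deg r)
      (hs' : ρ.deg s < ρ.deg a.obj), u = u' →
      (L.app ⟨s, u, hu, hs⟩ hs' : Ψ.obj s ⟶ X) = L.app ⟨s, u', hu', hs⟩ hs' := by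
    rintro s u u' hu hu' hs hs' rfl
    rfl
  exact aux _ _ _ _ _ _ (LatchingIndex.Hom.w f)

end Latching

/-! ### Lifting properties of maps of matching objects -/

section Matching

variable {R : Type v} [SmallCategory R] (ρ : GeneralizedReedy R)
  {M : Type u} [Category.{v} M] [HasLimits M]

lemma matchingIndex_isIso {r : R} {a b : ρ.MatchingIndex r} (f : a ⟶ b)
    (h : ρ.deg a.obj = ρ.deg b.obj) : IsIso f := by
  have hf : IsIso (MatchingIndex.Hom.map f) := by
    by_contra h'
    exact h.not_gt (ρ.deg_lt_of_minus _ (MatchingIndex.Hom.minus_map f) h')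
  refine ⟨MatchingIndex.Hom.mk (inv (MatchingIndex.Hom.map f)) (ρ.minus_of_isIso _) ?_, ?_, ?_⟩
  · rw [IsIso.comp_inv_eq]
    exact (MatchingIndex.Hom.w f).symm
  · exact MatchingIndex.Hom.ext (IsIso.hom_inv_id _)
  · exact MatchingIndex.Hom.ext (IsIso.inv_hom_id _)

lemma matchingIndex_deg_eq {r : R} {a b : ρ.MatchingIndex r} (e : a ≅ b) :
    ρ.deg a.obj = ρ.deg b.obj :=
  ρ.deg_eq_of_iso ((ρ.matchingForget r).mapIso e)

variable {ρ} in
/-- A partial filler over the matching category defines a morphism to the matching object. -/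
noncomputable def matchingOfPartialLift {r : R} {Φ : R ⥤ M} {B : M} {A' Y' : ρ.MatchingIndex r ⥤ M}
    {i : A' ⟶ (Functor.const _).obj B} {p : ρ.matchingForget r ⋙ Φ ⟶ Y'}
    {t : A' ⟶ ρ.matchingForget r ⋙ Φ} {b : (Functor.const _).obj B ⟶ Y'}
    (a : ρ.MatchingIndex r)
    (L : PartialLift (fun a : ρ.MatchingIndex r => ρ.deg a.obj) i p t b (ρ.deg a.obj)) :
    B ⟶ ρ.matchingObj a.obj Φ :=
  ρ.matchingLift (fun {s} u hu hs => L.app ⟨s, a.arrow ≫ u,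
      ρ.minus_isMultiplicative.comp_mem _ _ a.minus_arrow hu, hs.trans a.deg_lt⟩ hs) (by
    intro s s' w u hu hs u' hu' hs' hw h
    refine (L.naturality (s := ⟨s, a.arrow ≫ u, _, _⟩) (s' := ⟨s', a.arrow ≫ u', _, _⟩) hs hs'
      (MatchingIndex.Hom.mk w hw (by rw [Category.assoc, h]))).symm.trans ?_
    exact Category.id_comp _)

lemma ofPartialLift_matchingπ {r : R} {Φ : R ⥤ M} {B : M} {A' Y' : ρ.MatchingIndex r ⥤ M}
    {i : A' ⟶ (Functor.const _).obj B} {p : ρ.matchingForget r ⋙ Φ ⟶ Y'}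
    {t : A' ⟶ ρ.matchingForget r ⋙ Φ} {b : (Functor.const _).obj B ⟶ Y'}
    (a : ρ.MatchingIndex r)
    (L : PartialLift (fun a : ρ.MatchingIndex r => ρ.deg a.obj) i p t b (ρ.deg a.obj))
    (c : ρ.MatchingIndex r) (hc : ρ.deg c.obj < ρ.deg a.obj) (f : a ⟶ c) :
    matchingOfPartialLift a L ≫ ρ.matchingπ Φ (MatchingIndex.Hom.map f)
      (MatchingIndex.Hom.minus_map f) hc = L.app c hc := by
  refine (limit.lift_π _ (⟨c.obj, MatchingIndex.Hom.map f, MatchingIndex.Hom.minus_map f, hc⟩ :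
    ρ.MatchingIndex a.obj)).trans ?_
  have aux : ∀ {s : R} (u u' : r ⟶ s) (hu : ρ.minus u) (hu' : ρ.minus u')
      (hs : ρ.deg s < ρ.deg r) (hs' : ρ.deg s < ρ.deg a.obj), u = u' →
      (L.app ⟨s, u, hu, hs⟩ hs' : B ⟶ Φ.obj s) = L.app ⟨s, u', hu', hs⟩ hs' := by
    rintro s u u' hu hu' hs hs' rfl
    rfl
  exact aux _ _ _ _ _ _ (MatchingIndex.Hom.w f)

/-- If the relative matching maps of a transformation at the objects of degree less than that of
`r` have the right lifting property with respect to a morphism of `M`, then so does the induced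
morphism between matching objects. -/
theorem hasLiftingProperty_matchingObjMap {A B : M} (j : A ⟶ B) (r : R) {Φ Ψ : R ⥤ M} (τ : Φ ⟶ Ψ)
    (h : ∀ s, ρ.deg s < ρ.deg r → HasLiftingProperty j (ρ.relativeMatchingObjMap s τ)) :
    HasLiftingProperty j (ρ.matchingObjMap r τ) where
  sq_hasLift {f g} sq := by
    let F := ρ.matchingForget r
    -- A map into `M_r` is a cone, that is, a transformation from a constant diagram over the
    -- matching category. The lift is built there by induction on the degree of the target of the
    -- arrow.
    obtain ⟨l, hl, hl'⟩ := exists_lift_of_degreewise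
      (deg := fun a : ρ.MatchingIndex r => ρ.deg a.obj)
      (i := (Functor.const (ρ.MatchingIndex r)).map j)
      (p := Functor.whiskerLeft F τ)
      (t := (Functor.const _).map f ≫ (limit.cone (F ⋙ Φ)).π)
      (b := (Functor.const _).map g ≫ (limit.cone (F ⋙ Ψ)).π)
      (fun e => ρ.matchingIndex_deg_eq e)
      (fun f hf hf' => absurd (ρ.matchingIndex_isIso f hf) hf') (by
        intro a L
        have hw : j ≫ matchingOfPartialLift a L =
            f ≫ ρ.matchingπ Φ a.arrow a.minus_arrow a.deg_lt ≫ ρ.toMatchingObj a.obj Φ := by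
          refine matchingObj_hom_ext fun {s} u hu hs => ?_
          let c : ρ.MatchingIndex r := ⟨s, a.arrow ≫ u,
            ρ.minus_isMultiplicative.comp_mem _ _ a.minus_arrow hu, hs.trans a.deg_lt⟩
          let e : a ⟶ c := MatchingIndex.Hom.mk u hu rfl
          have h₁ := ρ.ofPartialLift_matchingπ a L c hs e
          have h₂ : j ≫ L.app c hs = f ≫ ρ.matchingπ Φ (a.arrow ≫ u) c.minus_arrow c.deg_lt :=
            L.fac_left c hs
          refine (Category.assoc _ _ _).trans ((congrArg (j ≫ ·) h₁).trans (h₂.trans ?_))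
          rw [Category.assoc, Category.assoc, ρ.toMatchingObj_π,
            ρ.matchingπ_w Φ u hu a.arrow a.minus_arrow a.deg_lt (a.arrow ≫ u) c.minus_arrow
              c.deg_lt rfl]
        have hw' : matchingOfPartialLift a L ≫ ρ.matchingObjMap a.obj τ =
            (g ≫ ρ.matchingπ Ψ a.arrow a.minus_arrow a.deg_lt) ≫ ρ.toMatchingObj a.obj Ψ := by
          refine matchingObj_hom_ext fun {s} u hu hs => ?_
          let c : ρ.MatchingIndex r := ⟨s, a.arrow ≫ u,
            ρ.minus_isMultiplicative.comp_mem _ _ a.minus_arrow hu, hs.trans a.deg_lt⟩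
          let e : a ⟶ c := MatchingIndex.Hom.mk u hu rfl
          have h₁ := ρ.ofPartialLift_matchingπ a L c hs e
          have h₂ : L.app c hs ≫ τ.app s = g ≫ ρ.matchingπ Ψ (a.arrow ≫ u) c.minus_arrow c.deg_lt :=
            L.fac_right c hs
          refine (Category.assoc _ _ _).trans ?_
          refine (congrArg (_ ≫ ·) (ρ.matchingObjMap_π τ u hu hs)).trans ?_
          refine (comp_comp_of_eq h₁ _).trans (h₂.trans ?_)
          rw [Category.assoc, Category.assoc, ρ.toMatchingObj_π,
            ρ.matchingπ_w Ψ u hu a.arrow a.minus_arrow a.deg_lt (a.arrow ≫ u) c.minus_arrow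
              c.deg_lt rfl]
        have pb := ρ.isPullback_relativeMatching a.obj τ
        -- Every degree-lowering map out of `a.obj` to a lower object gives an index below `a`, so
        -- the filler so far determines the component in the matching object of `a.obj`; only a lift
        -- against the relative matching map remains.
        have hsq : CommSq (f ≫ ρ.matchingπ Φ a.arrow a.minus_arrow a.deg_lt) j
            (ρ.relativeMatchingObjMap a.obj τ)
            (pb.lift (matchingOfPartialLift a L)
              (g ≫ ρ.matchingπ Ψ a.arrow a.minus_arrow a.deg_lt) hw') := by
          constructor
          refine pb.hom_ext ?_ ?_
          · rw [Category.assoc, Category.assoc, map_matchingFst, Category.assoc, pb.lift_fst, hw]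
          · rw [Category.assoc, Category.assoc, map_matchingSnd, Category.assoc, pb.lift_snd,
              ← ρ.matchingObjMap_π, reassoc_of% sq.w]
        have := h a.obj a.deg_lt
        obtain ⟨k, hk, hk'⟩ : ∃ k, j ≫ k = f ≫ ρ.matchingπ Φ a.arrow a.minus_arrow a.deg_lt ∧
            k ≫ ρ.relativeMatchingObjMap a.obj τ = pb.lift (matchingOfPartialLift a L)
              (g ≫ ρ.matchingπ Ψ a.arrow a.minus_arrow a.deg_lt) hw' :=
          ⟨hsq.lift, hsq.fac_left, hsq.fac_right⟩
        have c₃ : k ≫ ρ.toMatchingObj a.obj Φ = matchingOfPartialLift a L := by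
          rw [← ρ.map_matchingFst a.obj τ, reassoc_of% hk', pb.lift_fst]
        have c₄ : k ≫ τ.app a.obj = g ≫ ρ.matchingπ Ψ a.arrow a.minus_arrow a.deg_lt := by
          rw [← ρ.map_matchingSnd a.obj τ, reassoc_of% hk', pb.lift_snd]
        refine ⟨k, hk, c₄, ?_, ?_, ?_⟩
        · intro e
          -- Automorphisms of the index fix its arrow, hence are identities. This is why a lift in
          -- `M`, with no equivariance, is enough.
          have he : MatchingIndex.Hom.map e.hom = 𝟙 a.obj :=
            ρ.eq_id_of_minus a.arrow _ a.minus_arrow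
              (Iso.isIso_hom ((ρ.matchingForget r).mapIso e)) (MatchingIndex.Hom.w e.hom)
          have : (F ⋙ Φ).map e.hom = 𝟙 (Φ.obj a.obj) :=
            (congrArg Φ.map he).trans (Φ.map_id _)
          rw [this]
          exact (Category.id_comp _).trans (Category.comp_id _).symm
        · intro c hc e
          -- Morphisms of the matching category cannot raise the degree, so nothing arrives from a
          -- lower index.
          exact absurd hc (ρ.deg_le_of_minus (MatchingIndex.Hom.minus_map e)).not_gt
        · intro c hc e
          rw [← ρ.ofPartialLift_matchingπ a L c hc e, ← c₃]
          refine Eq.trans ?_ (Category.id_comp _).symm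
          rw [Category.assoc]
          exact congrArg (k ≫ ·) (ρ.toMatchingObj_π Φ _ _ _).symm)
    refine ⟨⟨⟨limit.lift (F ⋙ Φ) ⟨B, l⟩, ?_, ?_⟩⟩⟩
    · refine limit.hom_ext fun a => ?_
      refine (Category.assoc _ _ _).trans ((congrArg (j ≫ ·) (limit.lift_π _ a)).trans ?_)
      exact congrArg (fun x => x.app a) hl
    · refine matchingObj_hom_ext fun {s} u hu hs => ?_
      refine (Category.assoc _ _ _).trans ?_
      refine (congrArg (_ ≫ ·) (ρ.matchingObjMap_π τ u hu hs)).trans ?_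
      refine (comp_comp_of_eq (limit.lift_π _ (⟨s, u, hu, hs⟩ : ρ.MatchingIndex r)) _).trans ?_
      exact congrArg (fun x => x.app (⟨s, u, hu, hs⟩ : ρ.MatchingIndex r)) hl'

end Matching

end GeneralizedReedy

/-! ### Lifting properties of maps of latching objects -/

namespace DualizableGeneralizedReedy

variable {R : Type v} [SmallCategory R] (ρ : DualizableGeneralizedReedy R)
  {M : Type u} [Category.{v} M] [HasColimits M]

open GeneralizedReedy

/-- If the relative latching maps of a transformation at the objects of degree less than that of
`r` have the left lifting property with respect to a morphism of `M`, then so does the induced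
morphism between latching objects. -/
theorem hasLiftingProperty_latchingObjMap (r : R) {Φ Ψ : R ⥤ M} (τ : Φ ⟶ Ψ) {X Y : M} (q : X ⟶ Y)
    (h : ∀ s, ρ.deg s < ρ.deg r → HasLiftingProperty (ρ.relativeLatchingObjMap s τ) q) :
    HasLiftingProperty (ρ.latchingObjMap r τ) q where
  sq_hasLift {f g} sq := by
    let F := ρ.latchingForget r
    -- Here the lift is a cocone over the latching category. At an index `a`, the lower components
    -- glue to a map out of the latching object of `a.obj`, which the relative latching map then
    -- extends.
    obtain ⟨l, hl, hl'⟩ := exists_lift_of_degreewise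
      (deg := fun a : ρ.LatchingIndex r => ρ.deg a.obj)
      (i := Functor.whiskerLeft F τ)
      (p := (Functor.const (ρ.LatchingIndex r)).map q)
      (t := (colimit.cocone (F ⋙ Φ)).ι ≫ (Functor.const _).map f)
      (b := (colimit.cocone (F ⋙ Ψ)).ι ≫ (Functor.const _).map g)
      (fun e => ρ.latchingIndex_deg_eq e)
      (fun f hf hf' => absurd (ρ.latchingIndex_isIso f hf) hf') (by
        intro a L
        have hw : ρ.latchingObjTo a.obj Φ ≫ ρ.latchingι Φ a.arrow a.plus_arrow a.deg_lt ≫ f =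
            ρ.latchingObjMap a.obj τ ≫ latchingOfPartialLift a L := by
          refine latchingObj_hom_ext fun {s} u hu hs => ?_
          let c : ρ.LatchingIndex r := ⟨s, u ≫ a.arrow,
            ρ.plus_isMultiplicative.comp_mem _ _ hu a.plus_arrow, hs.trans a.deg_lt⟩
          let e : c ⟶ a := LatchingIndex.Hom.mk u hu rfl
          have h₁ := ρ.latchingι_ofPartialLift a L c hs e
          have h₂ : τ.app s ≫ L.app c hs = ρ.latchingι Φ (u ≫ a.arrow) c.plus_arrow c.deg_lt ≫ f :=
            L.fac_left c hs
          refine Eq.trans ?_ (comp_comp_of_eq (ρ.latchingι_map τ u hu hs) _).symm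
          refine Eq.trans ?_ (Category.assoc _ _ _).symm
          refine Eq.trans ?_ (congrArg (τ.app s ≫ ·) h₁).symm
          refine Eq.trans ?_ h₂.symm
          rw [reassoc_of% (ρ.latchingι_to Φ u hu hs), ← Category.assoc,
            ρ.latchingι_w Φ u hu (u ≫ a.arrow) c.plus_arrow c.deg_lt a.arrow a.plus_arrow
              a.deg_lt rfl]
        have hw' : latchingOfPartialLift a L ≫ q =
            ρ.latchingObjTo a.obj Ψ ≫ ρ.latchingι Ψ a.arrow a.plus_arrow a.deg_lt ≫ g := by
          refine latchingObj_hom_ext fun {s} u hu hs => ?_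
          let c : ρ.LatchingIndex r := ⟨s, u ≫ a.arrow,
            ρ.plus_isMultiplicative.comp_mem _ _ hu a.plus_arrow, hs.trans a.deg_lt⟩
          let e : c ⟶ a := LatchingIndex.Hom.mk u hu rfl
          have h₁ := ρ.latchingι_ofPartialLift a L c hs e
          have h₂ : L.app c hs ≫ q = ρ.latchingι Ψ (u ≫ a.arrow) c.plus_arrow c.deg_lt ≫ g :=
            L.fac_right c hs
          refine (comp_comp_of_eq h₁ _).trans (h₂.trans ?_)
          rw [reassoc_of% (ρ.latchingι_to Ψ u hu hs), ← Category.assoc,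
            ρ.latchingι_w Ψ u hu (u ≫ a.arrow) c.plus_arrow c.deg_lt a.arrow a.plus_arrow
              a.deg_lt rfl]
        have po := ρ.isPushout_relativeLatching a.obj τ
        have hsq : CommSq
            (po.desc (ρ.latchingι Φ a.arrow a.plus_arrow a.deg_lt ≫ f)
              (latchingOfPartialLift a L) hw)
            (ρ.relativeLatchingObjMap a.obj τ) q
            (ρ.latchingι Ψ a.arrow a.plus_arrow a.deg_lt ≫ g) := by
          constructor
          refine po.hom_ext ?_ ?_
          · rw [po.inl_desc_assoc, reassoc_of% @latchingInl_map, Category.assoc, sq.w,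
              reassoc_of% (ρ.latchingι_map τ a.arrow a.plus_arrow a.deg_lt)]
          · rw [po.inr_desc_assoc, reassoc_of% @latchingInr_map, hw']
        have := h a.obj a.deg_lt
        obtain ⟨k, hk, hk'⟩ : ∃ k, ρ.relativeLatchingObjMap a.obj τ ≫ k =
              po.desc (ρ.latchingι Φ a.arrow a.plus_arrow a.deg_lt ≫ f)
                (latchingOfPartialLift a L) hw ∧
            k ≫ q = ρ.latchingι Ψ a.arrow a.plus_arrow a.deg_lt ≫ g :=
          ⟨hsq.lift, hsq.fac_left, hsq.fac_right⟩
        have c₁ : τ.app a.obj ≫ k = ρ.latchingι Φ a.arrow a.plus_arrow a.deg_lt ≫ f := by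
          rw [← ρ.latchingInl_map a.obj τ, Category.assoc, hk, po.inl_desc]
        have c₂ : ρ.latchingObjTo a.obj Ψ ≫ k = latchingOfPartialLift a L := by
          rw [← ρ.latchingInr_map a.obj τ, Category.assoc, hk, po.inr_desc]
        refine ⟨k, c₁, hk', ?_, ?_, ?_⟩
        · intro e
          -- Dualizability enters here: it makes the automorphisms of a latching index trivial, so
          -- the lift need not be equivariant.
          have he : LatchingIndex.Hom.map e.hom = 𝟙 a.obj :=
            ρ.eq_id_of_plus a.arrow _ a.plus_arrow
              (Iso.isIso_hom ((ρ.latchingForget r).mapIso e)) (LatchingIndex.Hom.w e.hom)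
          have : (F ⋙ Ψ).map e.hom = 𝟙 (Ψ.obj a.obj) :=
            (congrArg Ψ.map he).trans (Ψ.map_id _)
          rw [this]
          exact (Category.id_comp _).trans (Category.comp_id _).symm
        · intro c hc e
          rw [← ρ.latchingι_ofPartialLift a L c hc e, ← c₂]
          refine Eq.trans ?_ (Category.comp_id _).symm
          rw [← Category.assoc]
          exact congrArg (· ≫ k) (ρ.latchingι_to Ψ _ _ _).symm
        · intro c hc e
          exact absurd hc (ρ.deg_le_of_plus (LatchingIndex.Hom.plus_map e)).not_gt)
    refine ⟨⟨⟨colimit.desc (F ⋙ Ψ) ⟨X, l⟩, ?_, ?_⟩⟩⟩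
    · refine latchingObj_hom_ext fun {s} u hu hs => ?_
      refine (comp_comp_of_eq (ρ.latchingι_map τ u hu hs) _).trans ?_
      refine (Category.assoc _ _ _).trans ?_
      refine (congrArg (τ.app s ≫ ·)
        (colimit.ι_desc _ (⟨s, u, hu, hs⟩ : ρ.LatchingIndex r))).trans ?_
      exact congrArg (fun x => x.app (⟨s, u, hu, hs⟩ : ρ.LatchingIndex r)) hl
    · refine colimit.hom_ext fun a => ?_
      refine (comp_comp_of_eq (colimit.ι_desc _ a) _).trans ?_
      exact congrArg (fun x => x.app a) hl'

end DualizableGeneralizedReedy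

namespace GeneralizedReedy

/-! ### Functoriality of relative maps and retracts -/

section Functoriality

variable {R : Type v} [SmallCategory R] (ρ : GeneralizedReedy R)
  {M : Type u} [Category.{v} M]

lemma autRestrict_comp (r : R) {Φ Ψ Ω : R ⥤ M} (τ : Φ ⟶ Ψ) (σ : Ψ ⟶ Ω) :
    autRestrict r (τ ≫ σ) = autRestrict r τ ≫ autRestrict r σ := rfl

lemma latchingMap_id [HasColimits M] (r : R) (Φ : R ⥤ M) :
    ρ.latchingMap r (𝟙 Φ) = 𝟙 _ :=
  NatTrans.ext <| funext fun _ => latchingObj_hom_ext (ρ := ρ) fun u hu hs => by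
    refine (ρ.latchingι_map _ u hu hs).trans ?_
    exact (Category.id_comp _).trans (Category.comp_id _).symm

lemma latchingMap_comp [HasColimits M] (r : R) {Φ Ψ Ω : R ⥤ M} (τ : Φ ⟶ Ψ) (σ : Ψ ⟶ Ω) :
    ρ.latchingMap r (τ ≫ σ) = ρ.latchingMap r τ ≫ ρ.latchingMap r σ :=
  NatTrans.ext <| funext fun _ => latchingObj_hom_ext (ρ := ρ) fun u hu hs => by
    refine (ρ.latchingι_map _ u hu hs).trans ?_
    refine Eq.trans ?_ (comp_comp_of_eq (ρ.latchingι_map τ u hu hs) _).symm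
    refine (Category.assoc _ _ _).trans (Eq.trans ?_ (Category.assoc _ _ _).symm)
    exact congrArg (τ.app _ ≫ ·) (ρ.latchingι_map σ u hu hs).symm

lemma matchingMap_id [HasLimits M] (r : R) (Φ : R ⥤ M) :
    ρ.matchingMap r (𝟙 Φ) = 𝟙 _ :=
  NatTrans.ext <| funext fun _ => matchingObj_hom_ext (ρ := ρ) fun u hu hs => by
    refine (ρ.matchingObjMap_π _ u hu hs).trans ?_
    exact (Category.comp_id _).trans (Category.id_comp _).symm

lemma matchingMap_comp [HasLimits M] (r : R) {Φ Ψ Ω : R ⥤ M} (τ : Φ ⟶ Ψ) (σ : Ψ ⟶ Ω) :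
    ρ.matchingMap r (τ ≫ σ) = ρ.matchingMap r τ ≫ ρ.matchingMap r σ :=
  NatTrans.ext <| funext fun _ => matchingObj_hom_ext (ρ := ρ) fun {s} u hu hs => by
    refine (ρ.matchingObjMap_π _ u hu hs).trans ?_
    refine Eq.trans ?_ (Category.assoc _ _ _).symm
    refine Eq.trans ?_ (congrArg (_ ≫ ·) (ρ.matchingObjMap_π σ u hu hs)).symm
    refine (Category.assoc _ _ _).symm.trans (Eq.trans ?_ (Category.assoc _ _ _))
    exact congrArg (· ≫ σ.app s) (ρ.matchingObjMap_π τ u hu hs).symm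

/-- The morphism between the sources of the relative latching maps induced by a commutative
square. -/
noncomputable def relativeLatchingSourceMap [HasColimits M] (r : R) {Φ Ψ Φ' Ψ' : R ⥤ M}
    {τ : Φ ⟶ Ψ} {τ' : Φ' ⟶ Ψ'} {a : Φ ⟶ Φ'} {b : Ψ ⟶ Ψ'} (h : a ≫ τ' = τ ≫ b) :
    pushout (ρ.latchingTo r Φ) (ρ.latchingMap r τ) ⟶
      pushout (ρ.latchingTo r Φ') (ρ.latchingMap r τ') :=
  pushout.desc (autRestrict r a ≫ pushout.inl _ _)
    (ρ.latchingMap r b ≫ pushout.inr _ _) (by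
      rw [← Category.assoc, latchingTo_naturality, Category.assoc, pushout.condition,
        ← Category.assoc, ← latchingMap_comp, h, latchingMap_comp, Category.assoc])

lemma inl_relativeLatchingSourceMap [HasColimits M] (r : R) {Φ Ψ Φ' Ψ' : R ⥤ M}
    {τ : Φ ⟶ Ψ} {τ' : Φ' ⟶ Ψ'} {a : Φ ⟶ Φ'} {b : Ψ ⟶ Ψ'} (h : a ≫ τ' = τ ≫ b) :
    pushout.inl _ _ ≫ ρ.relativeLatchingSourceMap r h = autRestrict r a ≫ pushout.inl _ _ :=
  pushout.inl_desc _ _ _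

lemma inr_relativeLatchingSourceMap [HasColimits M] (r : R) {Φ Ψ Φ' Ψ' : R ⥤ M}
    {τ : Φ ⟶ Ψ} {τ' : Φ' ⟶ Ψ'} {a : Φ ⟶ Φ'} {b : Ψ ⟶ Ψ'} (h : a ≫ τ' = τ ≫ b) :
    pushout.inr _ _ ≫ ρ.relativeLatchingSourceMap r h = ρ.latchingMap r b ≫ pushout.inr _ _ :=
  pushout.inr_desc _ _ _

lemma relativeLatchingSourceMap_comp_map [HasColimits M] (r : R) {Φ Ψ Φ' Ψ' : R ⥤ M}
    {τ : Φ ⟶ Ψ} {τ' : Φ' ⟶ Ψ'} {a : Φ ⟶ Φ'} {b : Ψ ⟶ Ψ'} (h : a ≫ τ' = τ ≫ b) :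
    ρ.relativeLatchingSourceMap r h ≫ ρ.relativeLatchingMap r τ' =
      ρ.relativeLatchingMap r τ ≫ autRestrict r b := by
  refine pushout.hom_ext ?_ ?_
  · rw [reassoc_of% @inl_relativeLatchingSourceMap, inl_relativeLatchingMap,
      reassoc_of% @inl_relativeLatchingMap, ← autRestrict_comp, h, autRestrict_comp]
  · rw [reassoc_of% @inr_relativeLatchingSourceMap, inr_relativeLatchingMap,
      reassoc_of% @inr_relativeLatchingMap, latchingTo_naturality]

lemma relativeLatchingSourceMap_comp_eq_id [HasColimits M] (r : R) {Φ Ψ Φ' Ψ' : R ⥤ M}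
    {τ : Φ ⟶ Ψ} {τ' : Φ' ⟶ Ψ'} {a : Φ ⟶ Φ'} {b : Ψ ⟶ Ψ'} (h : a ≫ τ' = τ ≫ b)
    {a' : Φ' ⟶ Φ} {b' : Ψ' ⟶ Ψ} (h' : a' ≫ τ = τ' ≫ b') (ha : a ≫ a' = 𝟙 Φ)
    (hb : b ≫ b' = 𝟙 Ψ) :
    ρ.relativeLatchingSourceMap r h ≫ ρ.relativeLatchingSourceMap r h' = 𝟙 _ := by
  refine pushout.hom_ext ?_ ?_
  · rw [reassoc_of% @inl_relativeLatchingSourceMap, inl_relativeLatchingSourceMap, ← Category.assoc,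
      ← autRestrict_comp, ha, Category.comp_id]
    exact Category.id_comp _
  · rw [reassoc_of% @inr_relativeLatchingSourceMap, inr_relativeLatchingSourceMap, ← Category.assoc,
      ← latchingMap_comp, hb, latchingMap_id, Category.comp_id, Category.id_comp]

/-- The relative latching map of a retract is a retract of the relative latching map. -/
noncomputable def retractRelativeLatchingMap [HasColimits M] (r : R) {Φ Ψ Φ' Ψ' : R ⥤ M}
    {τ : Φ ⟶ Ψ} {τ' : Φ' ⟶ Ψ'} (h : RetractArrow τ τ') :
    RetractArrow (ρ.relativeLatchingMap r τ) (ρ.relativeLatchingMap r τ') where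
  i := Arrow.homMk (ρ.relativeLatchingSourceMap r h.i_w) (autRestrict r h.i.right)
    (ρ.relativeLatchingSourceMap_comp_map r h.i_w)
  r := Arrow.homMk (ρ.relativeLatchingSourceMap r h.r_w) (autRestrict r h.r.right)
    (ρ.relativeLatchingSourceMap_comp_map r h.r_w)
  retract := Arrow.hom_ext _ _
    (ρ.relativeLatchingSourceMap_comp_eq_id r h.i_w h.r_w h.retract_left h.retract_right)
    (congrArg (autRestrict r) h.retract_right)

/-- The morphism between the targets of the relative matching maps induced by a commutative
square. -/
noncomputable def relativeMatchingTargetMap [HasLimits M] (r : R) {Φ Ψ Φ' Ψ' : R ⥤ M}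
    {τ : Φ ⟶ Ψ} {τ' : Φ' ⟶ Ψ'} {a : Φ ⟶ Φ'} {b : Ψ ⟶ Ψ'} (h : a ≫ τ' = τ ≫ b) :
    pullback (ρ.matchingMap r τ) (ρ.toMatching r Ψ) ⟶
      pullback (ρ.matchingMap r τ') (ρ.toMatching r Ψ') :=
  pullback.lift (pullback.fst _ _ ≫ ρ.matchingMap r a)
    (pullback.snd _ _ ≫ autRestrict r b) (by
      rw [Category.assoc, Category.assoc, ← matchingMap_comp, h, matchingMap_comp,
        ← toMatching_naturality, ← Category.assoc, pullback.condition, Category.assoc])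

lemma relativeMatchingTargetMap_fst [HasLimits M] (r : R) {Φ Ψ Φ' Ψ' : R ⥤ M}
    {τ : Φ ⟶ Ψ} {τ' : Φ' ⟶ Ψ'} {a : Φ ⟶ Φ'} {b : Ψ ⟶ Ψ'} (h : a ≫ τ' = τ ≫ b) :
    ρ.relativeMatchingTargetMap r h ≫ pullback.fst _ _ = pullback.fst _ _ ≫ ρ.matchingMap r a :=
  pullback.lift_fst _ _ _

lemma relativeMatchingTargetMap_snd [HasLimits M] (r : R) {Φ Ψ Φ' Ψ' : R ⥤ M}
    {τ : Φ ⟶ Ψ} {τ' : Φ' ⟶ Ψ'} {a : Φ ⟶ Φ'} {b : Ψ ⟶ Ψ'} (h : a ≫ τ' = τ ≫ b) :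
    ρ.relativeMatchingTargetMap r h ≫ pullback.snd _ _ = pullback.snd _ _ ≫ autRestrict r b :=
  pullback.lift_snd _ _ _

lemma map_comp_relativeMatchingTargetMap [HasLimits M] (r : R) {Φ Ψ Φ' Ψ' : R ⥤ M}
    {τ : Φ ⟶ Ψ} {τ' : Φ' ⟶ Ψ'} {a : Φ ⟶ Φ'} {b : Ψ ⟶ Ψ'} (h : a ≫ τ' = τ ≫ b) :
    autRestrict r a ≫ ρ.relativeMatchingMap r τ' =
      ρ.relativeMatchingMap r τ ≫ ρ.relativeMatchingTargetMap r h := by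
  refine pullback.hom_ext ?_ ?_
  · rw [Category.assoc, Category.assoc, relativeMatchingTargetMap_fst, relativeMatchingMap_fst,
      reassoc_of% @relativeMatchingMap_fst, toMatching_naturality]
  · rw [Category.assoc, Category.assoc, relativeMatchingTargetMap_snd, relativeMatchingMap_snd,
      reassoc_of% @relativeMatchingMap_snd, ← autRestrict_comp, h, autRestrict_comp]

lemma relativeMatchingTargetMap_comp_eq_id [HasLimits M] (r : R) {Φ Ψ Φ' Ψ' : R ⥤ M}
    {τ : Φ ⟶ Ψ} {τ' : Φ' ⟶ Ψ'} {a : Φ ⟶ Φ'} {b : Ψ ⟶ Ψ'} (h : a ≫ τ' = τ ≫ b)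
    {a' : Φ' ⟶ Φ} {b' : Ψ' ⟶ Ψ} (h' : a' ≫ τ = τ' ≫ b') (ha : a ≫ a' = 𝟙 Φ)
    (hb : b ≫ b' = 𝟙 Ψ) :
    ρ.relativeMatchingTargetMap r h ≫ ρ.relativeMatchingTargetMap r h' = 𝟙 _ := by
  refine pullback.hom_ext ?_ ?_
  · rw [Category.assoc, relativeMatchingTargetMap_fst, reassoc_of% @relativeMatchingTargetMap_fst,
      ← matchingMap_comp, ha, matchingMap_id, Category.comp_id, Category.id_comp]
  · rw [Category.assoc, relativeMatchingTargetMap_snd, reassoc_of% @relativeMatchingTargetMap_snd,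
      ← autRestrict_comp, hb, Category.id_comp]
    exact Category.comp_id _

/-- The relative matching map of a retract is a retract of the relative matching map. -/
noncomputable def retractRelativeMatchingMap [HasLimits M] (r : R) {Φ Ψ Φ' Ψ' : R ⥤ M}
    {τ : Φ ⟶ Ψ} {τ' : Φ' ⟶ Ψ'} (h : RetractArrow τ τ') :
    RetractArrow (ρ.relativeMatchingMap r τ) (ρ.relativeMatchingMap r τ') where
  i := Arrow.homMk (autRestrict r h.i.left) (ρ.relativeMatchingTargetMap r h.i_w)
    (ρ.map_comp_relativeMatchingTargetMap r h.i_w)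
  r := Arrow.homMk (autRestrict r h.r.left) (ρ.relativeMatchingTargetMap r h.r_w)
    (ρ.map_comp_relativeMatchingTargetMap r h.r_w)
  retract := Arrow.hom_ext _ _ (congrArg (autRestrict r) h.retract_left)
    (ρ.relativeMatchingTargetMap_comp_eq_id r h.i_w h.r_w h.retract_left h.retract_right)

end Functoriality

/-! ### Injective model structures on objects with a group action -/

section Injective

variable {M : Type u} [Category.{v} M] [ModelCategory M]

/-- Fibrations of the injective model structure on a category of objects with a group action are
fibrations of the underlying objects. -/
lemma fibration_app_of_injective [HasColimits M] {G : Type v} [Group G]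
    [ModelCategory (SingleObj G ⥤ M)] [IsInjectiveModelStructure (SingleObj G) M]
    {P Q : SingleObj G ⥤ M} (p : P ⟶ Q) (hp : Fibration p) (x : SingleObj G) :
    Fibration (p.app x) := by
  rw [fibration_iff, ← MorphismProperty.rlp_eq_of_wfs (trivialCofibrations M) (fibrations M)]
  intro A B j hj
  change HasLiftingProperty j (((evaluation (SingleObj G) M).obj x).map p)
  -- Lifting against the component at `x` is lifting against `p` from the free object on `j`, which
  -- at each `y` is a coproduct of copies of `j` over the arrows `x ⟶ y`.
  rw [← (evaluationAdjunctionRight M x).hasLiftingProperty_iff]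
  have key : ∀ y, trivialCofibrations M (((evaluationLeftAdjoint M x).map j).app y) := by
    intro y
    -- A coproduct of trivial cofibrations is one, since lifts can be chosen summand by summand.
    rw [← MorphismProperty.llp_eq_of_wfs (trivialCofibrations M) (fibrations M)]
    intro X Y q hq
    have h : ∀ g : x ⟶ y, HasLiftingProperty j q := fun _ =>
      MorphismProperty.hasLiftingProperty_of_wfs j q hj hq
    constructor
    intro f g sq
    have hs : ∀ u : x ⟶ y, Sigma.ι (fun _ : x ⟶ y => A) u ≫ ((evaluationLeftAdjoint M x).map j).app y
        = j ≫ Sigma.ι (fun _ : x ⟶ y => B) u := fun u => Sigma.ι_desc _ _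
    have w : ∀ u : x ⟶ y, CommSq (Sigma.ι (fun _ : x ⟶ y => A) u ≫ f) j q
        (Sigma.ι (fun _ : x ⟶ y => B) u ≫ g) := fun u => ⟨by
      refine (Category.assoc _ _ _).trans ((congrArg (_ ≫ ·) sq.w).trans ?_)
      refine (GeneralizedReedy.comp_comp_of_eq (hs u) g).trans ?_
      exact Category.assoc _ _ _⟩
    choose l hl hl' using fun u => show ∃ l, j ≫ l = _ ∧ l ≫ q = _ from
      have := h u
      ⟨(w u).lift, (w u).fac_left, (w u).fac_right⟩
    refine ⟨⟨⟨Sigma.desc l, ?_, ?_⟩⟩⟩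
    · refine Limits.Sigma.hom_ext _ _ fun u => ?_
      refine (GeneralizedReedy.comp_comp_of_eq (hs u) _).trans ?_
      refine (Category.assoc _ _ _).trans ((congrArg (j ≫ ·) (Sigma.ι_desc _ _)).trans (hl u))
    · refine Limits.Sigma.hom_ext _ _ fun u => ?_
      exact (GeneralizedReedy.comp_comp_of_eq (Sigma.ι_desc _ _) _).trans (hl' u)
  have : Cofibration ((evaluationLeftAdjoint M x).map j) :=
    (IsInjectiveModelStructure.cofibration_iff_app _).2 fun y =>
      (cofibration_iff _).2 (key y).1
  have : WeakEquivalence ((evaluationLeftAdjoint M x).map j) :=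
    (IsInjectiveModelStructure.weakEquivalence_iff_app _).2 fun y =>
      (weakEquivalence_iff _).2 (key y).2
  infer_instance

lemma weakEquivalence_iff_star {G : Type v} [Group G]
    [ModelCategory (SingleObj G ⥤ M)] [IsInjectiveModelStructure (SingleObj G) M]
    {P Q : SingleObj G ⥤ M} (p : P ⟶ Q) :
    WeakEquivalence p ↔ WeakEquivalence (p.app (SingleObj.star G)) := by
  rw [IsInjectiveModelStructure.weakEquivalence_iff_app]
  exact ⟨fun h => h _, fun h => by rintro ⟨⟩; exact h⟩

lemma cofibration_iff_star {G : Type v} [Group G]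
    [ModelCategory (SingleObj G ⥤ M)] [IsInjectiveModelStructure (SingleObj G) M]
    {P Q : SingleObj G ⥤ M} (p : P ⟶ Q) :
    Cofibration p ↔ Cofibration (p.app (SingleObj.star G)) := by
  rw [IsInjectiveModelStructure.cofibration_iff_app]
  exact ⟨fun h => h _, fun h => by rintro ⟨⟩; exact h⟩

end Injective

/-! ### Trivial fibrations through relative matching maps -/

section Model

variable {R : Type v} [SmallCategory R] (ρ : GeneralizedReedy R)
  {M : Type u} [Category.{v} M] [ModelCategory M]
  [∀ r : R, ModelCategory (SingleObj (Aut r) ⥤ M)]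
  [∀ r : R, IsInjectiveModelStructure (SingleObj (Aut r)) M]

lemma weakEquivalence_autRestrict_iff (r : R) {Φ Ψ : R ⥤ M} (τ : Φ ⟶ Ψ) :
    WeakEquivalence (autRestrict r τ) ↔ WeakEquivalence (τ.app r) :=
  weakEquivalence_iff_star _

/-- For a transformation whose relative matching maps are fibrations, being an objectwise weak
equivalence can be checked on the relative matching maps. -/
theorem weakEquivalence_relativeMatchingMap_iff [HasLimits M] [HasColimits M] {Φ Ψ : R ⥤ M}
    (τ : Φ ⟶ Ψ) (hτ : ∀ r, Fibration (ρ.relativeMatchingMap r τ)) :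
    (∀ r, WeakEquivalence (ρ.relativeMatchingMap r τ)) ↔
      ∀ r, WeakEquivalence (autRestrict r τ) := by
  have hfib : ∀ r, Fibration (ρ.relativeMatchingObjMap r τ) := fun r =>
    fibration_app_of_injective _ (hτ r) _
  -- If the relative matching maps below `r` are trivial fibrations, so are `M_r τ` and its pullback
  -- `matchingSnd`. Since `τ.app r` is the relative matching map followed by that pullback,
  -- two-out-of-three applies.
  have key : ∀ r, (∀ s, ρ.deg s < ρ.deg r → WeakEquivalence (ρ.relativeMatchingObjMap s τ)) →
      (WeakEquivalence (τ.app r) ↔ WeakEquivalence (ρ.relativeMatchingObjMap r τ)) := by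
    intro r hr
    have h₁ : trivialFibrations M (ρ.matchingObjMap r τ) := by
      rw [← MorphismProperty.rlp_eq_of_wfs (cofibrations M) (trivialFibrations M)]
      intro A B j hj
      refine ρ.hasLiftingProperty_matchingObjMap j r τ fun s hs => ?_
      have := hr s hs
      have := hfib s
      exact MorphismProperty.hasLiftingProperty_of_wfs _ _ hj
        (mem_trivialFibrations (ρ.relativeMatchingObjMap s τ))
    have h₂ : trivialFibrations M (ρ.matchingSnd r τ) :=
      MorphismProperty.of_isPullback (ρ.isPullback_relativeMatching r τ) h₁
    have : WeakEquivalence (ρ.matchingSnd r τ) := (weakEquivalence_iff _).2 h₂.2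
    rw [← ρ.map_matchingSnd r τ, weakEquivalence_postcomp_iff]
  have h₁ : ∀ r, WeakEquivalence (ρ.relativeMatchingMap r τ) ↔
      WeakEquivalence (ρ.relativeMatchingObjMap r τ) := fun r => weakEquivalence_iff_star _
  simp only [h₁, weakEquivalence_autRestrict_iff]
  refine ⟨fun h r => (key r fun s _ => h s).2 (h r), fun h => ?_⟩
  -- The converse needs induction on the degree, because `key` assumes the conclusion at all lower
  -- objects.
  suffices ∀ n r, ρ.deg r = n → WeakEquivalence (ρ.relativeMatchingObjMap r τ) from
    fun r => this _ r rfl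
  intro n
  induction n using Nat.strong_induction_on with
  | h n ih =>
    rintro r rfl
    exact (key r fun s hs => ih _ hs s rfl).1 (h r)

end Model

end GeneralizedReedy

/-! ### Trivial cofibrations through relative latching maps -/

namespace DualizableGeneralizedReedy

open GeneralizedReedy

variable {R : Type v} [SmallCategory R] (ρ : DualizableGeneralizedReedy R)
  {M : Type u} [Category.{v} M] [HasColimits M] [ModelCategory M]
  [∀ r : R, ModelCategory (SingleObj (Aut r) ⥤ M)]
  [∀ r : R, IsInjectiveModelStructure (SingleObj (Aut r)) M]

/-- For a transformation whose relative latching maps are cofibrations, being an objectwise weak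
equivalence can be checked on the relative latching maps. -/
theorem weakEquivalence_relativeLatchingMap_iff {Φ Ψ : R ⥤ M}
    (τ : Φ ⟶ Ψ) (hτ : ∀ r, Cofibration (ρ.relativeLatchingMap r τ)) :
    (∀ r, WeakEquivalence (ρ.relativeLatchingMap r τ)) ↔
      ∀ r, WeakEquivalence (autRestrict r τ) := by
  have hcof : ∀ r, Cofibration (ρ.relativeLatchingObjMap r τ) := fun r =>
    (cofibration_iff_star _).1 (hτ r)
  -- Here `τ.app r` is `latchingInl`, a pushout of the trivial cofibration `L_r τ`, followed by the
  -- relative latching map.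
  have key : ∀ r, (∀ s, ρ.deg s < ρ.deg r → WeakEquivalence (ρ.relativeLatchingObjMap s τ)) →
      (WeakEquivalence (τ.app r) ↔ WeakEquivalence (ρ.relativeLatchingObjMap r τ)) := by
    intro r hr
    have h₁ : trivialCofibrations M (ρ.latchingObjMap r τ) := by
      rw [← MorphismProperty.llp_eq_of_wfs (trivialCofibrations M) (fibrations M)]
      intro X Y q hq
      refine ρ.hasLiftingProperty_latchingObjMap r τ q fun s hs => ?_
      have := hr s hs
      have := hcof s
      exact MorphismProperty.hasLiftingProperty_of_wfs _ _
        (mem_trivialCofibrations (ρ.relativeLatchingObjMap s τ)) hq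
    have h₂ : trivialCofibrations M (ρ.latchingInl r τ) :=
      MorphismProperty.of_isPushout (ρ.isPushout_relativeLatching r τ) h₁
    have : WeakEquivalence (ρ.latchingInl r τ) := (weakEquivalence_iff _).2 h₂.2
    rw [← ρ.latchingInl_map r τ, weakEquivalence_precomp_iff]
  have h₁ : ∀ r, WeakEquivalence (ρ.relativeLatchingMap r τ) ↔
      WeakEquivalence (ρ.relativeLatchingObjMap r τ) := fun r => weakEquivalence_iff_star _
  simp only [h₁, weakEquivalence_autRestrict_iff]
  refine ⟨fun h r => (key r fun s _ => h s).2 (h r), fun h => ?_⟩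
  suffices ∀ n r, ρ.deg r = n → WeakEquivalence (ρ.relativeLatchingObjMap r τ) from
    fun r => this _ r rfl
  intro n
  induction n using Nat.strong_induction_on with
  | h n ih =>
    rintro r rfl
    exact (key r fun s hs => ih _ hs s rfl).1 (h r)

end DualizableGeneralizedReedy

namespace CategoryTheory

/-! ### Gluing equivariant factorizations -/

section Glue

variable {C : Type*} [Category C] {M : Type*} [Category M]

/-- The morphism between values of equivariant objects indexed by the objects of a category,
induced by an isomorphism of equal objects. -/
def castMap (X : ∀ c : C, SingleObj (Aut c) ⥤ M) {c d : C} (h : c = d) (g : c ≅ d) :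
    (X c).obj (SingleObj.star _) ⟶ (X d).obj (SingleObj.star _) :=
  match d, h, g with
  | _, rfl, g => (X c).map (show SingleObj.star (Aut c) ⟶ SingleObj.star (Aut c) from g)

variable (X : ∀ c : C, SingleObj (Aut c) ⥤ M)

lemma castMap_id {c : C} : castMap X rfl (Iso.refl c) = 𝟙 _ :=
  (X c).map_id _

lemma castMap_comp {c d e : C} (h : c = d) (h' : d = e) (f : c ≅ d) (g : d ≅ e) :
    castMap X (h.trans h') (f ≪≫ g) = castMap X h f ≫ castMap X h' g := by
  subst h h'
  exact (X c).map_comp (show SingleObj.star (Aut c) ⟶ SingleObj.star (Aut c) from f)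
    (show SingleObj.star (Aut c) ⟶ SingleObj.star (Aut c) from g)

lemma map_comp_castMap {P : C ⥤ M} (p : ∀ c, autInclusion c ⋙ P ⟶ X c) {c d : C} (h : c = d)
    (g : c ≅ d) :
    (p c).app (SingleObj.star _) ≫ castMap X h g =
      P.map g.hom ≫ (p d).app (SingleObj.star _) := by
  subst h
  exact ((p c).naturality (show SingleObj.star (Aut c) ⟶ SingleObj.star (Aut c) from g)).symm

lemma castMap_comp_app {Q : C ⥤ M} (q : ∀ c, X c ⟶ autInclusion c ⋙ Q) {c d : C} (h : c = d)
    (g : c ≅ d) :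
    castMap X h g ≫ (q d).app (SingleObj.star _) =
      (q c).app (SingleObj.star _) ≫ Q.map g.hom := by
  subst h
  exact (q c).naturality (show SingleObj.star (Aut c) ⟶ SingleObj.star (Aut c) from g)

/-- Equivariant factorizations of the components of a natural transformation can be glued at
representatives of the isomorphism classes. -/
theorem exists_glued_factorization (S : C → Prop) {P Q : C ⥤ M} (α : P ⟶ Q)
    (β : ∀ z, S z → (Q.obj z ⟶ P.obj z))
    (hαβ : ∀ z (hz : S z), α.app z ≫ β z hz = 𝟙 _)
    (hβα : ∀ z (hz : S z), β z hz ≫ α.app z = 𝟙 _)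
    (hS : ∀ {c d z z' : C} (a : c ⟶ z) (b : z ⟶ d) (a' : c ⟶ z') (b' : z' ⟶ d) (hz : S z)
      (hz' : S z'), a ≫ b = a' ≫ b' →
        Q.map a ≫ β z hz ≫ P.map b = Q.map a' ≫ β z' hz' ≫ P.map b')
    (hfac : ∀ {c d : C} (f : c ⟶ d), (∃ (z : C) (a : c ⟶ z) (b : z ⟶ d), S z ∧ a ≫ b = f) ∨
      IsIso f)
    (hid : ∀ {c z : C} (a : c ⟶ z) (b : z ⟶ c), S z → a ≫ b = 𝟙 c → S c)
    (p : ∀ c, autInclusion c ⋙ P ⟶ X c) (q : ∀ c, X c ⟶ autInclusion c ⋙ Q)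
    (hpq : ∀ c, p c ≫ q c = autRestrict c α) (hp : ∀ c, S c → IsIso (p c)) :
    ∃ (Z : C ⥤ M) (p' : P ⟶ Z) (q' : Z ⟶ Q), p' ≫ q' = α ∧ (∀ c, S c → IsIso (p'.app c)) ∧
      ∀ c, ¬ S c → ∃ (d : C) (_ : c ≅ d) (θ : autInclusion d ⋙ Z ≅ X d),
        autRestrict d p' ≫ θ.hom = p d ∧ θ.hom ≫ q d = autRestrict d q' := by
  have hSiso : ∀ {c d : C}, (c ≅ d) → S c → S d := fun e hc => hid e.inv e.hom hc e.inv_hom_id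
  obtain ⟨p₀, hp₀⟩ : ∃ p₀ : ∀ c, P.obj c ⟶ (X c).obj (SingleObj.star _),
    ∀ c, (p c).app (SingleObj.star _) = p₀ c := ⟨_, fun _ => rfl⟩
  obtain ⟨q₀, hq₀⟩ : ∃ q₀ : ∀ c, (X c).obj (SingleObj.star _) ⟶ Q.obj c,
    ∀ c, (q c).app (SingleObj.star _) = q₀ c := ⟨_, fun _ => rfl⟩
  have hpq₀ : ∀ c, p₀ c ≫ q₀ c = α.app c := fun c => by
    rw [← hp₀, ← hq₀]
    exact congrArg (fun t => t.app (SingleObj.star _)) (hpq c)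
  have hpm : ∀ {c d : C} (h : c = d) (g : c ≅ d),
      p₀ c ≫ castMap X h g = P.map g.hom ≫ p₀ d := fun h g => by
    rw [← hp₀, ← hp₀]
    exact map_comp_castMap X p h g
  have hqm : ∀ {c d : C} (h : c = d) (g : c ≅ d),
      castMap X h g ≫ q₀ d = q₀ c ≫ Q.map g.hom := fun h g => by
    rw [← hq₀, ← hq₀]
    exact castMap_comp_app X q h g
  have hpiso : ∀ c, S c → IsIso (p₀ c) := fun c hc => by
    have := hp c hc
    have h : IsIso ((p c).app (SingleObj.star _)) := inferInstance
    rw [← hp₀]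
    exact h
  obtain ⟨Z, p', q', e, h₁, h₂, h₃⟩ := exists_glued_functor S α β hαβ hβα hS hfac hid
    (fun c => (X (isoRep c)).obj (SingleObj.star _))
    (fun c => P.map (isoToRep c).hom ≫ p₀ (isoRep c))
    (fun c => q₀ (isoRep c) ≫ Q.map (isoToRep c).inv)
    (fun c => by
      rw [Category.assoc, reassoc_of% (hpq₀ (isoRep c)), ← α.naturality, ← P.map_comp_assoc,
        Iso.hom_inv_id, P.map_id, Category.id_comp])
    (fun c hc => by
      have := hpiso _ (hSiso (isoToRep c) hc)
      infer_instance)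
    -- The value at `c` is the chosen factorization at its representative, so an isomorphism acts
    -- through the conjugated automorphism of that representative.
    (fun {c d} f => castMap X (isoRep_eq f) ((isoToRep c).symm ≪≫ f ≪≫ isoToRep d))
    (fun c => by
      rw [Iso.refl_trans, Iso.symm_self_id]
      exact castMap_id X)
    (fun {c d e} f g => by
      rw [← castMap_comp]
      congr 1
      simp)
    (fun {c d} f => by
      rw [Category.assoc, hpm, ← P.map_comp_assoc, ← P.map_comp_assoc]
      simp)
    (fun {c d} f => by
      rw [← Category.assoc, hqm, Category.assoc, Category.assoc, ← Q.map_comp, ← Q.map_comp]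
      simp)
  refine ⟨Z, p', q', ?_, ?_, ?_⟩
  · ext c
    rw [NatTrans.comp_app, ← h₂, reassoc_of% (h₁ c), reassoc_of% (hpq₀ (isoRep c)),
      ← α.naturality, ← P.map_comp_assoc, Iso.hom_inv_id, P.map_id, Category.id_comp]
  · intro c hc
    have := hpiso _ (hSiso (isoToRep c) hc)
    rw [(Iso.eq_comp_inv (e c)).2 (h₁ c)]
    infer_instance
  · intro c hc
    have hd : ¬ S (isoRep c) := fun h => hc (hSiso (isoToRep c).symm h)
    have hrep : isoRep (isoRep c) = isoRep c := isoRep_eq (isoToRep c).symm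
    refine ⟨isoRep c, isoToRep c, ?_⟩
    -- All that matters about `d` from now on is that it equals its own representative.
    generalize isoRep c = d at hd hrep
    -- Even for a representative, `isoToRep d` may be a nontrivial automorphism; `k` undoes this
    -- twist.
    let k : (X (isoRep d)).obj (SingleObj.star _) ≅ (X d).obj (SingleObj.star _) :=
      { hom := castMap X hrep (isoToRep d).symm
        inv := castMap X hrep.symm (isoToRep d)
        hom_inv_id := by
          rw [← castMap_comp, Iso.symm_self_id]
          exact castMap_id X
        inv_hom_id := by
          rw [← castMap_comp, Iso.self_symm_id]
          exact castMap_id X }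
    have hk : ∀ g : d ≅ d, Z.map g.hom ≫ (e d).hom ≫ k.hom =
        ((e d).hom ≫ k.hom) ≫ castMap X rfl g := by
      intro g
      rw [reassoc_of% (h₃ d g hd), Category.assoc]
      congr 1
      rw [← castMap_comp, ← castMap_comp]
      congr 1
      simp
    refine ⟨NatIso.ofComponents (fun _ => e d ≪≫ k) (fun {x y} g => ?_), ?_, ?_⟩
    · exact hk g
    · refine NatTrans.ext (funext fun _ => ?_)
      have : p'.app d ≫ (e d).hom ≫ k.hom = p₀ d := by
        rw [reassoc_of% (h₁ d), hpm, ← P.map_comp_assoc]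
        simp
      exact this.trans (hp₀ d).symm
    · refine NatTrans.ext (funext fun _ => ?_)
      have : ((e d).hom ≫ k.hom) ≫ q₀ d = q'.app d := by
        rw [Category.assoc, hqm, ← h₂ d]
        rfl
      exact (congrArg (((e d).hom ≫ k.hom) ≫ ·) (hq₀ d)).trans this

end Glue


/-- The functor induced on automorphism groups by a functor. -/
def autFunctor {C D : Type*} [Category C] [Category D] (F : C ⥤ D) (c : C) :
    SingleObj (Aut c) ⥤ SingleObj (Aut (F.obj c)) where
  obj _ := SingleObj.star _
  map g := F.mapIso (show c ≅ c from g)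
  map_id _ := F.mapIso_refl c
  map_comp f g := F.mapIso_trans (show c ≅ c from f) (show c ≅ c from g)

end CategoryTheory

namespace GeneralizedReedy

/-! ### Extending a factorization by one degree -/

section Step

variable {R : Type v} [SmallCategory R] (ρ : GeneralizedReedy R)
  {M : Type u} [Category.{v} M]

-- Each path through an object below `n` can be moved, by naturality of `β`, to a Reedy
-- factorization of its composite whose middle object is also below `n`. Such factorizations are
-- unique up to isomorphism, so only the composite matters.
include ρ in
lemma map_inv_map_eq {n : ℕ} {P Q : R ⥤ M} (β : ∀ z, ρ.below n z → (Q.obj z ⟶ P.obj z))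
    (hβ : ∀ {z w : R} (hz : ρ.below n z) (hw : ρ.below n w) (f : z ⟶ w),
      Q.map f ≫ β w hw = β z hz ≫ P.map f)
    {c d z z' : R} (a : c ⟶ z) (b : z ⟶ d) (a' : c ⟶ z') (b' : z' ⟶ d)
    (hz : ρ.below n z) (hz' : ρ.below n z') (h : a ≫ b = a' ≫ b') :
    Q.map a ≫ β z hz ≫ P.map b = Q.map a' ≫ β z' hz' ≫ P.map b' := by
  have key : ∀ {z : R} (a : c ⟶ z) (b : z ⟶ d) (hz : ρ.below n z),
      ∃ (w : R) (p : c ⟶ w) (i : w ⟶ d) (hw : ρ.below n w), ρ.minus p ∧ ρ.plus i ∧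
        a ≫ b = p ≫ i ∧ Q.map a ≫ β z hz ≫ P.map b = Q.map p ≫ β w hw ≫ P.map i := by
    intro z a b hz
    obtain ⟨x, p₁, i₁, hp₁, hi₁, rfl⟩ := ρ.exists_factorization a
    obtain ⟨y, p₂, i₂, hp₂, hi₂, h₂⟩ := ρ.exists_factorization (i₁ ≫ b)
    have hx : ρ.below n x := (ρ.deg_le_of_plus hi₁).trans_lt hz
    have hy : ρ.below n y := (ρ.deg_le_of_minus hp₂).trans_lt hx
    refine ⟨y, p₁ ≫ p₂, i₂, hy, ρ.minus_isMultiplicative.comp_mem _ _ hp₁ hp₂, hi₂, ?_, ?_⟩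
    · rw [Category.assoc, Category.assoc, h₂]
    · rw [Q.map_comp, Q.map_comp, Category.assoc, Category.assoc,
        reassoc_of% (hβ hx hz i₁), reassoc_of% (hβ hx hy p₂), ← P.map_comp, ← P.map_comp, h₂]
  obtain ⟨w, p, i, hw, hp, hi, e, he⟩ := key a b hz
  obtain ⟨w', p', i', hw', hp', hi', e', he'⟩ := key a' b' hz'
  obtain ⟨u, hu, hu'⟩ := ρ.factorization_unique p i p' i' hp hi hp' hi' (e.symm.trans (h.trans e'))
  rw [he, he', ← hu, ← hu', Q.map_comp, P.map_comp, Category.assoc,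
    reassoc_of% (hβ hw hw' u.hom)]

/-- A natural transformation which is invertible below degree `n` can be factored with prescribed
factorizations in degree `n`. -/
theorem exists_factorization_step [HasColimits M] (n : ℕ)
    (TL TR : ∀ r : R, MorphismProperty (SingleObj (Aut r) ⥤ M))
    [∀ r, (TL r).RespectsIso] [∀ r, (TR r).RespectsIso]
    (hT : ∀ (r : R) {X Y : SingleObj (Aut r) ⥤ M} (f : X ⟶ Y),
      ∃ (Z : SingleObj (Aut r) ⥤ M) (i : X ⟶ Z) (p : Z ⟶ Y), i ≫ p = f ∧ TL r i ∧ TR r p)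
    (hTL : ∀ {r s : R} (_ : r ≅ s) {Φ Ψ : R ⥤ M} (τ : Φ ⟶ Ψ), TL s (autRestrict s τ) →
      TL r (autRestrict r τ))
    (hTR : ∀ {r s : R} (_ : r ≅ s) {Φ Ψ : R ⥤ M} (τ : Φ ⟶ Ψ), TR s (autRestrict s τ) →
      TR r (autRestrict r τ))
    {P Q : R ⥤ M} (α : P ⟶ Q) (hα : IsoOn (ρ.below n) α) :
    ∃ (P' : R ⥤ M) (j : P ⟶ P') (k : P' ⟶ Q), j ≫ k = α ∧ LeftOrth (ρ.below (n + 1)) j ∧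
      IsoOn (ρ.below n) j ∧ ∀ r, ρ.deg r = n → TL r (autRestrict r j) ∧ TR r (autRestrict r k) := by
  have hfactor : ∀ r : R, ∃ (X : SingleObj (Aut r) ⥤ M) (p : autInclusion r ⋙ P ⟶ X)
      (q : X ⟶ autInclusion r ⋙ Q), p ≫ q = autRestrict r α ∧ (ρ.below n r → IsIso p) ∧
        (ρ.deg r = n → TL r p ∧ TR r q) := by
    intro r
    -- Below degree `n` the transformation is already invertible, so the factorization with first
    -- map the identity keeps the diagram unchanged there.
    by_cases hr : ρ.below n r
    · exact ⟨_, 𝟙 _, autRestrict r α, Category.id_comp _, fun _ => inferInstance,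
        fun h => absurd hr (by simp [below, h])⟩
    · obtain ⟨X, p, q, h, hp, hq⟩ := hT r (autRestrict r α)
      exact ⟨X, p, q, h, fun h => absurd h hr, fun _ => ⟨hp, hq⟩⟩
  choose X p q hpq hp hpqT using hfactor
  obtain ⟨β, hβ₁, hβ₂⟩ : ∃ β : ∀ z, ρ.below n z → (Q.obj z ⟶ P.obj z),
      (∀ z hz, α.app z ≫ β z hz = 𝟙 _) ∧ ∀ z hz, β z hz ≫ α.app z = 𝟙 _ :=
    ⟨fun z hz => have := hα z hz; inv (α.app z),
      fun z hz => have := hα z hz; IsIso.hom_inv_id _,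
      fun z hz => have := hα z hz; IsIso.inv_hom_id _⟩
  have hβ : ∀ {z w : R} (hz : ρ.below n z) (hw : ρ.below n w) (f : z ⟶ w),
      Q.map f ≫ β w hw = β z hz ≫ P.map f := fun {z w} hz hw f => by
    have e : β z hz ≫ α.app z ≫ Q.map f ≫ β w hw = β z hz ≫ P.map f := by
      rw [← α.naturality_assoc, hβ₁, Category.comp_id]
    rw [← e, reassoc_of% (hβ₂ z hz)]
  -- The factorization is first glued over the objects of degree at most `n`; its extension to all
  -- of `R` is then the one left orthogonal to the maps invertible on `D`.
  let D := ρ.below (n + 1)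
  obtain ⟨Z, p', q', h₁, h₂, h₃⟩ := exists_glued_factorization
    (fun c : D.FullSubcategory => autFunctor D.ι c ⋙ X c.obj)
    (fun c => ρ.below n c.obj) (Functor.whiskerLeft D.ι α) (fun z hz => β z.obj hz)
    (fun z hz => hβ₁ z.obj hz) (fun z hz => hβ₂ z.obj hz)
    (fun a b a' b' hz hz' h => ρ.map_inv_map_eq β hβ a.hom b.hom a'.hom b'.hom hz hz'
      (congrArg (fun f => f.hom) h))
    (fun {c d} f => by
      by_cases hc : ρ.below n c.obj
      · exact Or.inl ⟨c, 𝟙 c, f, hc, Category.id_comp f⟩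
      by_cases hd : ρ.below n d.obj
      · exact Or.inl ⟨d, f, 𝟙 d, hd, Category.comp_id f⟩
      have hcd : ρ.deg c.obj = ρ.deg d.obj := by
        have hc' := c.property
        have hd' := d.property
        simp only [D, below] at hc hd hc' hd'
        omega
      by_cases hf : IsIso f.hom
      · exact Or.inr ((D.isIso_hom_iff f).1 hf)
      · obtain ⟨z, a, b, hz, hab⟩ := ρ.exists_fac_of_not_isIso f.hom hcd hf
        have hz' : ρ.below n z := by
          have hc' := c.property
          simp only [D, below] at hc' ⊢
          omega
        exact Or.inl ⟨⟨z, ρ.below_mono n.le_succ _ hz'⟩, ObjectProperty.homMk a,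
          ObjectProperty.homMk b, hz', ObjectProperty.hom_ext _ hab⟩)
    (fun {c z} a b hz h => (ρ.deg_le_of_fac (ρ.minus_isMultiplicative.id_mem c.obj)
      (ρ.plus_isMultiplicative.id_mem c.obj) a.hom b.hom (by
        rw [Category.comp_id]; exact congrArg (fun f => f.hom) h)).trans_lt hz)
    (fun c => Functor.whiskerLeft (autFunctor D.ι c) (p c.obj))
    (fun c => Functor.whiskerLeft (autFunctor D.ι c) (q c.obj))
    (fun c => by
      refine NatTrans.ext (funext fun _ => ?_)
      exact congrArg (fun t => t.app (SingleObj.star _)) (hpq c.obj))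
    (fun c hc => by
      have := hp c.obj hc
      exact (NatTrans.isIso_iff_isIso_app _).2 fun x =>
        inferInstanceAs (IsIso ((p c.obj).app (SingleObj.star _))))
  obtain ⟨P', j, k, e, hjk, hj, hk, hD⟩ := exists_extension_leftOrth D α p' q' h₁
  have hj' : ∀ c : D.FullSubcategory, j.app c.obj = p'.app c ≫ e.inv.app c := fun c => by
    rw [← hj]
    simp
  have hk' : ∀ c : D.FullSubcategory, k.app c.obj = e.hom.app c ≫ q'.app c := fun c => by
    rw [← NatTrans.comp_app, hk]
    rfl
  have hrep : ∀ r, ρ.deg r = n → ∃ (d : R) (_ : r ≅ d), TL d (autRestrict d j) ∧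
      TR d (autRestrict d k) := by
    intro r hr
    obtain ⟨d, f, θ, hθ, hθ'⟩ := h₃ ⟨r, by simp [D, below, hr]⟩ (by simp [below, hr])
    have hd : ρ.deg d.obj = n := (ρ.deg_eq_of_iso (D.ι.mapIso f)).symm.trans hr
    refine ⟨d.obj, D.ι.mapIso f, ?_⟩
    -- `D` is full, so its automorphisms of `d` are those of `d.obj`, and the equivariant
    -- identification over `D` is one over `R`.
    let Θ : autInclusion d.obj ⋙ P' ≅ X d.obj :=
      NatIso.ofComponents (fun _ => e.app d ≪≫ θ.app (SingleObj.star _)) (fun {x y} g => by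
        let g' : d ≅ d := D.isoMk (show d.obj ≅ d.obj from g)
        have h₁ := e.hom.naturality g'.hom
        have h₂ := θ.hom.naturality
          (show SingleObj.star (Aut d) ⟶ SingleObj.star (Aut d) from g')
        refine (comp_comp_of_eq h₁ _).trans ?_
        refine (Category.assoc _ _ _).trans ?_
        refine (congrArg (e.hom.app d ≫ ·) h₂).trans ?_
        exact (Category.assoc _ _ _).symm)
    have hΘ : autRestrict d.obj j ≫ Θ.hom = p d.obj := by
      refine NatTrans.ext (funext fun _ => ?_)
      have h₁ := congrArg (fun t => t.app d) hj
      have h₂ := congrArg (fun t => t.app (SingleObj.star _)) hθ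
      exact (comp_comp_of_eq h₁ _).trans h₂
    have hΘ' : Θ.hom ≫ q d.obj = autRestrict d.obj k := by
      refine NatTrans.ext (funext fun _ => ?_)
      have h₁ := congrArg (fun t => t.app d) hk
      have h₂ := congrArg (fun t => t.app (SingleObj.star _)) hθ'
      refine (Category.assoc _ _ _).trans ?_
      exact (congrArg (e.hom.app d ≫ ·) h₂).trans h₁
    obtain ⟨t₁, t₂⟩ := hpqT d.obj hd
    refine ⟨?_, ?_⟩
    · rwa [← (TL d.obj).cancel_right_of_respectsIso _ Θ.hom, hΘ]
    · rwa [← hΘ', (TR d.obj).cancel_left_of_respectsIso]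
  refine ⟨P', j, k, hjk, hD, ?_, ?_⟩
  · intro s hs
    have := h₂ ⟨s, ρ.below_mono n.le_succ _ hs⟩ hs
    rw [hj' ⟨s, ρ.below_mono n.le_succ _ hs⟩]
    infer_instance
  · intro r hr
    obtain ⟨d, f, hd, hd'⟩ := hrep r hr
    -- The prescribed factorization is only realized at representatives; the two classes are then
    -- transported along the isomorphism.
    exact ⟨hTL f j hd, hTR f k hd'⟩

end Step


/-! ### Dependence of relative maps on lower degrees -/

section Invariance

variable {R : Type v} [SmallCategory R] (ρ : GeneralizedReedy R)
  {M : Type u} [Category.{v} M]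

/-- The latching diagram only involves objects of degree less than that of `r`. -/
lemma isIso_latchingMap [HasColimits M] (r : R) {Φ Ψ : R ⥤ M} (τ : Φ ⟶ Ψ)
    (hτ : IsoOn (ρ.below (ρ.deg r)) τ) : IsIso (ρ.latchingMap r τ) := by
  apply isIso_singleObj
  have : IsIso (Functor.whiskerLeft (ρ.latchingForget r) τ) :=
    (NatTrans.isIso_iff_isIso_app _).2 fun x => hτ x.obj x.deg_lt
  have e : ρ.latchingObjMap r τ = colimMap (Functor.whiskerLeft (ρ.latchingForget r) τ) :=
    colimit.hom_ext fun x => (ρ.latchingι_map τ x.arrow x.plus_arrow x.deg_lt).trans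
      (ι_colimMap (Functor.whiskerLeft (ρ.latchingForget r) τ) x).symm
  change IsIso (ρ.latchingObjMap r τ)
  rw [e]
  exact (colim.mapIso (asIso (Functor.whiskerLeft (ρ.latchingForget r) τ))).isIso_hom

lemma isIso_matchingMap [HasLimits M] (r : R) {Φ Ψ : R ⥤ M} (τ : Φ ⟶ Ψ)
    (hτ : IsoOn (ρ.below (ρ.deg r)) τ) : IsIso (ρ.matchingMap r τ) := by
  apply isIso_singleObj
  have : IsIso (Functor.whiskerLeft (ρ.matchingForget r) τ) :=
    (NatTrans.isIso_iff_isIso_app _).2 fun x => hτ x.obj x.deg_lt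
  have e : ρ.matchingObjMap r τ = limMap (Functor.whiskerLeft (ρ.matchingForget r) τ) :=
    limit.hom_ext fun x => (ρ.matchingObjMap_π τ x.arrow x.minus_arrow x.deg_lt).trans
      (limMap_π (Functor.whiskerLeft (ρ.matchingForget r) τ) x).symm
  change IsIso (ρ.matchingObjMap r τ)
  rw [e]
  exact (lim.mapIso (asIso (Functor.whiskerLeft (ρ.matchingForget r) τ))).isIso_hom

lemma isIso_relativeLatchingSourceMap [HasColimits M] (r : R) {Φ Ψ Φ' Ψ' : R ⥤ M}
    {τ : Φ ⟶ Ψ} {τ' : Φ' ⟶ Ψ'} {a : Φ ⟶ Φ'} {b : Ψ ⟶ Ψ'} (h : a ≫ τ' = τ ≫ b) [IsIso a]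
    (hb : IsoOn (ρ.below (ρ.deg r)) b) : IsIso (ρ.relativeLatchingSourceMap r h) := by
  have := ρ.isIso_latchingMap r b hb
  have := ρ.isIso_latchingMap r a fun _ _ => inferInstance
  have : IsIso (autRestrict r a) := (NatTrans.isIso_iff_isIso_app _).2 fun _ =>
    inferInstanceAs (IsIso (a.app r))
  exact pushout.map_isIso (ρ.latchingTo r Φ) (ρ.latchingMap r τ) (ρ.latchingTo r Φ')
    (ρ.latchingMap r τ') (autRestrict r a) (ρ.latchingMap r b) (ρ.latchingMap r a)
    (ρ.latchingTo_naturality r a) (by rw [← latchingMap_comp, ← latchingMap_comp, h])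

lemma isIso_relativeMatchingTargetMap [HasLimits M] (r : R) {Φ Ψ Φ' Ψ' : R ⥤ M}
    {τ : Φ ⟶ Ψ} {τ' : Φ' ⟶ Ψ'} {a : Φ ⟶ Φ'} {b : Ψ ⟶ Ψ'} (h : a ≫ τ' = τ ≫ b) [IsIso b]
    (ha : IsoOn (ρ.below (ρ.deg r)) a) : IsIso (ρ.relativeMatchingTargetMap r h) := by
  have := ρ.isIso_matchingMap r a ha
  have := ρ.isIso_matchingMap r b fun _ _ => inferInstance
  have : IsIso (autRestrict r b) := (NatTrans.isIso_iff_isIso_app _).2 fun _ =>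
    inferInstanceAs (IsIso (b.app r))
  exact pullback.map_isIso (ρ.matchingMap r τ) (ρ.toMatching r Ψ) (ρ.matchingMap r τ')
    (ρ.toMatching r Ψ') (ρ.matchingMap r a) (autRestrict r b) (ρ.matchingMap r b)
    (by rw [← matchingMap_comp, ← matchingMap_comp, h]) (ρ.toMatching_naturality r b)

/-- The relative latching map of `a` is invertible, and passing from `a` to `a ≫ t` does not change
its source, since `t` is invertible below `r`. What is left of the relative latching map is the
component of `t`. -/
lemma relativeLatchingMap_comp_iff [HasColimits M] [HasLimits M] (r : R)
    (T : MorphismProperty (SingleObj (Aut r) ⥤ M)) [T.RespectsIso] {A P Z : R ⥤ M} (a : A ⟶ P)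
    (t : P ⟶ Z) (ha : LeftOrth (ρ.below (ρ.deg r)) a) (ht : IsoOn (ρ.below (ρ.deg r)) t) :
    T (ρ.relativeLatchingMap r (a ≫ t)) ↔ T (autRestrict r t) := by
  have h : 𝟙 A ≫ a ≫ t = a ≫ t := Category.id_comp _
  have := ρ.isIso_relativeLatchingMap_of_leftOrth r a ha
  have := ρ.isIso_relativeLatchingSourceMap r h ht
  rw [← T.cancel_left_of_respectsIso (ρ.relativeLatchingSourceMap r h),
    relativeLatchingSourceMap_comp_map, T.cancel_left_of_respectsIso]

/-- Dually, `h` does not affect the target of the relative matching map, and that of `l` is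
invertible, so only the component of `h` remains. -/
lemma relativeMatchingMap_comp_iff [HasColimits M] [HasLimits M] (r : R)
    (T : MorphismProperty (SingleObj (Aut r) ⥤ M)) [T.RespectsIso] {Z Q Y : R ⥤ M} (h : Z ⟶ Q)
    (l : Q ⟶ Y) (hh : IsoOn (ρ.below (ρ.deg r)) h) (hl : RightOrth (ρ.below (ρ.deg r)) l) :
    T (ρ.relativeMatchingMap r (h ≫ l)) ↔ T (autRestrict r h) := by
  have w : h ≫ l = (h ≫ l) ≫ 𝟙 Y := (Category.comp_id _).symm
  have := ρ.isIso_relativeMatchingMap_of_rightOrth r l hl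
  have := ρ.isIso_relativeMatchingTargetMap r w hh
  rw [← T.cancel_right_of_respectsIso _ (ρ.relativeMatchingTargetMap r w),
    ← map_comp_relativeMatchingTargetMap, T.cancel_right_of_respectsIso]

end Invariance

/-! ### The factorizations as a sequential colimit -/

section Factorization

variable {R : Type v} [SmallCategory R] (ρ : GeneralizedReedy R)
  {M : Type u} [Category.{v} M]

lemma isoOn_of_comp_left {D : ObjectProperty R} {P Q S : R ⥤ M} {f : P ⟶ Q} {g : Q ⟶ S}
    (hf : IsoOn D f) (hfg : IsoOn D (f ≫ g)) : IsoOn D g := fun s hs => by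
  have := hf s hs
  have := hfg s hs
  rw [NatTrans.comp_app] at this
  exact IsIso.of_isIso_comp_left (f.app s) _

/-- The coprojections to the colimit of a sequence are invertible wherever the later maps of the
sequence are. -/
lemma isoOn_colimit_ι [HasColimits M] (D : ℕ → ObjectProperty R) (hD : Monotone D) (F : ℕ ⥤ R ⥤ M)
    (hF : ∀ n, IsoOn (D n) (F.map (homOfLE n.le_succ))) (n : ℕ) :
    IsoOn (D n) (colimit.ι F n) := by
  intro s hs
  have h : ∀ m (hm : n ≤ m), IsIso ((F.map (homOfLE hm)).app s) := by
    intro m hm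
    induction m, hm using Nat.le_induction with
    | base =>
      have : homOfLE (le_refl n) = 𝟙 n := rfl
      rw [this, F.map_id]
      infer_instance
    | succ m hm ih =>
      have : homOfLE (hm.trans m.le_succ) = homOfLE hm ≫ homOfLE m.le_succ := rfl
      have := hF m s (hD hm _ hs)
      rw [‹homOfLE (hm.trans m.le_succ) = _›, F.map_comp, NatTrans.comp_app]
      infer_instance
  -- Colimits of diagrams are computed objectwise, and the sequence of values at `s` consists of
  -- isomorphisms from `n` on.
  have h' : (F ⋙ (evaluation R M).obj s).IsEventuallyConstantFrom n := fun m f => h m (leOfHom f)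
  exact h'.isIso_ι_of_isColimit
    (isColimitOfPreserves ((evaluation R M).obj s) (colimit.isColimit F))

/-- The colimit of a sequence of natural transformations over a fixed target, each of which is
invertible on a growing class of objects. -/
lemma exists_colimit_sequence [HasColimits M] (D : ℕ → ObjectProperty R) (hD : Monotone D)
    (P : ℕ → R ⥤ M) (j : ∀ n, P n ⟶ P (n + 1)) (hj : ∀ n, IsoOn (D n) (j n)) {Y : R ⥤ M}
    (b : ∀ n, P n ⟶ Y) (hb : ∀ n, j n ≫ b (n + 1) = b n) :
    ∃ (Z : R ⥤ M) (ι : ∀ n, P n ⟶ Z) (π : Z ⟶ Y), (∀ n, j n ≫ ι (n + 1) = ι n) ∧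
      (∀ n, ι n ≫ π = b n) ∧ ∀ n, IsoOn (D n) (ι n) := by
  have hF : ∀ n, (Functor.ofSequence j).map (homOfLE n.le_succ) = j n :=
    Functor.ofSequence_map_homOfLE_succ j
  let c : Cocone (Functor.ofSequence j) :=
    { pt := Y
      ι := NatTrans.ofSequence b (fun n => by
        rw [hF]
        exact (hb n).trans (Category.comp_id _).symm) }
  refine ⟨colimit (Functor.ofSequence j), colimit.ι (Functor.ofSequence j),
    colimit.desc (Functor.ofSequence j) c, fun n => ?_, colimit.ι_desc c,
    isoOn_colimit_ι D hD _ fun n => ?_⟩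
  · rw [← hF]
    exact colimit.w (Functor.ofSequence j) _
  · rw [hF]
    exact hj n

/-- Factorizations of maps with a group action extend to factorizations of natural
transformations, in terms of the relative latching and matching maps. -/
theorem exists_factorization_relative [HasColimits M] [HasLimits M]
    (TL TR : ∀ r : R, MorphismProperty (SingleObj (Aut r) ⥤ M))
    [∀ r, (TL r).RespectsIso] [∀ r, (TR r).RespectsIso]
    (hT : ∀ (r : R) {X Y : SingleObj (Aut r) ⥤ M} (f : X ⟶ Y),
      ∃ (Z : SingleObj (Aut r) ⥤ M) (i : X ⟶ Z) (p : Z ⟶ Y), i ≫ p = f ∧ TL r i ∧ TR r p)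
    (hTL : ∀ {r s : R} (_ : r ≅ s) {Φ Ψ : R ⥤ M} (τ : Φ ⟶ Ψ), TL s (autRestrict s τ) →
      TL r (autRestrict r τ))
    (hTR : ∀ {r s : R} (_ : r ≅ s) {Φ Ψ : R ⥤ M} (τ : Φ ⟶ Ψ), TR s (autRestrict s τ) →
      TR r (autRestrict r τ))
    {A Y : R ⥤ M} (f : A ⟶ Y) :
    ∃ (Z : R ⥤ M) (i : A ⟶ Z) (p : Z ⟶ Y), i ≫ p = f ∧
      (∀ r, TL r (ρ.relativeLatchingMap r i)) ∧ ∀ r, TR r (ρ.relativeMatchingMap r p) := by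
  have step : ∀ (n : ℕ) (s : {s : Factorisation f // LeftOrth (ρ.below n) s.ι}),
      ∃ (s' : {s : Factorisation f // LeftOrth (ρ.below (n + 1)) s.ι}) (j : s.1.mid ⟶ s'.1.mid),
        s.1.ι ≫ j = s'.1.ι ∧ j ≫ s'.1.π = s.1.π ∧ IsoOn (ρ.below n) j ∧
        ∃ (Q : R ⥤ M) (k : s'.1.mid ⟶ Q) (l : Q ⟶ Y), k ≫ l = s'.1.π ∧ IsoOn (ρ.below n) k ∧
          RightOrth (ρ.below n) l ∧
          ∀ r, ρ.deg r = n → TL r (autRestrict r j) ∧ TR r (autRestrict r k) := by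
    rintro n ⟨⟨P, a, b, hab⟩, ha⟩
    -- `Q` keeps `P` below degree `n` and is coskeletal over `Y` from there on, while `P` is
    -- skeletal relative to `A`. In degree `n`, `α` is thus the map to be factored.
    obtain ⟨Q, α, l, hαl, hα, hl⟩ := exists_factorization_rightOrth (ρ.below n) b
    obtain ⟨P', j, k, hjk, hj, hj', h⟩ :=
      ρ.exists_factorization_step n TL TR hT hTL hTR α hα
    have hb : j ≫ k ≫ l = b := by rw [reassoc_of% hjk, hαl]
    refine ⟨⟨⟨P', a ≫ j, k ≫ l, by rw [Category.assoc, hb, hab]⟩, ?_⟩, j, rfl, hb, hj', Q, k, l,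
      rfl, ?_, hl, h⟩
    · exact LeftOrth.comp (ha.mono (ρ.below_mono n.le_succ)) hj
    · exact isoOn_of_comp_left hj' (hjk ▸ hα)
  choose next hnext using step
  -- The sequence starts with `A` itself, the identity being orthogonal to everything.
  let s : ∀ n, {s : Factorisation f // LeftOrth (ρ.below n) s.ι} := fun n =>
    Nat.rec ⟨Factorisation.initial, fun _ _ => UniqueLift.id_left _⟩ next n
  obtain ⟨P, a, b, ha, hab, step⟩ : ∃ (P : ℕ → R ⥤ M) (a : ∀ n, A ⟶ P n) (b : ∀ n, P n ⟶ Y),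
      (∀ n, LeftOrth (ρ.below n) (a n)) ∧ (∀ n, a n ≫ b n = f) ∧
      ∀ n, ∃ (j : P n ⟶ P (n + 1)), a n ≫ j = a (n + 1) ∧ j ≫ b (n + 1) = b n ∧
        IsoOn (ρ.below n) j ∧ ∃ (Q : R ⥤ M) (k : P (n + 1) ⟶ Q) (l : Q ⟶ Y), k ≫ l = b (n + 1) ∧
          IsoOn (ρ.below n) k ∧ RightOrth (ρ.below n) l ∧
          ∀ r, ρ.deg r = n → TL r (autRestrict r j) ∧ TR r (autRestrict r k) :=
    ⟨fun n => (s n).1.mid, fun n => (s n).1.ι, fun n => (s n).1.π, fun n => (s n).2,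
      fun n => (s n).1.ι_π, fun n => hnext n (s n)⟩
  choose j haj hjb hj Q k l hkl hk hl hjk using step
  obtain ⟨Z, ι, π, hjι, hιπ, hι⟩ :=
    exists_colimit_sequence ρ.below (fun _ _ h => ρ.below_mono h) P j hj b hjb
  have hi : ∀ n, a n ≫ ι n = a 0 ≫ ι 0 := by
    intro n
    induction n with
    | zero => rfl
    | succ n ih => rw [← ih, ← haj, Category.assoc, hjι]
  have hιr : ∀ r, IsIso (autRestrict r (ι (ρ.deg r + 1))) := fun r =>
    isIso_singleObj _ (hι (ρ.deg r + 1) r (Nat.lt_succ_self _))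
  refine ⟨Z, a 0 ≫ ι 0, π, by rw [Category.assoc, hιπ, hab], fun r => ?_, fun r => ?_⟩
  · have := hιr r
    -- In degree `n`, the map from `P n` to the colimit is `j n` followed by a map invertible at
    -- `r`, so the relative latching map is `j n` up to isomorphism.
    rw [← hi (ρ.deg r), ρ.relativeLatchingMap_comp_iff r (TL r) _ _ (ha _) (hι _),
      ← hjι, autRestrict_comp, (TL r).cancel_right_of_respectsIso]
    exact (hjk _ r rfl).1
  · have := hιr r
    have hι' : IsoOn (ρ.below (ρ.deg r)) (ι (ρ.deg r + 1)) := fun x hx =>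
      hι (ρ.deg r + 1) x (ρ.below_mono (Nat.le_succ _) _ hx)
    -- Right orthogonality of `l` extends `k` from `P (n + 1)` to the colimit over `Y`, with `n =
    -- deg r`. This presents `π` as a map invertible below `n` followed by `l`, and at `r` the
    -- extension agrees with `k` up to isomorphism.
    obtain ⟨h, ⟨hh, hh'⟩, -⟩ := hl (ρ.deg r) (ι (ρ.deg r + 1)) hι' (k (ρ.deg r)) π
      ((hkl _).trans (hιπ _).symm)
    rw [← hh', ρ.relativeMatchingMap_comp_iff r (TR r) _ _
      (isoOn_of_comp_left hι' (hh ▸ hk (ρ.deg r))) (hl _),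
      ← (TR r).cancel_left_of_respectsIso (autRestrict r (ι (ρ.deg r + 1))),
      ← autRestrict_comp, hh]
    exact (hjk _ r rfl).2

end Factorization

end GeneralizedReedy

/-! ### Transport between isomorphic objects -/

namespace CategoryTheory

/-- The equivalence between the automorphism groups of isomorphic objects. -/
def autEquivalence {C : Type*} [Category C] {c d : C} (e : c ≅ d) :
    SingleObj (Aut c) ≌ SingleObj (Aut d) :=
  (Aut.autMulEquivOfIso e).toSingleObjEquiv

/-- The automorphism groups of isomorphic objects are included compatibly with their
equivalence. -/
def autInclusionIso {C : Type*} [Category C] {c d : C} (e : c ≅ d) :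
    autInclusion c ≅ (autEquivalence e).functor ⋙ autInclusion d :=
  NatIso.ofComponents (fun _ => e) (fun {x y} g => by
    change Iso.hom (show c ≅ c from g) ≫ e.hom =
      e.hom ≫ e.inv ≫ Iso.hom (show c ≅ c from g) ≫ e.hom
    rw [Iso.hom_inv_id_assoc])

/-- Conjugation by `e` identifies the two automorphism groups, and the values of the diagrams at `e`
give an equivariant isomorphism of arrows. -/
lemma autRestrict_iff_of_iso {R : Type*} [Category R] {M : Type*} [Category M] {r s : R}
    (e : r ≅ s) {Φ Ψ : R ⥤ M} (τ : Φ ⟶ Ψ) (T : MorphismProperty (SingleObj (Aut r) ⥤ M))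
    [T.RespectsIso] :
    T (autRestrict r τ) ↔ T (Functor.whiskerLeft (autEquivalence e).functor (autRestrict s τ)) := by
  have w : (Functor.isoWhiskerRight (autInclusionIso e) Φ).hom ≫
        Functor.whiskerLeft (autEquivalence e).functor (autRestrict s τ) =
      autRestrict r τ ≫ (Functor.isoWhiskerRight (autInclusionIso e) Ψ).hom :=
    NatTrans.ext (funext fun _ => τ.naturality e.hom)
  exact T.arrow_mk_iso_iff (Arrow.isoMk' (autRestrict r τ)
    (Functor.whiskerLeft (autEquivalence e).functor (autRestrict s τ))
    (Functor.isoWhiskerRight (autInclusionIso e) Φ)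
    (Functor.isoWhiskerRight (autInclusionIso e) Ψ) w)

end CategoryTheory

section Transport

variable {R : Type v} [SmallCategory R] {M : Type u} [Category.{v} M] [ModelCategory M]
  [∀ r : R, ModelCategory (SingleObj (Aut r) ⥤ M)]
  [∀ r : R, IsInjectiveModelStructure (SingleObj (Aut r)) M]

open GeneralizedReedy

lemma cofibration_autRestrict_iff (r : R) {Φ Ψ : R ⥤ M} (τ : Φ ⟶ Ψ) :
    Cofibration (autRestrict r τ) ↔ Cofibration (τ.app r) :=
  cofibration_iff_star _

lemma weakEquivalence_autRestrict_of_iso {r s : R} (e : r ≅ s) {Φ Ψ : R ⥤ M} (τ : Φ ⟶ Ψ)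
    (h : WeakEquivalence (autRestrict s τ)) : WeakEquivalence (autRestrict r τ) := by
  rw [weakEquivalence_autRestrict_iff, weakEquivalence_iff] at h ⊢
  rwa [← (weakEquivalences M).cancel_right_of_respectsIso _ (Ψ.map e.hom), ← τ.naturality,
    (weakEquivalences M).cancel_left_of_respectsIso]

lemma cofibration_autRestrict_of_iso {r s : R} (e : r ≅ s) {Φ Ψ : R ⥤ M} (τ : Φ ⟶ Ψ)
    (h : Cofibration (autRestrict s τ)) : Cofibration (autRestrict r τ) := by
  rw [cofibration_autRestrict_iff, cofibration_iff] at h ⊢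
  rwa [← (cofibrations M).cancel_right_of_respectsIso _ (Ψ.map e.hom), ← τ.naturality,
    (cofibrations M).cancel_left_of_respectsIso]

/-- Unlike the other two classes, injective fibrations are not defined objectwise. They are
transported by lifting: the equivalence of diagram categories preserves trivial cofibrations, since
these are objectwise. -/
lemma fibration_autRestrict_of_iso {r s : R} (e : r ≅ s) {Φ Ψ : R ⥤ M} (τ : Φ ⟶ Ψ)
    (h : Fibration (autRestrict s τ)) : Fibration (autRestrict r τ) := by
  rw [fibration_iff]
  refine (autRestrict_iff_of_iso e τ _).2 ?_
  rw [← MorphismProperty.rlp_eq_of_wfs (trivialCofibrations (SingleObj (Aut r) ⥤ M))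
    (fibrations (SingleObj (Aut r) ⥤ M))]
  intro X Y j hj
  have adj := ((autEquivalence e).congrLeft (E := M)).toAdjunction
  have : HasLiftingProperty (((autEquivalence e).congrLeft (E := M)).functor.map j)
      (autRestrict s τ) := by
    have hj' := (mem_trivialCofibrations_iff j).1 hj
    have : Cofibration (((autEquivalence e).congrLeft (E := M)).functor.map j) :=
      (IsInjectiveModelStructure.cofibration_iff_app _).2 fun x =>
        (IsInjectiveModelStructure.cofibration_iff_app _).1 hj'.1 _
    have : WeakEquivalence (((autEquivalence e).congrLeft (E := M)).functor.map j) :=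
      (IsInjectiveModelStructure.weakEquivalence_iff_app _).2 fun x =>
        (IsInjectiveModelStructure.weakEquivalence_iff_app _).1 hj'.2 _
    infer_instance
  exact (adj.hasLiftingProperty_iff _ _).1 this

end Transport

/-! ### The Reedy model structure -/

namespace DualizableGeneralizedReedy

variable {R : Type v} [SmallCategory R] (ρ : DualizableGeneralizedReedy R)
  (M : Type u) [Category.{v} M] [ModelCategory M]
  [∀ r : R, ModelCategory (SingleObj (Aut r) ⥤ M)]

/-- The weak equivalences of the Reedy model structure. -/
def reedyWeakEquivalences : MorphismProperty (R ⥤ M) :=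
  fun _ _ τ => ∀ r : R, WeakEquivalence (autRestrict r τ)

/-- The cofibrations of the Reedy model structure. -/
def reedyCofibrations [HasColimits M] : MorphismProperty (R ⥤ M) :=
  fun _ _ τ => ∀ r : R, Cofibration (ρ.relativeLatchingMap r τ)

/-- The fibrations of the Reedy model structure. -/
def reedyFibrations [HasLimits M] : MorphismProperty (R ⥤ M) :=
  fun _ _ τ => ∀ r : R, Fibration (ρ.relativeMatchingMap r τ)

instance : (reedyWeakEquivalences (R := R) M).IsStableUnderRetracts where
  of_retract {_ _ _ _ f g} h hg r := by
    have := hg r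
    rw [weakEquivalence_iff] at this ⊢
    exact MorphismProperty.of_retract
      (h.map ((Functor.whiskeringLeft _ _ M).obj (autInclusion r))) this

instance : (reedyWeakEquivalences (R := R) M).HasTwoOutOfThreeProperty where
  comp_mem f g hf hg r := by
    have := hf r
    have := hg r
    exact inferInstanceAs (WeakEquivalence (autRestrict r f ≫ autRestrict r g))
  of_postcomp f g hg hfg r := by
    have := hg r
    have : WeakEquivalence (autRestrict r f ≫ autRestrict r g) := hfg r
    exact weakEquivalence_of_postcomp (autRestrict r f) (autRestrict r g)
  of_precomp f g hf hfg r := by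
    have := hf r
    have : WeakEquivalence (autRestrict r f ≫ autRestrict r g) := hfg r
    exact weakEquivalence_of_precomp (autRestrict r f) (autRestrict r g)

instance [HasColimits M] : (ρ.reedyCofibrations M).IsStableUnderRetracts where
  of_retract h hg r := by
    have := hg r
    rw [cofibration_iff] at this ⊢
    exact MorphismProperty.of_retract (ρ.retractRelativeLatchingMap r h) this

instance [HasLimits M] : (ρ.reedyFibrations M).IsStableUnderRetracts where
  of_retract h hg r := by
    have := hg r
    rw [fibration_iff] at this ⊢
    exact MorphismProperty.of_retract (ρ.retractRelativeMatchingMap r h) this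

variable [∀ r : R, IsInjectiveModelStructure (SingleObj (Aut r)) M] [HasLimits M] [HasColimits M]

/-- Both factorization and lifting are solved by relative maps that are injective cofibrations and
trivial fibrations; the comparison of weak equivalences for matching maps translates the latter into
trivial Reedy fibrations. Closure under retracts does the rest. -/
instance : MorphismProperty.IsWeakFactorizationSystem (ρ.reedyCofibrations M)
    (ρ.reedyFibrations M ⊓ reedyWeakEquivalences M) :=
  have : MorphismProperty.HasFactorization (ρ.reedyCofibrations M)
      (ρ.reedyFibrations M ⊓ reedyWeakEquivalences M) := ⟨fun {X Y} f => by
    obtain ⟨Z, i, p, h, hi, hp⟩ := ρ.exists_factorization_relative (M := M)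
      (fun r => cofibrations _) (fun r => trivialFibrations _) (fun r _ _ f =>
        have d := MorphismProperty.factorizationData (cofibrations (SingleObj (Aut r) ⥤ M))
          (trivialFibrations (SingleObj (Aut r) ⥤ M)) f
        ⟨d.Z, d.i, d.p, d.fac, d.hi, d.hp⟩)
      (fun e _ _ τ hτ => (cofibration_iff _).1
        (cofibration_autRestrict_of_iso e τ ((cofibration_iff _).2 hτ)))
      (fun e _ _ τ hτ => (mem_trivialFibrations_iff _).2
        ⟨fibration_autRestrict_of_iso e τ ((mem_trivialFibrations_iff _).1 hτ).1,
          weakEquivalence_autRestrict_of_iso e τ ((mem_trivialFibrations_iff _).1 hτ).2⟩) f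
    have hp₁ : ρ.reedyFibrations M p := fun r => ((mem_trivialFibrations_iff _).1 (hp r)).1
    exact ⟨⟨Z, i, p, h, fun r => (cofibration_iff _).2 (hi r), hp₁,
      (ρ.weakEquivalence_relativeMatchingMap_iff p hp₁).1
        fun r => ((mem_trivialFibrations_iff _).1 (hp r)).2⟩⟩⟩
  .mk' _ _ fun i p hi hp => ρ.hasLiftingProperty_of_relative i p fun r => by
    have := hi r
    have := hp.1 r
    have := (ρ.weakEquivalence_relativeMatchingMap_iff p hp.1).2 hp.2 r
    infer_instance

/-- The same argument with the trivial class on the latching side, so the comparison for latching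
maps is needed here; it rests on dualizability. -/
instance : MorphismProperty.IsWeakFactorizationSystem
    (ρ.reedyCofibrations M ⊓ reedyWeakEquivalences M) (ρ.reedyFibrations M) :=
  have : MorphismProperty.HasFactorization (ρ.reedyCofibrations M ⊓ reedyWeakEquivalences M)
      (ρ.reedyFibrations M) := ⟨fun {X Y} f => by
    obtain ⟨Z, i, p, h, hi, hp⟩ := ρ.exists_factorization_relative (M := M)
      (fun r => trivialCofibrations _) (fun r => fibrations _) (fun r _ _ f =>
        have d := MorphismProperty.factorizationData
          (trivialCofibrations (SingleObj (Aut r) ⥤ M)) (fibrations (SingleObj (Aut r) ⥤ M)) f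
        ⟨d.Z, d.i, d.p, d.fac, d.hi, d.hp⟩)
      (fun e _ _ τ hτ => (mem_trivialCofibrations_iff _).2
        ⟨cofibration_autRestrict_of_iso e τ ((mem_trivialCofibrations_iff _).1 hτ).1,
          weakEquivalence_autRestrict_of_iso e τ ((mem_trivialCofibrations_iff _).1 hτ).2⟩)
      (fun e _ _ τ hτ => (fibration_iff _).1
        (fibration_autRestrict_of_iso e τ ((fibration_iff _).2 hτ))) f
    have hi₁ : ρ.reedyCofibrations M i := fun r => ((mem_trivialCofibrations_iff _).1 (hi r)).1
    exact ⟨⟨Z, i, p, h, ⟨hi₁, (ρ.weakEquivalence_relativeLatchingMap_iff i hi₁).1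
      fun r => ((mem_trivialCofibrations_iff _).1 (hi r)).2⟩,
      fun r => (fibration_iff _).2 (hp r)⟩⟩⟩
  .mk' _ _ fun i p hi hp => ρ.hasLiftingProperty_of_relative i p fun r => by
    have := hp r
    have := hi.1 r
    have := (ρ.weakEquivalence_relativeLatchingMap_iff i hi.1).2 hi.2 r
    infer_instance

/-- The Reedy model structure on diagrams indexed by a dualizable generalized Reedy category. -/
noncomputable abbrev reedyModelCategory : ModelCategory (R ⥤ M) :=
  letI : CategoryWithWeakEquivalences (R ⥤ M) := ⟨reedyWeakEquivalences M⟩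
  letI : CategoryWithCofibrations (R ⥤ M) := ⟨ρ.reedyCofibrations M⟩
  letI : CategoryWithFibrations (R ⥤ M) := ⟨ρ.reedyFibrations M⟩
  have : (weakEquivalences (R ⥤ M)).HasTwoOutOfThreeProperty :=
    inferInstanceAs (reedyWeakEquivalences M).HasTwoOutOfThreeProperty
  have : MorphismProperty.IsWeakFactorizationSystem (cofibrations (R ⥤ M))
      (trivialFibrations (R ⥤ M)) :=
    inferInstanceAs (MorphismProperty.IsWeakFactorizationSystem (ρ.reedyCofibrations M)
      (ρ.reedyFibrations M ⊓ reedyWeakEquivalences M))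
  have : MorphismProperty.IsWeakFactorizationSystem (trivialCofibrations (R ⥤ M))
      (fibrations (R ⥤ M)) :=
    inferInstanceAs (MorphismProperty.IsWeakFactorizationSystem
      (ρ.reedyCofibrations M ⊓ reedyWeakEquivalences M) (ρ.reedyFibrations M))
  ModelCategory.mk' _

end DualizableGeneralizedReedy

theorem theorem5p14 {R : Type v} [SmallCategory R] (ρ : DualizableGeneralizedReedy R)
    {M : Type u} [Category.{v} M] [HasLimits M] [HasColimits M] [ModelCategory M]
    [∀ r : R, ModelCategory (SingleObj (Aut r) ⥤ M)]
    [∀ r : R, IsInjectiveModelStructure (SingleObj (Aut r)) M] :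
    HasLimits (R ⥤ M) ∧ HasColimits (R ⥤ M) ∧
      ∃ _ : ModelCategory (R ⥤ M), ∀ {Φ Ψ : R ⥤ M} (τ : Φ ⟶ Ψ),
        (WeakEquivalence τ ↔ ∀ r : R, WeakEquivalence (autRestrict r τ)) ∧
        (Cofibration τ ↔ ∀ r : R, Cofibration (ρ.relativeLatchingMap r τ)) ∧
        (Fibration τ ↔ ∀ r : R, Fibration (ρ.relativeMatchingMap r τ)) := by
  refine ⟨inferInstance, inferInstance, ρ.reedyModelCategory M, fun τ => ⟨?_, ?_, ?_⟩⟩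
  · rw [weakEquivalence_iff]
    rfl
  · rw [cofibration_iff]
    rfl
  · rw [fibration_iff]
    rfl
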